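/- Let $M$ be a closed (compact, boundaryless) smooth Riemannian manifold of dimension $d$, and let $1\le r\le\infty$. A $C^r$ diffeomorphism $f$ of $M$ is partially hyperbolic if $TM$ has a continuous $Df$-invariant splitting $TM=E^{ss}_f\oplus E^c_f\oplus E^{uu}_f$ into three non-trivial subbundles such that for some $\ell>0$, all $x\in M$ and all unit vectors $v^{\sigma}\in E^{\sigma}_f(x)$, $\sigma = ss,c,uu$, $$\|Df^\ell v^{ss}\|<\min\{1,\|Df^\ell v^c\|\}\le\max\{1,\|Df^\ell v^c\|\}<\|Df^\ell v^{uu}\|.$$ Put $E^{cs}_f=E^{ss}_f\oplus E^c_f$ and $E^{cu}_f=E^c_f\oplus E^{uu}_f$. For a diffeomorphism $h$ of $M$, $f$ is called $h$-transverse to $g$ if, in every tangent space, $Dh(E^{uu}_f)$ is a complement of $E^{cs}_g$ and $Dh^{-1}(E^{ss}_g)$ is a complement of $E^{cu}_f$. Two $C^r$ diffeomorphisms are called isotopic if they are joined by a path of $C^r$ diffeomorphisms that is continuous in the $C^1$ topology. Let $\{f_t\}_{t\in[0,1]}$ be a path of partially hyperbolic $C^r$ diffeomorphisms of $M$, continuous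 in the $C^1$ topology, with splittings chosen so that the ranks of $E^{ss}_{f_t}$ and $E^{uu}_{f_t}$ at each point do not depend on $t$; put $f=f_0$ and $g=f_1$. Then for every sufficiently large $N$ there is a $C^r$ diffeomorphism $h$ of $M$ such that $f$ is $h$-transverse to $g$ and $h$ is isotopic to $f^N$. In particular, if $f$ is isotopic to the identity, then so are $g$ and $h$. Moreover, let each $f_t$ preserve a smooth volume $\mathrm{vol}_t$ (a measure with smooth positive density in charts) that varies smoothly with $t\in[0,1]$, where $\mathrm{vol}_0$ and $\mathrm{vol}_1$ give the same volume to each connected component of $M$ (if $M$ is connected: the same total volume). Then for every sufficiently large $N$ the diffeomorphism $h$ can be chosen so that, in addition to all of the above, it maps $\mathrm{vol}_0$ to $\mathrm{vol}_1$. -/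

import Mathlib

open scoped Manifold ContDiff
open MeasureTheory

/-- A continuous subbundle of the tangent bundle of `M`: a family of subspaces of the tangent spaces
that near every point is spanned by a continuous frame. -/
def IsContinuousSubbundle {d : ℕ} {M : Type*} [TopologicalSpace M]
    [ChartedSpace (EuclideanSpace ℝ (Fin d)) M] [IsManifold (𝓡 d) ∞ M]
    (E : (x : M) → Submodule ℝ (TangentSpace (𝓡 d) x)) : Prop :=
  ∀ x₀ : M, ∃ U ∈ nhds x₀, ∃ (k : ℕ) (X : Fin k → (x : M) → TangentSpace (𝓡 d) x),
    (∀ i, ContinuousOn (fun x => (⟨x, X i x⟩ : TangentBundle (𝓡 d) M)) U) ∧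
    ∀ x ∈ U, LinearIndependent ℝ (fun i => X i x) ∧
      Submodule.span ℝ (Set.range fun i => X i x) = E x

/-- The length of a tangent vector for a Riemannian metric. -/
noncomputable def riemNorm {d : ℕ} {M : Type*} [TopologicalSpace M]
    [ChartedSpace (EuclideanSpace ℝ (Fin d)) M] [IsManifold (𝓡 d) ∞ M]
    (γ : Bundle.ContMDiffRiemannianMetric (𝓡 d) ∞ (EuclideanSpace ℝ (Fin d))
      (fun x : M => TangentSpace (𝓡 d) x))
    {x : M} (v : TangentSpace (𝓡 d) x) : ℝ :=
  Real.sqrt (γ.inner x v v)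

/-- A partially hyperbolic splitting `TM = Ess ⊕ Ec ⊕ Euu` for a diffeomorphism `f` of a
Riemannian manifold `(M, γ)`; the diffeomorphism is partially hyperbolic if it has one. -/
structure PartiallyHyperbolicSplitting {d : ℕ} {M : Type*} [TopologicalSpace M]
    [ChartedSpace (EuclideanSpace ℝ (Fin d)) M] [IsManifold (𝓡 d) ∞ M] {r : ℕ∞}
    (γ : Bundle.ContMDiffRiemannianMetric (𝓡 d) ∞ (EuclideanSpace ℝ (Fin d))
      (fun x : M => TangentSpace (𝓡 d) x))
    (f : Diffeomorph (𝓡 d) (𝓡 d) M M r) where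
  /-- the strong stable bundle -/
  Ess : (x : M) → Submodule ℝ (TangentSpace (𝓡 d) x)
  /-- the center bundle -/
  Ec : (x : M) → Submodule ℝ (TangentSpace (𝓡 d) x)
  /-- the strong unstable bundle -/
  Euu : (x : M) → Submodule ℝ (TangentSpace (𝓡 d) x)
  ess_continuous : IsContinuousSubbundle Ess
  ec_continuous : IsContinuousSubbundle Ec
  euu_continuous : IsContinuousSubbundle Euu
  ess_nontrivial : ∀ x, Ess x ≠ ⊥
  ec_nontrivial : ∀ x, Ec x ≠ ⊥
  euu_nontrivial : ∀ x, Euu x ≠ ⊥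
  /-- together with the next field: the tangent space is the direct sum of the three subspaces -/
  disjoint_ess_ec : ∀ x, Disjoint (Ess x) (Ec x)
  isCompl_cs_uu : ∀ x, IsCompl (Ess x ⊔ Ec x) (Euu x)
  ess_invariant : ∀ x, (Ess x).map (mfderiv (𝓡 d) (𝓡 d) f x).toLinearMap = Ess (f x)
  ec_invariant : ∀ x, (Ec x).map (mfderiv (𝓡 d) (𝓡 d) f x).toLinearMap = Ec (f x)
  euu_invariant : ∀ x, (Euu x).map (mfderiv (𝓡 d) (𝓡 d) f x).toLinearMap = Euu (f x)
  hyperbolic : ∃ l : ℕ, 0 < l ∧ ∀ x : M, ∀ vs ∈ Ess x, ∀ vc ∈ Ec x, ∀ vu ∈ Euu x,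
    riemNorm γ vs = 1 → riemNorm γ vc = 1 → riemNorm γ vu = 1 →
      riemNorm γ (mfderiv (𝓡 d) (𝓡 d) f^[l] x vs) <
          min 1 (riemNorm γ (mfderiv (𝓡 d) (𝓡 d) f^[l] x vc)) ∧
      max 1 (riemNorm γ (mfderiv (𝓡 d) (𝓡 d) f^[l] x vc)) <
          riemNorm γ (mfderiv (𝓡 d) (𝓡 d) f^[l] x vu)

/-- `f` (with splitting `S`) is `h`-transverse to `g` (with splitting `T`): the bundle
`Dh(Euu_f)` is transverse to `Ecs_g = Ess_g ⊕ Ec_g`, and `Dh⁻¹(Ess_g)` is transverse to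
`Ecu_f = Ec_f ⊕ Euu_f`. Transverse means complementary in every tangent space; when the bundles of
`f` and `g` have the same ranks this is the same as spanning every tangent space. -/
def HTransverse {d : ℕ} {M N : Type*} [TopologicalSpace M]
    [ChartedSpace (EuclideanSpace ℝ (Fin d)) M] [IsManifold (𝓡 d) ∞ M] [TopologicalSpace N]
    [ChartedSpace (EuclideanSpace ℝ (Fin d)) N] [IsManifold (𝓡 d) ∞ N] {r : ℕ∞}
    {γ : Bundle.ContMDiffRiemannianMetric (𝓡 d) ∞ (EuclideanSpace ℝ (Fin d))
      (fun x : M => TangentSpace (𝓡 d) x)}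
    {γ' : Bundle.ContMDiffRiemannianMetric (𝓡 d) ∞ (EuclideanSpace ℝ (Fin d))
      (fun x : N => TangentSpace (𝓡 d) x)}
    {f : Diffeomorph (𝓡 d) (𝓡 d) M M r} {g : Diffeomorph (𝓡 d) (𝓡 d) N N r}
    (S : PartiallyHyperbolicSplitting γ f) (T : PartiallyHyperbolicSplitting γ' g)
    (h : Diffeomorph (𝓡 d) (𝓡 d) M N r) : Prop :=
  (∀ x : M, IsCompl ((S.Euu x).map (mfderiv (𝓡 d) (𝓡 d) h x).toLinearMap)
      (T.Ess (h x) ⊔ T.Ec (h x))) ∧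
  (∀ y : N, IsCompl ((T.Ess y).map (mfderiv (𝓡 d) (𝓡 d) h.symm y).toLinearMap)
      (S.Ec (h.symm y) ⊔ S.Euu (h.symm y)))

/-- A path `F t`, `t ∈ [0,1]`, of diffeomorphisms that is continuous for the `C^1` topology:
the tangent map of `F t` at a tangent vector `v` depends continuously on `(t, v)`. -/
def IsC1Path {d : ℕ} {M : Type*} [TopologicalSpace M]
    [ChartedSpace (EuclideanSpace ℝ (Fin d)) M] [IsManifold (𝓡 d) ∞ M] {r : ℕ∞}
    (F : unitInterval → Diffeomorph (𝓡 d) (𝓡 d) M M r) : Prop :=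
  Continuous fun p : unitInterval × TangentBundle (𝓡 d) M =>
    tangentMap (𝓡 d) (𝓡 d) (F p.1) p.2

/-- Two maps are `C^r`-isotopic if they are joined by a path of `C^r` diffeomorphisms that is
continuous for the `C^1` topology. -/
def DiffIsotopic (d : ℕ) {M : Type*} [TopologicalSpace M]
    [ChartedSpace (EuclideanSpace ℝ (Fin d)) M] [IsManifold (𝓡 d) ∞ M] (r : ℕ∞)
    (a b : M → M) : Prop :=
  ∃ F : unitInterval → Diffeomorph (𝓡 d) (𝓡 d) M M r, IsC1Path F ∧ ⇑(F 0) = a ∧ ⇑(F 1) = b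

/-- A family of smooth volumes on `M` varying smoothly with `t ∈ [0,1]`: in each of the charts
covering `M`, the measure `vol t` has a positive density with respect to Lebesgue measure that is
jointly smooth in `t` and in the coordinates. -/
def IsSmoothVolumeFamily (d : ℕ) {M : Type*} [TopologicalSpace M]
    [ChartedSpace (EuclideanSpace ℝ (Fin d)) M] [IsManifold (𝓡 d) ∞ M] [MeasurableSpace M]
    (vol : unitInterval → Measure M) : Prop :=
  ∀ x₀ : M, ∃ ρ : ℝ × EuclideanSpace ℝ (Fin d) → ℝ,
    ContDiffOn ℝ ∞ ρ (Set.Icc 0 1 ×ˢ (extChartAt (𝓡 d) x₀).target) ∧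
    (∀ p ∈ Set.Icc (0 : ℝ) 1 ×ˢ (extChartAt (𝓡 d) x₀).target, 0 < ρ p) ∧
    ∀ t : unitInterval, ∀ s : Set M, MeasurableSet s → s ⊆ (extChartAt (𝓡 d) x₀).source →
      vol t s = ∫⁻ y in extChartAt (𝓡 d) x₀ '' s, ENNReal.ofReal (ρ ((t : ℝ), y))

/-! ### Continuous fibrewise norms on the tangent bundle of a compact manifold -/

section TangentNorm

set_option linter.unusedSectionVars false

/-! Transversality comes from an open-closed argument in the parameter. Let A_t ⊕ B_t be either of
the dominated splittings Ecs ⊕ Euu or Ess ⊕ Ecu of f_t. If k maps B_0 to a bundle transverse to A_s,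
then iterating f_s pushes Dk(B_0) towards B_s. So for each t with A_t ∩ B_s = 0 and all large m,
f_s^m ∘ k maps B_0 transversally to A_t (`IsDominated.exists_forall_transverse`). For t close to s
both A_t ∩ B_s and A_s ∩ B_t vanish (`IsDominated.eventually_disjoint`). Continuity of the bundles
in t is not assumed, so this is derived from cone fields and a count of dimensions.

Hence the set of t for which some composition k of maps of the family makes Dk(B_0) transverse to
A_t is open and closed. It contains 0 because of the empty composition, so it contains 1. Further
iterates of f_1 preserve A_1, which gives all larger lengths N (`exists_isWord_transverse`). One
composition serves both splittings. Multiplying all its parameters by s joins it to f_0^N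
(`IsWord.exists_path`).

For the volume statement, a path G_t with G_0 = id is constructed that carries vol_0 to a multiple
of vol_t. The factor is constant on components and keeps their masses fixed, so it is invariant
under f_t and equals 1 at t = 1 (`exists_path_measurePreserving`). The conjugates G_t⁻¹ f_t G_t then
preserve vol_0, and the pulled back splittings are still dominated. The transversality argument
applied to the conjugates yields a composition k preserving vol_0, and h = G_1 ∘ k is the required
map (`exists_hTransverse_of_conj`). Without volumes one takes G_t = id.

The path G_t is a version of Moser's theorem that needs no flows (`exists_moser_path`). A family of
functions with zero integral over every component is a finite sum of families each of which, in a
chart and after multiplication with the density, is supported in a cube and has zero integral along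
all lines in one coordinate direction (`mem_elementarySums`, resting on `exists_sum_isLineZero`).
Adding one such term to a density is realized by monotone rearrangement along these lines
(`exists_isC1Fam_line_transport`, `exists_diffeo_elementary`). Time is subdivided so that all
intermediate densities stay positive. -/

theorem isManifold_one_of_infty {d : ℕ} {M : Type*} [TopologicalSpace M]
    [ChartedSpace (EuclideanSpace ℝ (Fin d)) M] [h : IsManifold (𝓡 d) ∞ M] :
    IsManifold (𝓡 d) 1 M := inferInstance

attribute [local instance 5000] isManifold_one_of_infty instTopologicalSpaceTangentBundle

open Filter Topology

variable {d : ℕ} {M : Type*} [TopologicalSpace M]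
  [ChartedSpace (EuclideanSpace ℝ (Fin d)) M] [IsManifold (𝓡 d) ∞ M]
  (γ : Bundle.ContMDiffRiemannianMetric (𝓡 d) ∞ (EuclideanSpace ℝ (Fin d))
      (fun x : M => TangentSpace (𝓡 d) x))

instance tangentSpace_finiteDimensional (x : M) :
    FiniteDimensional ℝ (TangentSpace (𝓡 d) x) :=
  inferInstanceAs (FiniteDimensional ℝ (EuclideanSpace ℝ (Fin d)))

lemma finrank_tangentSpace (x : M) : Module.finrank ℝ (TangentSpace (𝓡 d) x) = d :=
  finrank_euclideanSpace_fin (𝕜 := ℝ) (n := d)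

lemma riemNorm_nonneg {x : M} (v : TangentSpace (𝓡 d) x) : 0 ≤ riemNorm γ v :=
  Real.sqrt_nonneg _

lemma riemNorm_zero (x : M) : riemNorm γ (0 : TangentSpace (𝓡 d) x) = 0 := by
  simp [riemNorm]

lemma riemInner_self_nonneg {x : M} (v : TangentSpace (𝓡 d) x) : 0 ≤ γ.inner x v v := by
  rcases eq_or_ne v 0 with rfl | h
  · simp
  · exact (γ.pos x v h).le

lemma riemNorm_sq {x : M} (v : TangentSpace (𝓡 d) x) : riemNorm γ v ^ 2 = γ.inner x v v :=
  Real.sq_sqrt (riemInner_self_nonneg γ v)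

lemma riemNorm_pos {x : M} {v : TangentSpace (𝓡 d) x} (h : v ≠ 0) : 0 < riemNorm γ v :=
  Real.sqrt_pos.2 (γ.pos x v h)

lemma riemNorm_eq_zero {x : M} {v : TangentSpace (𝓡 d) x} : riemNorm γ v = 0 ↔ v = 0 := by
  refine ⟨fun h => ?_, fun h => h ▸ riemNorm_zero γ x⟩
  by_contra hv
  exact (riemNorm_pos γ hv).ne' h

lemma riemNorm_smul {x : M} (c : ℝ) (v : TangentSpace (𝓡 d) x) :
    riemNorm γ (c • v) = |c| * riemNorm γ v := by
  rw [riemNorm, riemNorm, map_smul, map_smul, _root_.smul_apply, smul_eq_mul,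
    smul_eq_mul, ← mul_assoc, Real.sqrt_mul (mul_self_nonneg c), Real.sqrt_mul_self_eq_abs]

lemma riemNorm_add_le {x : M} (v w : TangentSpace (𝓡 d) x) :
    riemNorm γ (v + w) ≤ riemNorm γ v + riemNorm γ w := by
  have hcs : γ.inner x v w ≤ riemNorm γ v * riemNorm γ w := by
    have h : (γ.inner x v w) * (γ.inner x w v) ≤ γ.inner x v v * γ.inner x w w := by
      have := InnerProductSpace.Core.inner_mul_inner_self_le (𝕜 := ℝ)
        (c := (γ.toRiemannianMetric.toCore x).toCore) v w
      refine le_trans ?_ this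
      refine le_trans (le_abs_self _) ?_
      rw [abs_mul]
      rfl
    rw [γ.symm x w v] at h
    refine le_trans (Real.le_sqrt_of_sq_le (y := γ.inner x v v * γ.inner x w w) (by linarith)) ?_
    rw [Real.sqrt_mul (riemInner_self_nonneg γ v)]
    rfl
  refine Real.sqrt_le_iff.2 ⟨add_nonneg (riemNorm_nonneg γ v) (riemNorm_nonneg γ w), ?_⟩
  have : γ.inner x (v + w) (v + w)
      = γ.inner x v v + 2 * γ.inner x v w + γ.inner x w w := by
    simp only [map_add, _root_.add_apply]
    rw [γ.symm x w v]; ring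
  rw [this, ← riemNorm_sq, ← riemNorm_sq]
  nlinarith

lemma continuous_riemNorm :
    Continuous fun v : TangentBundle (𝓡 d) M => riemNorm γ v.2 := by
  refine Real.continuous_sqrt.comp ?_
  have hv : Continuous fun v : TangentBundle (𝓡 d) M =>
    (⟨v.1, v.2⟩ : Bundle.TotalSpace (EuclideanSpace ℝ (Fin d)) (fun x : M => TangentSpace (𝓡 d) x)) :=
    continuous_id
  have hb : Continuous fun v : TangentBundle (𝓡 d) M => v.1 :=
    FiberBundle.continuous_proj _ _
  rw [continuous_iff_continuousAt]
  intro v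
  have hg := (γ.contMDiff.continuous.comp hb).continuousAt (x := v)
  have := ContinuousAt.clm_bundle_apply₂ (F₁ := EuclideanSpace ℝ (Fin d))
    (F₂ := EuclideanSpace ℝ (Fin d)) (F₃ := ℝ) (E₃ := Bundle.Trivial M ℝ) hg hv.continuousAt hv.continuousAt
  rw [FiberBundle.continuousAt_totalSpace] at this
  exact this.2

/-- Continuity of a map to the tangent bundle in a fixed trivialization. -/
lemma continuousAt_tangentBundle_iff {X : Type*} [TopologicalSpace X] {x₀ : X}
    (f : X → TangentBundle (𝓡 d) M) :
    ContinuousAt f x₀ ↔ ContinuousAt (fun x => (f x).1) x₀ ∧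
      ContinuousAt (fun x => (FiberBundle.trivializationAt (EuclideanSpace ℝ (Fin d))
        (TangentSpace (𝓡 d)) (f x₀).1 (f x)).2) x₀ :=
  FiberBundle.continuousAt_totalSpace _ f

lemma trivializationAt_smul (x₀ x : M) (hx : x ∈ (FiberBundle.trivializationAt (EuclideanSpace ℝ (Fin d))
    (TangentSpace (𝓡 d)) x₀).baseSet) (c : ℝ) (v : TangentSpace (𝓡 d) x) :
    (FiberBundle.trivializationAt (EuclideanSpace ℝ (Fin d)) (TangentSpace (𝓡 d)) x₀ ⟨x, c • v⟩).2
    = c • (FiberBundle.trivializationAt (EuclideanSpace ℝ (Fin d)) (TangentSpace (𝓡 d)) x₀ ⟨x, v⟩).2 :=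
  ((FiberBundle.trivializationAt (EuclideanSpace ℝ (Fin d)) (TangentSpace (𝓡 d)) x₀).linear ℝ hx).map_smul c v

/-- The unit ball bundle of a continuous fiberwise norm over a compact manifold is compact. -/
lemma isCompact_tangent_le_one [T2Space M] [CompactSpace M] (q : TangentBundle (𝓡 d) M → ℝ)
    (hq : Continuous q)
    (hsmul : ∀ (x : M) (c : ℝ) (v : TangentSpace (𝓡 d) x), q ⟨x, c • v⟩ = |c| * q ⟨x, v⟩)
    (hpos : ∀ (x : M) (v : TangentSpace (𝓡 d) x), v ≠ 0 → 0 < q ⟨x, v⟩) :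
    IsCompact {v : TangentBundle (𝓡 d) M | q v ≤ 1} := by
  have key : ∀ x₀ : M, ∃ C ∈ 𝓝 x₀, ∃ K : Set (TangentBundle (𝓡 d) M), IsCompact K ∧
      ∀ v : TangentBundle (𝓡 d) M, v.1 ∈ C → q v ≤ 1 → v ∈ K := by
    intro x₀
    let e := FiberBundle.trivializationAt (EuclideanSpace ℝ (Fin d)) (TangentSpace (𝓡 d) : M → Type _) x₀
    have hlc : LocallyCompactSpace M := inferInstance
    obtain ⟨C, hC, hCb, hCc⟩ := hlc.local_compact_nhds x₀ e.baseSet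
      (e.open_baseSet.mem_nhds (FiberBundle.mem_baseSet_trivializationAt' x₀))
    let σ : M × EuclideanSpace ℝ (Fin d) → TangentBundle (𝓡 d) M := fun z => ⟨z.1, e.symm z.1 z.2⟩
    have hσ : ContinuousOn σ (e.baseSet ×ˢ Set.univ) := e.continuousOn_symm
    have hcov : ∀ v : TangentBundle (𝓡 d) M, v.1 ∈ e.baseSet → σ (v.1, (e v).2) = v := by
      intro v hv
      have := e.symm_apply_apply_mk hv v.2
      exact congrArg (fun w => (⟨v.1, w⟩ : TangentBundle (𝓡 d) M)) this
    have hσs : ∀ (x : M) (c : ℝ) (y : EuclideanSpace ℝ (Fin d)), x ∈ e.baseSet →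
        q (σ (x, c • y)) = |c| * q (σ (x, y)) := by
      intro x c y hx
      rw [← hsmul]
      have := (e.symmₗ ℝ x).map_smul c y
      rw [e.coe_symmₗ hx] at this
      exact congrArg (fun w => q ⟨x, w⟩) this
    -- A lower bound of `q` on unit vectors of the model fibre over the compact set `C`. By
    -- homogeneity, `q ≤ 1` then confines vectors over `C` to the ball of radius `m⁻¹`.
    obtain ⟨m, hm0, hm⟩ : ∃ m, 0 < m ∧ ∀ z ∈ C ×ˢ Metric.sphere (0 : EuclideanSpace ℝ (Fin d)) 1,
        m ≤ q (σ z) := by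
      refine IsCompact.exists_forall_le' (hCc.prod (isCompact_sphere _ _)) (hq.comp_continuousOn
        (hσ.mono (Set.prod_mono hCb (Set.subset_univ _)))) ?_
      rintro ⟨x, y⟩ ⟨hx, hy⟩
      refine hpos x _ fun h0 => ?_
      have h1 := e.apply_mk_symm (hCb hx) y
      have h2 : (e ⟨x, e.symm x y⟩).2 = y := by rw [h1]
      have h3 : (e ⟨x, e.symm x y⟩).2 = 0 := by
        have h0' : e.symm x y = (0 : ℝ) • (0 : TangentSpace (𝓡 d) x) := by
          rw [zero_smul]; exact h0
        rw [h0']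
        exact (trivializationAt_smul x₀ x (hCb hx) 0 0).trans (zero_smul _ _)
      simp only [mem_sphere_iff_norm, sub_zero] at hy
      rw [← h2, h3, norm_zero] at hy
      exact zero_ne_one hy
    refine ⟨C, hC, σ '' (C ×ˢ Metric.closedBall 0 m⁻¹),
      (hCc.prod (isCompact_closedBall _ _)).image_of_continuousOn
      (hσ.mono (Set.prod_mono hCb (Set.subset_univ _))), fun v hv hqv => ?_⟩
    refine ⟨(v.1, (e v).2), ⟨hv, ?_⟩, hcov v (hCb hv)⟩
    rw [mem_closedBall_zero_iff]
    rcases eq_or_ne (e v).2 0 with h0 | h0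
    · rw [h0, norm_zero]; positivity
    have hn : 0 < ‖(e v).2‖ := norm_pos_iff.2 h0
    have h1 := hm (v.1, ‖(e v).2‖⁻¹ • (e v).2) ⟨hv, by
      rw [mem_sphere_iff_norm, sub_zero, norm_smul, norm_inv, norm_norm, inv_mul_cancel₀ hn.ne']⟩
    rw [hσs _ _ _ (hCb hv), hcov v (hCb hv), abs_of_pos (inv_pos.2 hn)] at h1
    have h2 : m ≤ ‖(e v).2‖⁻¹ := h1.trans (mul_le_of_le_one_right (inv_pos.2 hn).le hqv)
    exact (le_inv_comm₀ hm0 hn).1 h2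
  choose C hC K hK hCK using key
  obtain ⟨t, -, ht⟩ := isCompact_univ.elim_nhds_subcover C fun x _ => hC x
  refine (t.isCompact_biUnion fun x _ => hK x).of_isClosed_subset
    (isClosed_le hq continuous_const) fun v hv => ?_
  obtain ⟨x, hx, hvx⟩ := Set.mem_iUnion₂.1 (ht (Set.mem_univ v.1))
  exact Set.mem_iUnion₂.2 ⟨x, hx, hCK x v hvx hv⟩

/-- A continuous fiberwise homogeneous function is bounded by any continuous fiberwise norm. -/
lemma exists_le_mul_tangent [T2Space M] [CompactSpace M] (q p : TangentBundle (𝓡 d) M → ℝ)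
    (hq : Continuous q)
    (hsmul : ∀ (x : M) (c : ℝ) (v : TangentSpace (𝓡 d) x), q ⟨x, c • v⟩ = |c| * q ⟨x, v⟩)
    (hpos : ∀ (x : M) (v : TangentSpace (𝓡 d) x), v ≠ 0 → 0 < q ⟨x, v⟩) (hp : Continuous p)
    (hpsmul : ∀ (x : M) (c : ℝ) (v : TangentSpace (𝓡 d) x), p ⟨x, c • v⟩ = |c| * p ⟨x, v⟩) :
    ∃ C : ℝ, 0 < C ∧ ∀ v, p v ≤ C * q v := by
  obtain ⟨C, hC⟩ := (isCompact_tangent_le_one q hq hsmul hpos).bddAbove_image hp.continuousOn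
  -- `C` bounds `p` on the unit ball of `q`; the maximum with 1 only makes the constant positive.
  refine ⟨max C 1, by positivity, fun v => ?_⟩
  rcases eq_or_ne v.2 0 with h0 | h0
  · have hv : v = ⟨v.1, (0 : ℝ) • v.2⟩ := by rw [zero_smul, ← h0]
    rw [hv, hpsmul, hsmul]; simp
  have hv := hpos v.1 v.2 h0
  have h1 : p ⟨v.1, (q v)⁻¹ • v.2⟩ ≤ C := by
    refine hC ⟨_, ?_, rfl⟩
    change q _ ≤ 1
    rw [hsmul, abs_of_pos (inv_pos.2 hv)]
    exact (inv_mul_cancel₀ hv.ne').le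
  rw [hpsmul, abs_of_pos (inv_pos.2 hv)] at h1
  have h2 : (q v)⁻¹ * p v ≤ max C 1 := h1.trans (le_max_left _ _)
  rwa [inv_mul_le_iff₀ hv, mul_comm] at h2

lemma IsContinuousSubbundle.sup {A B : (x : M) → Submodule ℝ (TangentSpace (𝓡 d) x)}
    (hA : IsContinuousSubbundle A) (hB : IsContinuousSubbundle B)
    (hAB : ∀ x, Disjoint (A x) (B x)) : IsContinuousSubbundle fun x => A x ⊔ B x := by
  intro x₀
  obtain ⟨U, hU, k, X, hX, hX'⟩ := hA x₀
  obtain ⟨V, hV, l, Y, hY, hY'⟩ := hB x₀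
  refine ⟨U ∩ V, inter_mem hU hV, k + l, fun i x => Fin.addCases (fun i => X i x) (fun j => Y j x) i,
    fun i => ?_, fun x hx => ?_⟩
  · refine Fin.addCases (fun i => ?_) (fun j => ?_) i
    · simpa using (hX i).mono Set.inter_subset_left
    · simpa using (hY j).mono Set.inter_subset_right
  · have he : (fun i : Fin (k + l) => Fin.addCases (motive := fun _ => TangentSpace (𝓡 d) x)
        (fun i => X i x) (fun j => Y j x) i)
        = Sum.elim (fun i => X i x) (fun j => Y j x) ∘ finSumFinEquiv.symm := by
      ext i
      refine Fin.addCases (fun i => ?_) (fun j => ?_) i <;> simp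
    have h1 := hX' x hx.1
    have h2 := hY' x hx.2
    rw [he]
    refine ⟨(linearIndependent_equiv _).2 (h1.1.sum_type h2.1 ?_), ?_⟩
    · rw [h1.2, h2.2]; exact hAB x
    · rw [Set.range_comp, finSumFinEquiv.symm.surjective.range_eq, Set.image_univ,
        Set.Sum.elim_range, Submodule.span_union, h1.2, h2.2]

/-- The projection along a splitting into continuous subbundles is continuous. -/
lemma IsContinuousSubbundle.continuous_projection
    {A B : (x : M) → Submodule ℝ (TangentSpace (𝓡 d) x)}
    (hA : IsContinuousSubbundle A) (hB : IsContinuousSubbundle B)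
    (hAB : ∀ x, IsCompl (A x) (B x)) :
    Continuous fun v : TangentBundle (𝓡 d) M =>
      (⟨v.1, (A v.1).projection (B v.1) (hAB v.1) v.2⟩ : TangentBundle (𝓡 d) M) := by
  rw [continuous_iff_continuousAt]
  intro v₀
  obtain ⟨U, hU, k, X, hX, hX'⟩ := hA v₀.1
  obtain ⟨V, hV, l, Y, hY, hY'⟩ := hB v₀.1
  let F := EuclideanSpace ℝ (Fin d)
  let e := FiberBundle.trivializationAt F (TangentSpace (𝓡 d) : M → Type _) v₀.1
  have hb : Continuous fun v : TangentBundle (𝓡 d) M => v.1 := FiberBundle.continuous_proj _ _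
  rw [continuousAt_tangentBundle_iff]
  refine ⟨hb.continuousAt, ?_⟩
  -- The two frames together are a basis in which the projection retains the first `k` coordinates.
  -- The coordinates of a vector vary continuously because the operator `L x` from coordinates to
  -- vectors has a continuous inverse.
  let Z : Fin k ⊕ Fin l → (x : M) → TangentSpace (𝓡 d) x :=
    fun i x => Sum.elim (fun i => X i x) (fun j => Y j x) i
  have hli : ∀ x ∈ U ∩ V, LinearIndependent ℝ (fun i => Z i x) := by
    intro x hx
    refine ((hX' x hx.1).1.sum_type (hY' x hx.2).1 ?_)
    rw [(hX' x hx.1).2, (hY' x hx.2).2]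
    exact (hAB x).disjoint
  have hsp : ∀ x ∈ U ∩ V, Submodule.span ℝ (Set.range fun i => Z i x) = ⊤ := by
    intro x hx
    have : (fun i => Z i x) = Sum.elim (fun i => X i x) (fun j => Y j x) := rfl
    rw [this, Set.Sum.elim_range, Submodule.span_union, (hX' x hx.1).2, (hY' x hx.2).2]
    exact (hAB x).sup_eq_top
  let z : Fin k ⊕ Fin l → M → F := fun i x => (e ⟨x, Z i x⟩).2
  have hz : ∀ i, ContinuousAt (z i) v₀.1 := by
    intro i
    have : ContinuousAt (fun x => (⟨x, Z i x⟩ : TangentBundle (𝓡 d) M)) v₀.1 := by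
      rcases i with i | j
      · exact (hX i).continuousAt hU
      · exact (hY j).continuousAt hV
    exact ((continuousAt_tangentBundle_iff _).1 this).2
  let L : M → ((Fin k ⊕ Fin l → ℝ) →L[ℝ] F) := fun x =>
    ∑ i, (ContinuousLinearMap.proj (R := ℝ) (φ := fun _ : Fin k ⊕ Fin l => ℝ) i).smulRight (z i x)
  have hL : ContinuousAt L v₀.1 := by
    refine tendsto_finsetSum _ fun i _ => ?_
    exact ((ContinuousLinearMap.smulRightL ℝ (Fin k ⊕ Fin l → ℝ) F
      (ContinuousLinearMap.proj (R := ℝ) (φ := fun _ : Fin k ⊕ Fin l => ℝ) i)).continuous.continuousAt).comp (hz i)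
  have hev : ∀ᶠ v : TangentBundle (𝓡 d) M in 𝓝 v₀, v.1 ∈ (U ∩ V) ∩ e.baseSet :=
    hb.continuousAt.eventually_mem (inter_mem (inter_mem hU hV)
      (e.open_baseSet.mem_nhds (FiberBundle.mem_baseSet_trivializationAt' v₀.1)))
  -- the frame gives invertible operators
  have hLe : ∀ x ∈ (U ∩ V) ∩ e.baseSet, ∃ ε : (Fin k ⊕ Fin l → ℝ) ≃L[ℝ] F, (ε : _ →L[ℝ] F) = L x ∧
      ∀ c, ε c = (e ⟨x, ∑ i, c i • Z i x⟩).2 := by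
    intro x hx
    let bs := Module.Basis.mk (hli x hx.1) (hsp x hx.1).ge
    let ε := bs.equivFun.symm.trans (e.linearEquivAt ℝ x hx.2)
    have hε : ∀ c, ε c = (e ⟨x, ∑ i, c i • Z i x⟩).2 := by
      intro c
      change (e ⟨x, bs.equivFun.symm c⟩).2 = _
      rw [Module.Basis.equivFun_symm_apply]
      simp [bs]
    refine ⟨ε.toContinuousLinearEquiv, ?_, hε⟩
    ext1 c
    refine (hε c).trans ?_
    have h3 := map_sum (e.linearEquivAt ℝ x hx.2) (fun i => c i • Z i x) Finset.univ
    refine h3.trans ?_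
    simp only [L, _root_.sum_apply, ContinuousLinearMap.smulRight_apply,
      ContinuousLinearMap.proj_apply]
    refine Finset.sum_congr rfl fun i _ => ?_
    exact map_smul (e.linearEquivAt ℝ x hx.2) (c i) (Z i x)
  have hcoord : ∀ v : TangentBundle (𝓡 d) M, v.1 ∈ (U ∩ V) ∩ e.baseSet →
      (e ⟨v.1, (A v.1).projection (B v.1) (hAB v.1) v.2⟩).2 =
      ∑ i : Fin k, (ContinuousLinearMap.inverse (L v.1) (e v).2) (Sum.inl i) • z (Sum.inl i) v.1 := by
    intro v hv
    obtain ⟨ε, hε, hε'⟩ := hLe v.1 hv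
    rw [← hε, ContinuousLinearMap.inverse_equiv]
    set c := ε.symm (e v).2 with hc
    have hv2 : v.2 = ∑ i, c i • Z i v.1 := by
      have h1 : ε c = (e v).2 := by rw [hc]; exact ε.apply_symm_apply _
      rw [hε'] at h1
      exact ((e.linearEquivAt ℝ v.1 hv.2).injective h1).symm
    have hsum : v.2 = ∑ i, c (Sum.inl i) • X i v.1 + ∑ j, c (Sum.inr j) • Y j v.1 := by
      rw [hv2, Fintype.sum_sum_type]; rfl
    have hAm : ∑ i, c (Sum.inl i) • X i v.1 ∈ A v.1 := by
      rw [← (hX' v.1 hv.1.1).2]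
      exact Submodule.sum_mem _ fun i _ => Submodule.smul_mem _ _ (Submodule.subset_span ⟨i, rfl⟩)
    have hBm : ∑ i, c (Sum.inr i) • Y i v.1 ∈ B v.1 := by
      rw [← (hY' v.1 hv.1.2).2]
      exact Submodule.sum_mem _ fun i _ => Submodule.smul_mem _ _ (Submodule.subset_span ⟨i, rfl⟩)
    have hproj : (A v.1).projection (B v.1) (hAB v.1) v.2 = ∑ i, c (Sum.inl i) • X i v.1 := by
      rw [hsum, map_add]
      have e1 := Submodule.projection_apply_left (hAB v.1) ⟨_, hAm⟩
      have e2 := (Submodule.projection_apply_eq_zero_iff (hAB v.1)).2 hBm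
      rw [e2, add_zero]; exact e1
    rw [hproj]
    have h3 := map_sum (e.linearEquivAt ℝ v.1 hv.2) (fun i => c (Sum.inl i) • X i v.1) Finset.univ
    refine h3.trans (Finset.sum_congr rfl fun i _ => ?_)
    exact map_smul (e.linearEquivAt ℝ v.1 hv.2) (c (Sum.inl i)) (X i v.1)
  have hinv : ContinuousAt (fun v : TangentBundle (𝓡 d) M => ContinuousLinearMap.inverse (L v.1)) v₀ := by
    obtain ⟨ε, hε, -⟩ := hLe v₀.1 hev.self_of_nhds
    have h1 := (contDiffAt_map_inverse (𝕜 := ℝ) (n := 0) ε).continuousAt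
    rw [hε] at h1
    exact ContinuousAt.comp (f := fun v : TangentBundle (𝓡 d) M => L v.1) h1
      (ContinuousAt.comp (f := fun v : TangentBundle (𝓡 d) M => v.1) hL hb.continuousAt)
  have hev2 : ContinuousAt (fun v : TangentBundle (𝓡 d) M => (e v).2) v₀ :=
    ((continuousAt_tangentBundle_iff (fun v => v)).1 continuousAt_id).2
  have hfin : ContinuousAt (fun v : TangentBundle (𝓡 d) M => ∑ i : Fin k,
      (ContinuousLinearMap.inverse (L v.1) (e v).2) (Sum.inl i) • z (Sum.inl i) v.1) v₀ := by
    refine tendsto_finsetSum _ fun i _ => ?_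
    have h1 : ContinuousAt (fun v : TangentBundle (𝓡 d) M =>
        ContinuousLinearMap.inverse (L v.1) (e v).2 (Sum.inl i)) v₀ :=
      (continuous_apply (Sum.inl i)).continuousAt.comp (hinv.clm_apply hev2)
    have h2 : ContinuousAt (fun v : TangentBundle (𝓡 d) M => z (Sum.inl i) v.1) v₀ :=
      ContinuousAt.comp (f := fun v : TangentBundle (𝓡 d) M => v.1) (hz (Sum.inl i)) hb.continuousAt
    exact h1.smul h2
  refine hfin.congr ?_
  filter_upwards [hev] with v hv
  exact (hcoord v hv).symm

end TangentNorm

/-! ### Dominated splittings and the components of vectors along them -/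

section DominatedSplittings

set_option linter.unusedSectionVars false

attribute [local instance 5000] isManifold_one_of_infty instTopologicalSpaceTangentBundle

open Filter Topology

variable {d : ℕ} {M : Type*} [TopologicalSpace M]
  [ChartedSpace (EuclideanSpace ℝ (Fin d)) M] [IsManifold (𝓡 d) ∞ M] {r : ℕ∞}

lemma Diffeomorph.mdifferentiable_of_one_le (hr : 1 ≤ r) (f : Diffeomorph (𝓡 d) (𝓡 d) M M r) :
    MDifferentiable (𝓡 d) (𝓡 d) f :=
  f.mdifferentiable (by
    intro h
    have : (r : WithTop ℕ∞) = ((0 : ℕ∞) : WithTop ℕ∞) := h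
    rw [WithTop.coe_inj] at this
    subst this
    exact absurd hr (by norm_num))

lemma MDifferentiable.iterate {f : M → M} (hf : MDifferentiable (𝓡 d) (𝓡 d) f) (n : ℕ) :
    MDifferentiable (𝓡 d) (𝓡 d) f^[n] := by
  induction n with
  | zero => exact mdifferentiable_id
  | succ n ih => exact ih.comp hf

lemma tangentMap_iterate {f : M → M} (hf : MDifferentiable (𝓡 d) (𝓡 d) f) (n : ℕ) :
    tangentMap (𝓡 d) (𝓡 d) f^[n] = (tangentMap (𝓡 d) (𝓡 d) f)^[n] := by
  induction n with
  | zero => exact tangentMap_id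
  | succ n ih =>
    rw [Function.iterate_succ, tangentMap_comp (hf.iterate n) hf, ih, Function.iterate_succ]

lemma mfderiv_iterate_succ {f : M → M} (hf : MDifferentiable (𝓡 d) (𝓡 d) f) (n : ℕ) (x : M)
    (v : TangentSpace (𝓡 d) x) :
    mfderiv (𝓡 d) (𝓡 d) f^[n + 1] x v =
      mfderiv (𝓡 d) (𝓡 d) f^[n] (f x) (mfderiv (𝓡 d) (𝓡 d) f x v) := by
  rw [Function.iterate_succ, mfderiv_comp x (hf.iterate n (f x)) (hf x)]
  rfl

lemma mfderiv_symm_mfderiv (hr : 1 ≤ r) (f : Diffeomorph (𝓡 d) (𝓡 d) M M r) (x : M)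
    (v : TangentSpace (𝓡 d) x) :
    mfderiv (𝓡 d) (𝓡 d) f.symm (f x) (mfderiv (𝓡 d) (𝓡 d) f x v) = v := by
  have h := mfderiv_comp x (f.symm.mdifferentiable_of_one_le hr (f x))
    (f.mdifferentiable_of_one_le hr x)
  have h2 : (f.symm : M → M) ∘ f = id := funext f.symm_apply_apply
  rw [h2, mfderiv_id] at h
  exact (congrArg (fun L : TangentSpace (𝓡 d) x →L[ℝ] TangentSpace (𝓡 d) x => L v) h).symm

lemma mfderiv_mfderiv_symm (hr : 1 ≤ r) (f : Diffeomorph (𝓡 d) (𝓡 d) M M r) (x : M)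
    (v : TangentSpace (𝓡 d) (f x)) :
    mfderiv (𝓡 d) (𝓡 d) f x (mfderiv (𝓡 d) (𝓡 d) f.symm (f x) v) = v := by
  have h := mfderiv_comp (f x) (f.mdifferentiable_of_one_le hr (f.symm (f x)))
    (f.symm.mdifferentiable_of_one_le hr (f x))
  have h2 : (f : M → M) ∘ f.symm = id := funext f.apply_symm_apply
  rw [h2, mfderiv_id] at h
  have h3 := (congrArg (fun L : TangentSpace (𝓡 d) (f x) →L[ℝ] TangentSpace (𝓡 d) (f x) => L v) h).symm
  have h4 : f.symm (f x) = x := f.symm_apply_apply x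
  rw [h4] at h3
  exact h3

lemma mfderiv_bijective (hr : 1 ≤ r) (f : Diffeomorph (𝓡 d) (𝓡 d) M M r) (x : M) :
    Function.Bijective (mfderiv (𝓡 d) (𝓡 d) f x) :=
  ⟨Function.LeftInverse.injective (mfderiv_symm_mfderiv hr f x),
    Function.RightInverse.surjective (mfderiv_mfderiv_symm hr f x)⟩

lemma mfderiv_iterate_bijective (hr : 1 ≤ r) (f : Diffeomorph (𝓡 d) (𝓡 d) M M r) (n : ℕ) (x : M) :
    Function.Bijective (mfderiv (𝓡 d) (𝓡 d) f^[n] x) := by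
  induction n generalizing x with
  | zero =>
    have : mfderiv (𝓡 d) (𝓡 d) f^[0] x = ContinuousLinearMap.id ℝ _ := mfderiv_id
    rw [this]
    exact Function.bijective_id
  | succ n ih =>
    have h : (mfderiv (𝓡 d) (𝓡 d) f^[n + 1] x : _ → _) =
        mfderiv (𝓡 d) (𝓡 d) f^[n] (f x) ∘ mfderiv (𝓡 d) (𝓡 d) f x :=
      funext (mfderiv_iterate_succ (f.mdifferentiable_of_one_le hr) n x)
    rw [h]
    exact (ih (f x)).comp (mfderiv_bijective hr f x)

/-- A dominated splitting `TM = A ⊕ B` for `f`: the bundles are complementary, invariant, with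
continuous projections, and `B` asymptotically dominates `A`. -/
structure IsDominated
    (γ : Bundle.ContMDiffRiemannianMetric (𝓡 d) ∞ (EuclideanSpace ℝ (Fin d))
      (fun x : M => TangentSpace (𝓡 d) x))
    (f : Diffeomorph (𝓡 d) (𝓡 d) M M r) (A B : (x : M) → Submodule ℝ (TangentSpace (𝓡 d) x)) :
    Prop where
  compl : ∀ x, IsCompl (A x) (B x)
  cont_left : Continuous fun v : TangentBundle (𝓡 d) M =>
      (⟨v.1, (A v.1).projection (B v.1) (compl v.1) v.2⟩ : TangentBundle (𝓡 d) M)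
  cont_right : Continuous fun v : TangentBundle (𝓡 d) M =>
      (⟨v.1, (B v.1).projection (A v.1) (compl v.1).symm v.2⟩ : TangentBundle (𝓡 d) M)
  inv_left : ∀ x v, mfderiv (𝓡 d) (𝓡 d) f x v ∈ A (f x) ↔ v ∈ A x
  inv_right : ∀ x v, mfderiv (𝓡 d) (𝓡 d) f x v ∈ B (f x) ↔ v ∈ B x
  dom : ∀ ε : ℝ, 0 < ε → ∃ l₀ : ℕ, ∀ l ≥ l₀, ∀ x, ∀ a ∈ A x, ∀ b ∈ B x,
    riemNorm γ (mfderiv (𝓡 d) (𝓡 d) f^[l] x a) * riemNorm γ b ≤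
      ε * (riemNorm γ a * riemNorm γ (mfderiv (𝓡 d) (𝓡 d) f^[l] x b))

lemma invariant_iterate (hr : 1 ≤ r) {f : Diffeomorph (𝓡 d) (𝓡 d) M M r}
    {A : (x : M) → Submodule ℝ (TangentSpace (𝓡 d) x)}
    (hA : ∀ x v, mfderiv (𝓡 d) (𝓡 d) f x v ∈ A (f x) ↔ v ∈ A x) (n : ℕ) (x : M)
    (v : TangentSpace (𝓡 d) x) :
    mfderiv (𝓡 d) (𝓡 d) f^[n] x v ∈ A (f^[n] x) ↔ v ∈ A x := by
  induction n generalizing x with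
  | zero =>
    have : mfderiv (𝓡 d) (𝓡 d) f^[0] x = ContinuousLinearMap.id ℝ _ := mfderiv_id
    rw [this]
    rfl
  | succ n ih =>
    rw [mfderiv_iterate_succ (f.mdifferentiable_of_one_le hr), ← hA x v]
    exact ih (f x) _

namespace IsDominated

variable {γ : Bundle.ContMDiffRiemannianMetric (𝓡 d) ∞ (EuclideanSpace ℝ (Fin d))
      (fun x : M => TangentSpace (𝓡 d) x)}
  {f : Diffeomorph (𝓡 d) (𝓡 d) M M r} {A B : (x : M) → Submodule ℝ (TangentSpace (𝓡 d) x)}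

/-- The projection to the first bundle. -/
noncomputable def projL (h : IsDominated γ f A B) (x : M) :
    TangentSpace (𝓡 d) x →ₗ[ℝ] TangentSpace (𝓡 d) x := (A x).projection (B x) (h.compl x)

/-- The projection to the second bundle. -/
noncomputable def projR (h : IsDominated γ f A B) (x : M) :
    TangentSpace (𝓡 d) x →ₗ[ℝ] TangentSpace (𝓡 d) x := (B x).projection (A x) (h.compl x).symm

lemma projL_mem (h : IsDominated γ f A B) (x : M) (v : TangentSpace (𝓡 d) x) :
    h.projL x v ∈ A x := Submodule.projection_apply_mem _ _

lemma projR_mem (h : IsDominated γ f A B) (x : M) (v : TangentSpace (𝓡 d) x) :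
    h.projR x v ∈ B x := Submodule.projection_apply_mem _ _

lemma projL_add_projR (h : IsDominated γ f A B) (x : M) (v : TangentSpace (𝓡 d) x) :
    h.projL x v + h.projR x v = v := Submodule.projection_add_projection_eq_self (h.compl x) v

lemma proj_add (h : IsDominated γ f A B) {x : M} {a b : TangentSpace (𝓡 d) x} (ha : a ∈ A x)
    (hb : b ∈ B x) : h.projL x (a + b) = a ∧ h.projR x (a + b) = b := by
  have e1 := Submodule.projection_apply_left (h.compl x) ⟨a, ha⟩
  have e2 := (Submodule.projection_apply_eq_zero_iff (h.compl x)).2 hb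
  have e3 := Submodule.projection_apply_left (h.compl x).symm ⟨b, hb⟩
  have e4 := (Submodule.projection_apply_eq_zero_iff (h.compl x).symm).2 ha
  constructor
  · rw [projL, map_add, e2, add_zero]; exact e1
  · rw [projR, map_add, e4, zero_add]; exact e3

lemma proj_of_mem_left (h : IsDominated γ f A B) {x : M} {a : TangentSpace (𝓡 d) x}
    (ha : a ∈ A x) : h.projL x a = a ∧ h.projR x a = 0 := by
  simpa using h.proj_add ha (zero_mem (B x))

lemma proj_of_mem_right (h : IsDominated γ f A B) {x : M} {b : TangentSpace (𝓡 d) x}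
    (hb : b ∈ B x) : h.projL x b = 0 ∧ h.projR x b = b := by
  simpa using h.proj_add (zero_mem (A x)) hb

/-- The length of the first component. -/
noncomputable def normL (h : IsDominated γ f A B) (v : TangentBundle (𝓡 d) M) : ℝ :=
  riemNorm γ (h.projL v.1 v.2)

/-- The length of the second component. -/
noncomputable def normR (h : IsDominated γ f A B) (v : TangentBundle (𝓡 d) M) : ℝ :=
  riemNorm γ (h.projR v.1 v.2)

lemma continuous_normL (h : IsDominated γ f A B) : Continuous h.normL :=
  (continuous_riemNorm γ).comp h.cont_left

lemma continuous_normR (h : IsDominated γ f A B) : Continuous h.normR :=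
  (continuous_riemNorm γ).comp h.cont_right

lemma normL_nonneg (h : IsDominated γ f A B) (v) : 0 ≤ h.normL v := riemNorm_nonneg _ _

lemma normR_nonneg (h : IsDominated γ f A B) (v) : 0 ≤ h.normR v := riemNorm_nonneg _ _

lemma normL_smul (h : IsDominated γ f A B) (x : M) (c : ℝ) (v : TangentSpace (𝓡 d) x) :
    h.normL ⟨x, c • v⟩ = |c| * h.normL ⟨x, v⟩ := by
  simp only [normL, map_smul, riemNorm_smul]

lemma normR_smul (h : IsDominated γ f A B) (x : M) (c : ℝ) (v : TangentSpace (𝓡 d) x) :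
    h.normR ⟨x, c • v⟩ = |c| * h.normR ⟨x, v⟩ := by
  simp only [normR, map_smul, riemNorm_smul]

lemma riemNorm_le (h : IsDominated γ f A B) (x : M) (v : TangentSpace (𝓡 d) x) :
    riemNorm γ v ≤ h.normL ⟨x, v⟩ + h.normR ⟨x, v⟩ := by
  conv_lhs => rw [← h.projL_add_projR x v]
  exact riemNorm_add_le γ _ _

lemma norm_add_pos (h : IsDominated γ f A B) (x : M) (v : TangentSpace (𝓡 d) x) (hv : v ≠ 0) :
    0 < h.normL ⟨x, v⟩ + h.normR ⟨x, v⟩ :=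
  (riemNorm_pos γ hv).trans_le (h.riemNorm_le x v)

/-- By compactness the angle between the two bundles is bounded below, so the projections are
uniformly bounded. -/
lemma exists_norm_le [T2Space M] [CompactSpace M] (h : IsDominated γ f A B) :
    ∃ C : ℝ, 0 < C ∧ ∀ x (v : TangentSpace (𝓡 d) x),
      h.normL ⟨x, v⟩ ≤ C * riemNorm γ v ∧ h.normR ⟨x, v⟩ ≤ C * riemNorm γ v := by
  obtain ⟨C, hC0, hC⟩ := exists_le_mul_tangent (fun v : TangentBundle (𝓡 d) M => riemNorm γ v.2)
    (fun v => h.normL v + h.normR v) (continuous_riemNorm γ) (fun x c v => riemNorm_smul γ c v)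
    (fun x v hv => riemNorm_pos γ hv) (h.continuous_normL.add h.continuous_normR)
    (fun x c v => by rw [normL_smul, normR_smul]; ring)
  refine ⟨C, hC0, fun x v => ⟨?_, ?_⟩⟩
  · have := hC ⟨x, v⟩; have h2 := h.normR_nonneg ⟨x, v⟩; simp only at this; linarith
  · have := hC ⟨x, v⟩; have h2 := h.normL_nonneg ⟨x, v⟩; simp only at this; linarith

/-- Invariance of both bundles makes the projections commute with the derivative. -/
lemma proj_iterate (hr : 1 ≤ r) (h : IsDominated γ f A B) (n : ℕ) (x : M)
    (v : TangentSpace (𝓡 d) x) :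
    h.projL (f^[n] x) (mfderiv (𝓡 d) (𝓡 d) f^[n] x v) =
        mfderiv (𝓡 d) (𝓡 d) f^[n] x (h.projL x v) ∧
      h.projR (f^[n] x) (mfderiv (𝓡 d) (𝓡 d) f^[n] x v) =
        mfderiv (𝓡 d) (𝓡 d) f^[n] x (h.projR x v) := by
  have h1 := (invariant_iterate hr h.inv_left n x _).2 (h.projL_mem x v)
  have h2 := (invariant_iterate hr h.inv_right n x _).2 (h.projR_mem x v)
  have h3 := h.proj_add h1 h2
  rw [← map_add, h.projL_add_projR] at h3
  exact h3

end IsDominated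

end DominatedSplittings

/-! ### Cone fields and their stability under perturbation -/

section Cones

set_option linter.unusedSectionVars false

attribute [local instance 5000] isManifold_one_of_infty instTopologicalSpaceTangentBundle

open Filter Topology

variable {d : ℕ} {M : Type*} [TopologicalSpace M]
  [ChartedSpace (EuclideanSpace ℝ (Fin d)) M] [IsManifold (𝓡 d) ∞ M] {r : ℕ∞}

/-- Continuous families of diffeomorphisms in the `C^1` topology, over any parameter space. -/
def IsC1Family {P : Type*} [TopologicalSpace P] (F : P → Diffeomorph (𝓡 d) (𝓡 d) M M r) : Prop :=
  Continuous fun p : P × TangentBundle (𝓡 d) M => tangentMap (𝓡 d) (𝓡 d) (F p.1) p.2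

lemma IsC1Family.continuous_iterate {P : Type*} [TopologicalSpace P]
    {F : P → Diffeomorph (𝓡 d) (𝓡 d) M M r} (hF : IsC1Family F) (n : ℕ) :
    Continuous fun p : P × TangentBundle (𝓡 d) M => (tangentMap (𝓡 d) (𝓡 d) (F p.1))^[n] p.2 := by
  induction n with
  | zero => exact continuous_snd
  | succ n ih => exact ih.comp (continuous_fst.prodMk hF)

variable {γ : Bundle.ContMDiffRiemannianMetric (𝓡 d) ∞ (EuclideanSpace ℝ (Fin d))
      (fun x : M => TangentSpace (𝓡 d) x)}

/-- Domination with constant 1/4, applied to the components of arbitrary vectors. The factor 4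
leaves room for a factor 2 that survives perturbation of the map. -/
lemma IsDominated.normL_iterate_mul (hr : 1 ≤ r) {f : Diffeomorph (𝓡 d) (𝓡 d) M M r}
    {A B : (x : M) → Submodule ℝ (TangentSpace (𝓡 d) x)} (h : IsDominated γ f A B) :
    ∃ l : ℕ, 0 < l ∧ ∀ x, ∀ u w : TangentSpace (𝓡 d) x,
      4 * (h.normL ((tangentMap (𝓡 d) (𝓡 d) f)^[l] ⟨x, u⟩) * h.normR ⟨x, w⟩) ≤
        h.normL ⟨x, u⟩ * h.normR ((tangentMap (𝓡 d) (𝓡 d) f)^[l] ⟨x, w⟩) ∧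
      (h.normR ⟨x, w⟩ ≠ 0 → 0 < h.normR ((tangentMap (𝓡 d) (𝓡 d) f)^[l] ⟨x, w⟩)) := by
  obtain ⟨l, hl⟩ := h.dom (1 / 4) (by norm_num)
  -- `l` may be zero; domination persists for all later iterates, so one more iteration is harmless.
  refine ⟨l + 1, l.succ_pos, fun x u w => ?_⟩
  have h1 := hl (l + 1) l.le_succ x _ (h.projL_mem x u) _ (h.projR_mem x w)
  rw [← tangentMap_iterate (f.mdifferentiable_of_one_le hr)]
  have e1 : h.normL (tangentMap (𝓡 d) (𝓡 d) f^[l + 1] ⟨x, u⟩) =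
      riemNorm γ (mfderiv (𝓡 d) (𝓡 d) f^[l + 1] x (h.projL x u)) :=
    congrArg (riemNorm γ) (h.proj_iterate hr (l + 1) x u).1
  have e2 : h.normR (tangentMap (𝓡 d) (𝓡 d) f^[l + 1] ⟨x, w⟩) =
      riemNorm γ (mfderiv (𝓡 d) (𝓡 d) f^[l + 1] x (h.projR x w)) :=
    congrArg (riemNorm γ) (h.proj_iterate hr (l + 1) x w).2
  rw [e1, e2]
  refine ⟨?_, fun h0 => riemNorm_pos γ fun h2 => h0 ?_⟩
  · simp only [IsDominated.normL, IsDominated.normR]; linarith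
  · have h3 := (mfderiv_iterate_bijective hr f (l + 1) x).1 (h2.trans (map_zero _).symm)
    simp only [IsDominated.normR, h3, riemNorm_zero]

/-- The cone field of a dominated splitting is strictly invariant and dominated by the maps that
are close to the given one. -/
lemma IsDominated.exists_cone_step [T2Space M] [CompactSpace M] (hr : 1 ≤ r) {P : Type*}
    [TopologicalSpace P] {F : P → Diffeomorph (𝓡 d) (𝓡 d) M M r} (hF : IsC1Family F) (t : P)
    {A B : (x : M) → Submodule ℝ (TangentSpace (𝓡 d) x)} (h : IsDominated γ (F t) A B) :
    ∃ l : ℕ, 0 < l ∧ ∀ᶠ s in 𝓝 t,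
      (∀ v : TangentBundle (𝓡 d) M, h.normL v ≤ h.normR v →
        h.normL ((tangentMap (𝓡 d) (𝓡 d) (F s))^[l] v) ≤
          h.normR ((tangentMap (𝓡 d) (𝓡 d) (F s))^[l] v)) ∧
      (∀ x, ∀ u w : TangentSpace (𝓡 d) x, h.normL ⟨x, w⟩ ≤ h.normR ⟨x, w⟩ →
        h.normR ((tangentMap (𝓡 d) (𝓡 d) (F s))^[l] ⟨x, u⟩) <
          h.normL ((tangentMap (𝓡 d) (𝓡 d) (F s))^[l] ⟨x, u⟩) →
        2 * (h.normL ((tangentMap (𝓡 d) (𝓡 d) (F s))^[l] ⟨x, u⟩) * h.normR ⟨x, w⟩) ≤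
          h.normL ⟨x, u⟩ * h.normR ((tangentMap (𝓡 d) (𝓡 d) (F s))^[l] ⟨x, w⟩)) := by
  obtain ⟨l, hl0, hl⟩ := h.normL_iterate_mul hr
  refine ⟨l, hl0, ?_⟩
  set q : TangentBundle (𝓡 d) M → ℝ := fun v => h.normL v + h.normR v with hqdef
  have hq : Continuous q := h.continuous_normL.add h.continuous_normR
  have hcL := h.continuous_normL
  have hcR := h.continuous_normR
  have hqs : ∀ (x : M) (c : ℝ) (v : TangentSpace (𝓡 d) x), q ⟨x, c • v⟩ = |c| * q ⟨x, v⟩ := by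
    intro x c v
    simp only [hqdef, h.normL_smul, h.normR_smul]; ring
  have hball := isCompact_tangent_le_one q hq hqs h.norm_add_pos
  have hsph : IsCompact {v : TangentBundle (𝓡 d) M | q v = 1} :=
    hball.of_isClosed_subset (isClosed_eq hq continuous_const) fun v hv => le_of_eq hv
  -- iterates are homogeneous
  have hit : ∀ (s : P) (x : M) (c : ℝ) (v : TangentSpace (𝓡 d) x),
      h.normL ((tangentMap (𝓡 d) (𝓡 d) (F s))^[l] ⟨x, c • v⟩) =
        |c| * h.normL ((tangentMap (𝓡 d) (𝓡 d) (F s))^[l] ⟨x, v⟩) ∧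
      h.normR ((tangentMap (𝓡 d) (𝓡 d) (F s))^[l] ⟨x, c • v⟩) =
        |c| * h.normR ((tangentMap (𝓡 d) (𝓡 d) (F s))^[l] ⟨x, v⟩) := by
    intro s x c v
    rw [← tangentMap_iterate ((F s).mdifferentiable_of_one_le hr)]
    have : tangentMap (𝓡 d) (𝓡 d) (F s)^[l] ⟨x, c • v⟩ = ⟨(F s)^[l] x, c •
        mfderiv (𝓡 d) (𝓡 d) (F s)^[l] x v⟩ := by
      simp [tangentMap]
    rw [this, h.normL_smul, h.normR_smul]
    exact ⟨rfl, rfl⟩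
  have hg := hF.continuous_iterate l
  -- Unit vectors of the closed cone land in the open cone. A strict inequality on a compact set is
  -- what carries over to nearby parameters.
  have hcone : ∀ v : TangentBundle (𝓡 d) M, q v = 1 → h.normL v ≤ h.normR v →
      h.normL ((tangentMap (𝓡 d) (𝓡 d) (F t))^[l] v) <
          h.normR ((tangentMap (𝓡 d) (𝓡 d) (F t))^[l] v) := by
    intro v hv1 hv2
    have h1 := hl v.1 v.2 v.2
    have hR : 0 < h.normR v := by
      simp only [hqdef] at hv1; linarith [h.normL_nonneg v]
    have h2 := h1.2 hR.ne'
    have h3 : 4 * (h.normL ((tangentMap (𝓡 d) (𝓡 d) (F t))^[l] v) * h.normR v) ≤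
      h.normR v * h.normR ((tangentMap (𝓡 d) (𝓡 d) (F t))^[l] v) :=
      h1.1.trans (mul_le_mul_of_nonneg_right hv2 (h.normR_nonneg _))
    have h4 : h.normR v * (4 * h.normL ((tangentMap (𝓡 d) (𝓡 d) (F t))^[l] v)) ≤
      h.normR v * h.normR ((tangentMap (𝓡 d) (𝓡 d) (F t))^[l] v) := by linarith
    have h5 := le_of_mul_le_mul_left h4 hR
    have h6 := h.normL_nonneg ((tangentMap (𝓡 d) (𝓡 d) (F t))^[l] v)
    have h7 : 0 < h.normR ((tangentMap (𝓡 d) (𝓡 d) (F t))^[l] v) := h2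
    linarith
  have hnorm : ∀ v : TangentBundle (𝓡 d) M, v.2 ≠ 0 → 0 < q v ∧ q ⟨v.1, (q v)⁻¹ • v.2⟩ = 1 := by
    intro v hv
    have h0 := h.norm_add_pos v.1 v.2 hv
    refine ⟨h0, ?_⟩
    rw [hqs, abs_of_pos (inv_pos.2 h0)]
    exact inv_mul_cancel₀ h0.ne'
  have ev1 : ∀ᶠ s in 𝓝 t, ∀ v : TangentBundle (𝓡 d) M, h.normL v ≤ h.normR v →
        h.normL ((tangentMap (𝓡 d) (𝓡 d) (F s))^[l] v) ≤
          h.normR ((tangentMap (𝓡 d) (𝓡 d) (F s))^[l] v) := by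
    have hK : IsCompact ({v | q v = 1} ∩ {v | h.normL v ≤ h.normR v}) :=
      hsph.inter_right (isClosed_le hcL hcR)
    have hopen : IsOpen {p : P × TangentBundle (𝓡 d) M |
        h.normL ((tangentMap (𝓡 d) (𝓡 d) (F p.1))^[l] p.2) <
          h.normR ((tangentMap (𝓡 d) (𝓡 d) (F p.1))^[l] p.2)} :=
      isOpen_lt (hcL.comp hg) (hcR.comp hg)
    obtain ⟨U, V, hU, -, htU, hKV, hUV⟩ := generalized_tube_lemma (isCompact_singleton (x := t)) hK
      hopen (by
        rintro ⟨s, v⟩ ⟨hs, hv1, hv2⟩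
        obtain rfl : s = t := hs
        exact hcone v hv1 hv2)
    filter_upwards [hU.mem_nhds (htU rfl)] with s hs v hv
    rcases eq_or_ne v.2 0 with h0 | h0
    · have hv0 : v = ⟨v.1, (0 : ℝ) • v.2⟩ := by rw [zero_smul, ← h0]
      rw [hv0, (hit s _ _ _).1, (hit s _ _ _).2]; simp
    · obtain ⟨hp, h1⟩ := hnorm v h0
      have h2 := hUV (a := (s, ⟨v.1, (q v)⁻¹ • v.2⟩)) ⟨hs, hKV ⟨h1, by
        change h.normL _ ≤ h.normR _
        rw [h.normL_smul, h.normR_smul]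
        exact mul_le_mul_of_nonneg_left hv (abs_nonneg _)⟩⟩
      change h.normL _ < h.normR _ at h2
      rw [(hit s _ _ _).1, (hit s _ _ _).2] at h2
      exact (lt_of_mul_lt_mul_left h2 (abs_nonneg _)).le
  refine ev1.and ?_
  have hb1 : Continuous fun p : TangentBundle (𝓡 d) M × TangentBundle (𝓡 d) M => p.1.1 :=
    (FiberBundle.continuous_proj _ _).comp continuous_fst
  have hb2 : Continuous fun p : TangentBundle (𝓡 d) M × TangentBundle (𝓡 d) M => p.2.1 :=
    (FiberBundle.continuous_proj _ _).comp continuous_snd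
  have hK : IsCompact (({v | q v = 1} ×ˢ ({v | q v = 1} ∩ {v | h.normL v ≤ h.normR v})) ∩
      {p : TangentBundle (𝓡 d) M × TangentBundle (𝓡 d) M | p.1.1 = p.2.1}) :=
    (hsph.prod (hsph.inter_right (isClosed_le hcL hcR))).inter_right (isClosed_eq hb1 hb2)
  have hg1 : Continuous fun p : P × (TangentBundle (𝓡 d) M × TangentBundle (𝓡 d) M) =>
      (tangentMap (𝓡 d) (𝓡 d) (F p.1))^[l] p.2.1 :=
    hg.comp (continuous_fst.prodMk (continuous_fst.comp continuous_snd))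
  have hg2 : Continuous fun p : P × (TangentBundle (𝓡 d) M × TangentBundle (𝓡 d) M) =>
      (tangentMap (𝓡 d) (𝓡 d) (F p.1))^[l] p.2.2 :=
    hg.comp (continuous_fst.prodMk (continuous_snd.comp continuous_snd))
  -- The alternative is phrased so that it is open: either the image of `u` lies in the open cone,
  -- or the growth inequality is strict. At `t` it holds on the compact set of pairs of unit vectors
  -- with `w` in the cone, hence on a tube around it.
  have hopen : IsOpen ({p : P × (TangentBundle (𝓡 d) M × TangentBundle (𝓡 d) M) |
        h.normL ((tangentMap (𝓡 d) (𝓡 d) (F p.1))^[l] p.2.1) <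
          h.normR ((tangentMap (𝓡 d) (𝓡 d) (F p.1))^[l] p.2.1)} ∪
      {p | 2 * (h.normL ((tangentMap (𝓡 d) (𝓡 d) (F p.1))^[l] p.2.1) * h.normR p.2.2) <
          h.normL p.2.1 * h.normR ((tangentMap (𝓡 d) (𝓡 d) (F p.1))^[l] p.2.2)}) := by
    refine (isOpen_lt (hcL.comp hg1) (hcR.comp hg1)).union (isOpen_lt ?_ ?_)
    · exact continuous_const.mul ((hcL.comp hg1).mul (hcR.comp (continuous_snd.comp continuous_snd)))
    · exact (hcL.comp (continuous_fst.comp continuous_snd)).mul (hcR.comp hg2)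
  obtain ⟨U, V, hU, -, htU, hKV, hUV⟩ := generalized_tube_lemma (isCompact_singleton (x := t)) hK
      hopen (by
        rintro ⟨s, u, w⟩ ⟨hs, ⟨hu, hw1, hw2⟩, huw⟩
        obtain rfl : s = t := hs
        obtain ⟨x, u⟩ := u
        obtain ⟨y, w⟩ := w
        obtain rfl : x = y := huw
        by_cases hcu : h.normL ⟨x, u⟩ ≤ h.normR ⟨x, u⟩
        · exact Or.inl (hcone _ hu hcu)
        · right
          change h.normL ⟨x, w⟩ ≤ h.normR ⟨x, w⟩ at hw2
          change h.normL ⟨x, w⟩ + h.normR ⟨x, w⟩ = 1 at hw1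
          have h1 := hl x u w
          have h2 := h1.2 (by linarith)
          have h3 : 0 < h.normL ⟨x, u⟩ := (h.normR_nonneg _).trans_lt (not_le.1 hcu)
          have h4 := mul_pos h3 h2
          have h5 : 2 * (h.normL ((tangentMap (𝓡 d) (𝓡 d) (F s))^[l] ⟨x, u⟩) * h.normR ⟨x, w⟩) <
            h.normL ⟨x, u⟩ * h.normR ((tangentMap (𝓡 d) (𝓡 d) (F s))^[l] ⟨x, w⟩) := by
            linarith [h1.1]
          exact h5)
  filter_upwards [hU.mem_nhds (htU rfl)] with s hs x u w hw hgu
  rcases eq_or_ne u 0 with h0 | h0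
  · exfalso
    have hv0 : u = (0 : ℝ) • (0 : TangentSpace (𝓡 d) x) := by rw [zero_smul, ← h0]
    rw [hv0, (hit s _ _ _).1, (hit s _ _ _).2] at hgu
    simp at hgu
  rcases eq_or_ne w 0 with h1 | h1
  · have hv0 : w = (0 : ℝ) • (0 : TangentSpace (𝓡 d) x) := by rw [zero_smul, ← h1]
    rw [hv0, (hit s _ _ _).2, h.normR_smul]
    simp
  obtain ⟨hpu, hqu⟩ := hnorm ⟨x, u⟩ h0
  obtain ⟨hpw, hqw⟩ := hnorm ⟨x, w⟩ h1
  set a := (q ⟨x, u⟩)⁻¹ with ha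
  set b := (q ⟨x, w⟩)⁻¹ with hb
  have ha0 : 0 < a := inv_pos.2 hpu
  have hb0 : 0 < b := inv_pos.2 hpw
  have h2 := hUV (a := (s, ⟨x, a • u⟩, ⟨x, b • w⟩)) ⟨hs, hKV ⟨⟨hqu, hqw, by
        change h.normL _ ≤ h.normR _
        rw [h.normL_smul, h.normR_smul]
        exact mul_le_mul_of_nonneg_left hw (abs_nonneg _)⟩, rfl⟩⟩
  rcases h2 with h2 | h2
  · change h.normL _ < h.normR _ at h2
    rw [(hit s _ _ _).1, (hit s _ _ _).2] at h2
    exact absurd (lt_of_mul_lt_mul_left h2 (abs_nonneg _)) hgu.not_gt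
  · change 2 * (h.normL _ * h.normR _) < h.normL _ * h.normR _ at h2
    rw [(hit s _ _ _).1, (hit s _ _ _).2, h.normL_smul, h.normR_smul, abs_of_pos ha0,
      abs_of_pos hb0] at h2
    refine le_of_lt (lt_of_mul_lt_mul_left (a := a * b) ?_ (mul_pos ha0 hb0).le)
    linarith

/-- Iterated form of the domination in the cone field. -/
lemma IsDominated.exists_cone_dom [T2Space M] [CompactSpace M] (hr : 1 ≤ r) {P : Type*}
    [TopologicalSpace P] {F : P → Diffeomorph (𝓡 d) (𝓡 d) M M r} (hF : IsC1Family F) (t : P)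
    {A B : (x : M) → Submodule ℝ (TangentSpace (𝓡 d) x)} (h : IsDominated γ (F t) A B) :
    ∃ l : ℕ, 0 < l ∧ ∃ C : ℝ, 0 < C ∧ ∀ᶠ s in 𝓝 t, ∀ n : ℕ, ∀ x, ∀ u w : TangentSpace (𝓡 d) x, w ∈ B x →
      mfderiv (𝓡 d) (𝓡 d) (F s)^[l * n] x u ∈ A ((F s)^[l * n] x) →
      2 ^ n * (riemNorm γ (mfderiv (𝓡 d) (𝓡 d) (F s)^[l * n] x u) * riemNorm γ w) ≤
        C * (riemNorm γ u * riemNorm γ (mfderiv (𝓡 d) (𝓡 d) (F s)^[l * n] x w)) := by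
  obtain ⟨l, hl0, hl⟩ := h.exists_cone_step hr hF t
  obtain ⟨C, hC0, hC⟩ := h.exists_norm_le
  refine ⟨l, hl0, C * C, by positivity, ?_⟩
  filter_upwards [hl] with s hs
  obtain ⟨hs1, hs2⟩ := hs
  set T := (tangentMap (𝓡 d) (𝓡 d) (F s))^[l] with hT
  have hfib : ∀ (x : M) (u w : TangentSpace (𝓡 d) x), ∃ (y : M) (u' w' : TangentSpace (𝓡 d) y),
      T ⟨x, u⟩ = ⟨y, u'⟩ ∧ T ⟨x, w⟩ = ⟨y, w'⟩ := by
    intro x u w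
    rw [hT, ← tangentMap_iterate ((F s).mdifferentiable_of_one_le hr)]
    exact ⟨_, _, _, rfl, rfl⟩
  have hinv : ∀ (n : ℕ) (v : TangentBundle (𝓡 d) M), h.normL v ≤ h.normR v →
      h.normL (T^[n] v) ≤ h.normR (T^[n] v) := by
    intro n
    induction n with
    | zero => exact fun v hv => hv
    | succ n ih => exact fun v hv => ih _ (hs1 v hv)
  -- The cone is invariant, so if the last image of `u` lies outside it, all earlier ones do. The
  -- one-step estimate then applies every time and the factors 2 multiply.
  have key : ∀ (n : ℕ) (x : M) (u w : TangentSpace (𝓡 d) x), h.normL ⟨x, w⟩ ≤ h.normR ⟨x, w⟩ →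
      h.normR (T^[n] ⟨x, u⟩) < h.normL (T^[n] ⟨x, u⟩) →
      2 ^ n * (h.normL (T^[n] ⟨x, u⟩) * h.normR ⟨x, w⟩) ≤
        h.normL ⟨x, u⟩ * h.normR (T^[n] ⟨x, w⟩) := by
    intro n
    induction n with
    | zero => intro x u w _ _; simp
    | succ n ih =>
      intro x u w hw hu
      simp only [Function.iterate_succ, Function.comp_apply] at hu ⊢
      have h1 := hs1 ⟨x, w⟩ hw
      have hu1 : h.normR (T ⟨x, u⟩) < h.normL (T ⟨x, u⟩) := by
        by_contra hcon
        exact absurd (hinv n _ (not_lt.1 hcon)) (not_le.2 hu)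
      have h2 := hs2 x u w hw hu1
      obtain ⟨y, u', w', e1, e2⟩ := hfib x u w
      rw [e1] at hu hu1 h2 ⊢
      rw [e2] at h1 h2 ⊢
      have h3 := ih y u' w' h1 hu
      have hpos : 0 < h.normL ⟨y, u'⟩ := (h.normR_nonneg _).trans_lt hu1
      have n1 := h.normL_nonneg (T^[n] ⟨y, u'⟩)
      have n2 := h.normR_nonneg (T^[n] ⟨y, w'⟩)
      have n3 := h.normR_nonneg ⟨x, w⟩
      have n4 := h.normL_nonneg ⟨x, u⟩
      -- The one-step estimate and the induction hypothesis share the factor `h.normL ⟨y, u'⟩`,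
      -- which cancels after multiplying them.
      refine le_of_mul_le_mul_left ?_ hpos
      have h4 := mul_le_mul_of_nonneg_left h2 (mul_nonneg (pow_nonneg zero_le_two n) n1)
      have h5 := mul_le_mul_of_nonneg_right h3 n4
      rw [pow_succ]
      linarith
  intro n x u w hw hu
  have hTn : T^[n] = tangentMap (𝓡 d) (𝓡 d) (F s)^[l * n] := by
    rw [hT, ← Function.iterate_mul, tangentMap_iterate ((F s).mdifferentiable_of_one_le hr)]
  have ewL : h.normL ⟨x, w⟩ = 0 := by
    simp only [IsDominated.normL, (h.proj_of_mem_right hw).1, riemNorm_zero]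
  have ewR : h.normR ⟨x, w⟩ = riemNorm γ w := by
    simp only [IsDominated.normR, (h.proj_of_mem_right hw).2]
  have euL : h.normL (T^[n] ⟨x, u⟩) = riemNorm γ (mfderiv (𝓡 d) (𝓡 d) (F s)^[l * n] x u) := by
    rw [hTn]
    exact congrArg (riemNorm γ) (h.proj_of_mem_left hu).1
  have euR : h.normR (T^[n] ⟨x, u⟩) = 0 := by
    rw [hTn]
    exact (congrArg (riemNorm γ) (h.proj_of_mem_left hu).2).trans (riemNorm_zero γ _)
  rcases (riemNorm_nonneg γ (mfderiv (𝓡 d) (𝓡 d) (F s)^[l * n] x u)).eq_or_lt with h0 | h0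
  · rw [← h0, zero_mul, mul_zero]
    have n1 := riemNorm_nonneg γ u
    have n2 := riemNorm_nonneg γ (mfderiv (𝓡 d) (𝓡 d) (F s)^[l * n] x w)
    positivity
  have h1 := key n x u w (by rw [ewL]; exact h.normR_nonneg _) (by rw [euL, euR]; exact h0)
  rw [euL, ewR] at h1
  refine h1.trans ?_
  have h2 := (hC x u).1
  have h3 : h.normR (T^[n] ⟨x, w⟩) ≤ C * riemNorm γ (mfderiv (𝓡 d) (𝓡 d) (F s)^[l * n] x w) := by
    rw [hTn]
    exact (hC _ _).2
  refine (mul_le_mul h2 h3 (h.normR_nonneg _) (mul_nonneg hC0.le (riemNorm_nonneg γ u))).trans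
    (le_of_eq ?_)
  ring

end Cones

/-! ### Transversality along paths of maps with dominated splittings -/

section Transversality

set_option linter.unusedSectionVars false

attribute [local instance 5000] isManifold_one_of_infty instTopologicalSpaceTangentBundle
attribute [local instance] tangentSpace_finiteDimensional

open Filter Topology

variable {d : ℕ} {M : Type*} [TopologicalSpace M]
  [ChartedSpace (EuclideanSpace ℝ (Fin d)) M] [IsManifold (𝓡 d) ∞ M] {r : ℕ∞}
  {γ : Bundle.ContMDiffRiemannianMetric (𝓡 d) ∞ (EuclideanSpace ℝ (Fin d))
      (fun x : M => TangentSpace (𝓡 d) x)}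

lemma finrank_add_of_isCompl {x : M} {A B : Submodule ℝ (TangentSpace (𝓡 d) x)}
    (h : IsCompl A B) : Module.finrank ℝ A + Module.finrank ℝ B = d := by
  rw [Submodule.finrank_add_eq_of_isCompl h, finrank_tangentSpace]

/-- Two subspaces whose dimensions add up to more than the dimension of the space meet. -/
lemma exists_ne_zero_mem_inf {x : M} {U W : Submodule ℝ (TangentSpace (𝓡 d) x)}
    (h : d < Module.finrank ℝ U + Module.finrank ℝ W) : ∃ u ≠ 0, u ∈ U ∧ u ∈ W := by
  by_contra! hcon
  have hd : Disjoint U W := by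
    rw [Submodule.disjoint_def]
    intro v hv hw
    by_contra h0
    exact hcon v h0 hv hw
  have h1 := Submodule.finrank_sup_add_finrank_inf_eq U W
  rw [hd.eq_bot, finrank_bot, add_zero] at h1
  have h2 := Submodule.finrank_le (U ⊔ W)
  rw [h1, finrank_tangentSpace] at h2
  omega

lemma isCompl_of_disjoint_of_finrank {x : M} {U W : Submodule ℝ (TangentSpace (𝓡 d) x)}
    (h : Disjoint U W) (hd : Module.finrank ℝ U + Module.finrank ℝ W = d) : IsCompl U W := by
  refine ⟨h, codisjoint_iff.2 (Submodule.eq_top_of_finrank_eq ?_)⟩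
  have h1 := Submodule.finrank_sup_add_finrank_inf_eq U W
  rw [h.eq_bot, finrank_bot, add_zero] at h1
  rw [h1, hd, finrank_tangentSpace]

lemma finrank_span_sup {x : M} {W : Submodule ℝ (TangentSpace (𝓡 d) x)}
    {v : TangentSpace (𝓡 d) x} (hv : v ∉ W) :
    Module.finrank ℝ (Submodule.span ℝ {v} ⊔ W : Submodule ℝ (TangentSpace (𝓡 d) x)) =
      Module.finrank ℝ W + 1 := by
  have h0 : v ≠ 0 := fun h => hv (h ▸ zero_mem W)
  have hd : Disjoint (Submodule.span ℝ {v}) W := by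
    rw [Submodule.disjoint_span_singleton' h0 |> disjoint_comm.trans]
    exact hv
  have h1 := Submodule.finrank_sup_add_finrank_inf_eq (Submodule.span ℝ {v}) W
  rw [hd.eq_bot, finrank_bot, add_zero, finrank_span_singleton h0] at h1
  omega

lemma finrank_map_iterate (hr : 1 ≤ r) {f : Diffeomorph (𝓡 d) (𝓡 d) M M r}
    {A : (x : M) → Submodule ℝ (TangentSpace (𝓡 d) x)}
    (hA : ∀ x v, mfderiv (𝓡 d) (𝓡 d) f x v ∈ A (f x) ↔ v ∈ A x) (n : ℕ) (x : M) :
    Module.finrank ℝ (A (f^[n] x)) = Module.finrank ℝ (A x) := by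
  let e := LinearEquiv.ofBijective (mfderiv (𝓡 d) (𝓡 d) f^[n] x).toLinearMap
    (mfderiv_iterate_bijective hr f n x)
  have h : (A x).map (e : _ →ₗ[ℝ] _) = A (f^[n] x) := by
    ext v
    constructor
    · rintro ⟨w, hw, rfl⟩
      exact (invariant_iterate hr hA n x w).2 hw
    · intro hv
      obtain ⟨w, rfl⟩ := e.surjective v
      exact ⟨w, (invariant_iterate hr hA n x w).1 hv, rfl⟩
  rw [← h]
  exact LinearEquiv.finrank_map_eq e (A x)

lemma finrank_comap_iterate (hr : 1 ≤ r) (f : Diffeomorph (𝓡 d) (𝓡 d) M M r) (n : ℕ) (x : M)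
    (W : Submodule ℝ (TangentSpace (𝓡 d) (f^[n] x))) :
    Module.finrank ℝ (W.comap (mfderiv (𝓡 d) (𝓡 d) f^[n] x).toLinearMap) = Module.finrank ℝ W := by
  let e := LinearEquiv.ofBijective (mfderiv (𝓡 d) (𝓡 d) f^[n] x).toLinearMap
    (mfderiv_iterate_bijective hr f n x)
  have h : (W.comap (mfderiv (𝓡 d) (𝓡 d) f^[n] x).toLinearMap).map (e : _ →ₗ[ℝ] _) = W :=
    Submodule.map_comap_eq_of_surjective e.surjective W
  conv_rhs => rw [← h]
  exact (LinearEquiv.finrank_map_eq e _).symm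

variable [T2Space M] [CompactSpace M]

/-- Dominated splittings of fixed ranks vary little: the bundles for nearby parameters stay
transverse. -/
lemma IsDominated.eventually_disjoint (hr : 1 ≤ r) {P : Type*}
    [TopologicalSpace P] {F : P → Diffeomorph (𝓡 d) (𝓡 d) M M r} (hF : IsC1Family F)
    {A B : P → (x : M) → Submodule ℝ (TangentSpace (𝓡 d) x)}
    (h : ∀ t, IsDominated γ (F t) (A t) (B t))
    (hA : ∀ s t x, Module.finrank ℝ (A s x) = Module.finrank ℝ (A t x)) (t : P) :
    ∀ᶠ s in 𝓝 t, ∀ x, Disjoint (A s x) (B t x) ∧ Disjoint (A t x) (B s x) := by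
  obtain ⟨l, hl0, C, hC0, hl⟩ := (h t).exists_cone_dom hr hF t
  filter_upwards [hl] with s hs
  -- `K` and `m₀` depend on `s`. This is harmless because on the chosen neighbourhood the cone
  -- estimate holds for every `n`, and `n` is fixed only after `s`.
  obtain ⟨K, hK0, hK⟩ := (h s).exists_norm_le
  obtain ⟨m₀, hm₀⟩ := (h s).dom 1 one_pos
  obtain ⟨n, hn, hn2⟩ : ∃ n, m₀ ≤ l * n ∧ 2 * K * C < 2 ^ n := by
    obtain ⟨n₁, hn₁⟩ := pow_unbounded_of_one_lt (2 * K * C) (one_lt_two (α := ℝ))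
    exact ⟨max m₀ n₁, (le_max_left _ _).trans (Nat.le_mul_of_pos_left _ hl0),
      hn₁.trans_le (pow_le_pow_right₀ one_le_two (le_max_right _ _))⟩
  have hdom := hm₀ _ hn
  have hBrank : ∀ s t x, Module.finrank ℝ (B s x) = Module.finrank ℝ (B t x) := by
    intro s t x
    have h1 := finrank_add_of_isCompl ((h s).compl x)
    have h2 := finrank_add_of_isCompl ((h t).compl x)
    have h3 := hA s t x
    omega
  set g := (F s)^[l * n] with hg
  have hinj := fun x => (mfderiv_iterate_bijective hr (F s) (l * n) x).1
  have hne : ∀ (x : M) (v : TangentSpace (𝓡 d) x), v ≠ 0 → mfderiv (𝓡 d) (𝓡 d) g x v ≠ 0 :=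
    fun x v hv h0 => hv (hinj x (h0.trans (map_zero _).symm))
  -- The first estimate will come from the cones of `F t`, the second from the splitting of `F s`.
  -- They are incompatible since `2 ^ n` exceeds `2 * K * C`.
  have hcompare : ∀ (x : M) (u v : TangentSpace (𝓡 d) x), u ≠ 0 → v ≠ 0 →
      2 ^ n * (riemNorm γ (mfderiv (𝓡 d) (𝓡 d) g x u) * riemNorm γ v) ≤
        C * (riemNorm γ u * riemNorm γ (mfderiv (𝓡 d) (𝓡 d) g x v)) →
      riemNorm γ u * riemNorm γ (mfderiv (𝓡 d) (𝓡 d) g x v) ≤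
        2 * K * (riemNorm γ (mfderiv (𝓡 d) (𝓡 d) g x u) * riemNorm γ v) → False := by
    intro x u v hu hv h1 h2
    have p := mul_pos (riemNorm_pos γ (hne x u hu)) (riemNorm_pos γ hv)
    have h3 := mul_le_mul_of_nonneg_left h2 hC0.le
    have h4 := (mul_lt_mul_iff_left₀ p).2 hn2
    linarith
  intro x
  constructor
  · rw [Submodule.disjoint_def]
    intro v hvA hvB
    by_contra hv0
    have hvB' : v ∉ B s x := fun h0 =>
      hv0 (Submodule.disjoint_def.1 ((h s).compl x).disjoint v hvA h0)
    -- The dimensions add up to `d + 1`. As `v` lies in the dominated bundle of `F s`, the vector `u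
    -- = c • v + b` grows at least like `v` up to the factor `2 * K`. But `v` lies in `B t` and the
    -- image of `u` in `A t`, so by the cone estimate `u` grows far less.
    obtain ⟨u, hu0, hu1, hu2⟩ := exists_ne_zero_mem_inf (x := x)
      (U := (A t (g x)).comap (mfderiv (𝓡 d) (𝓡 d) g x).toLinearMap)
      (W := Submodule.span ℝ {v} ⊔ B s x) (by
        rw [finrank_span_sup hvB', hg, finrank_comap_iterate hr, hA t s,
          finrank_map_iterate hr (h s).inv_left]
        have h1 := finrank_add_of_isCompl ((h s).compl x)
        omega)
    obtain ⟨a, ha, b, hb, rfl⟩ := Submodule.mem_sup.1 hu2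
    obtain ⟨c, rfl⟩ := Submodule.mem_span_singleton.1 ha
    refine hcompare x _ v hu0 hv0 (hs n x _ v hvB hu1) ?_
    have hcA : c • v ∈ A s x := Submodule.smul_mem _ c hvA
    have e1 := (h s).proj_iterate hr (l * n) x (c • v + b)
    rw [((h s).proj_add hcA hb).1, ((h s).proj_add hcA hb).2] at e1
    have e2 := hK (g x) (mfderiv (𝓡 d) (𝓡 d) g x (c • v + b))
    have e3 : riemNorm γ (mfderiv (𝓡 d) (𝓡 d) g x (c • v)) ≤
        K * riemNorm γ (mfderiv (𝓡 d) (𝓡 d) g x (c • v + b)) := by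
      rw [← e1.1]; exact e2.1
    have e4 : riemNorm γ (mfderiv (𝓡 d) (𝓡 d) g x b) ≤
        K * riemNorm γ (mfderiv (𝓡 d) (𝓡 d) g x (c • v + b)) := by
      rw [← e1.2]; exact e2.2
    have e5 := hdom x v hvA b hb
    have e6 := riemNorm_add_le γ (c • v) b
    have n0 := riemNorm_nonneg γ v
    have n1 := riemNorm_nonneg γ (mfderiv (𝓡 d) (𝓡 d) g x v)
    have e7 : riemNorm γ (mfderiv (𝓡 d) (𝓡 d) g x (c • v)) =
        |c| * riemNorm γ (mfderiv (𝓡 d) (𝓡 d) g x v) := by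
      rw [map_smul]; exact riemNorm_smul γ c _
    rw [riemNorm_smul] at e6
    rw [e7] at e3
    have e8 := mul_le_mul_of_nonneg_right e6 n1
    have e9 := mul_le_mul_of_nonneg_right e3 n0
    have e10 := mul_le_mul_of_nonneg_right e4 n0
    linarith
  · rw [Submodule.disjoint_def]
    intro v hvA hvB
    by_contra hv0
    obtain ⟨y, rfl⟩ : ∃ y, g y = x := ((F s).bijective.surjective.iterate (l * n)) x
    obtain ⟨v, rfl⟩ := (mfderiv_iterate_bijective hr (F s) (l * n) y).2 v
    have hvBs : v ∈ B s y := (invariant_iterate hr (h s).inv_right (l * n) y v).1 hvB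
    have hv0' : v ≠ 0 := fun h0 => hv0 (by rw [h0]; exact map_zero _)
    have hvA' : v ∉ A s y := fun h0 =>
      hv0' (Submodule.disjoint_def.1 ((h s).compl y).disjoint v h0 hvBs)
    -- The mirror image, read at the preimage `y`. Now `v` lies in the dominating bundle of `F s`,
    -- so `w` in the span of `v` and `A s` grows at most like `v`, whereas the cone estimate demands
    -- far more.
    obtain ⟨w, hw0, hw1, hw2⟩ := exists_ne_zero_mem_inf (x := y)
      (U := B t y) (W := Submodule.span ℝ {v} ⊔ A s y) (by
        rw [finrank_span_sup hvA', hBrank t s]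
        have h1 := finrank_add_of_isCompl ((h s).compl y)
        omega)
    obtain ⟨b, hb, a, ha, rfl⟩ := Submodule.mem_sup.1 hw2
    obtain ⟨c, rfl⟩ := Submodule.mem_span_singleton.1 hb
    refine hcompare y v _ hv0' hw0 (hs n y v _ hw1 hvA) ?_
    have hcB : c • v ∈ B s y := Submodule.smul_mem _ c hvBs
    have e1 := (h s).proj_add ha hcB
    have e2 := hK y (a + c • v)
    simp only [IsDominated.normL, IsDominated.normR, e1.1, e1.2] at e2
    rw [add_comm (c • v) a]
    have e5 := hdom y a ha v hvBs
    have e6 := riemNorm_add_le γ (mfderiv (𝓡 d) (𝓡 d) g y a) (mfderiv (𝓡 d) (𝓡 d) g y (c • v))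
    have n0 := riemNorm_nonneg γ v
    have n1 := riemNorm_nonneg γ (mfderiv (𝓡 d) (𝓡 d) g y v)
    have e7 : riemNorm γ (mfderiv (𝓡 d) (𝓡 d) g y (c • v)) =
        |c| * riemNorm γ (mfderiv (𝓡 d) (𝓡 d) g y v) := by
      rw [map_smul]; exact riemNorm_smul γ c _
    rw [e7] at e6
    rw [riemNorm_smul] at e2
    have e0 : mfderiv (𝓡 d) (𝓡 d) g y (a + c • v) =
      mfderiv (𝓡 d) (𝓡 d) g y a + mfderiv (𝓡 d) (𝓡 d) g y (c • v) := map_add _ _ _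
    rw [e0]
    have e8 := mul_le_mul_of_nonneg_right e6 n0
    have e9 := mul_le_mul_of_nonneg_right e2.1 n1
    have e10 := mul_le_mul_of_nonneg_right e2.2 n1
    linarith

/-- Composition with a high iterate of a map with a dominated splitting creates transversality. -/
lemma IsDominated.exists_forall_transverse (hr : 1 ≤ r) {f f₀ f' k : Diffeomorph (𝓡 d) (𝓡 d) M M r}
    {A B A₀ B₀ A' B' : (x : M) → Submodule ℝ (TangentSpace (𝓡 d) x)}
    (h : IsDominated γ f A B) (h₀ : IsDominated γ f₀ A₀ B₀) (h' : IsDominated γ f' A' B')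
    (hk : ∀ x, ∀ v ∈ B₀ x, mfderiv (𝓡 d) (𝓡 d) k x v ∈ A (k x) → v = 0)
    (hBA : ∀ x, Disjoint (A' x) (B x)) :
    ∃ m₀ : ℕ, ∀ m ≥ m₀, ∀ x, ∀ v ∈ B₀ x,
      mfderiv (𝓡 d) (𝓡 d) (f^[m] ∘ k) x v ∈ A' (f^[m] (k x)) → v = 0 := by
  have hkd := k.mdifferentiable_of_one_le hr
  have hcT : Continuous (tangentMap (𝓡 d) (𝓡 d) k) :=
    k.contMDiff.continuous_tangentMap (by exact_mod_cast hr)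
  have hsm : ∀ (x : M) (c : ℝ) (v : TangentSpace (𝓡 d) x), tangentMap (𝓡 d) (𝓡 d) k ⟨x, c • v⟩ =
      ⟨k x, c • mfderiv (𝓡 d) (𝓡 d) k x v⟩ := by
    intro x c v
    simp [tangentMap]
  -- The sum is positive on nonzero vectors exactly because `k` maps `B₀` transversally to `A`. On
  -- `B₀` its first term vanishes, so the image of `B₀` lies in a cone of width `C₁` around `B`.
  obtain ⟨C₁, hC₁0, hC₁⟩ := exists_le_mul_tangent
    (fun v => h₀.normL v + h.normR (tangentMap (𝓡 d) (𝓡 d) k v))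
    (fun v => h.normL (tangentMap (𝓡 d) (𝓡 d) k v))
    (h₀.continuous_normL.add (h.continuous_normR.comp hcT))
    (fun x c v => by
      rw [h₀.normL_smul, hsm, h.normR_smul, mul_add]; rfl)
    (fun x v hv => by
      have n1 := h₀.normL_nonneg ⟨x, v⟩
      have n2 := h.normR_nonneg (tangentMap (𝓡 d) (𝓡 d) k ⟨x, v⟩)
      refine lt_of_le_of_ne (add_nonneg n1 n2) fun h0 => hv ?_
      have z1 : h₀.normL ⟨x, v⟩ = 0 := by linarith
      have z2 : h.normR (tangentMap (𝓡 d) (𝓡 d) k ⟨x, v⟩) = 0 := by linarith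
      refine hk x v ?_ ?_
      · have := h₀.projL_add_projR x v
        rw [(riemNorm_eq_zero γ).1 z1, zero_add] at this
        rw [← this]; exact h₀.projR_mem x v
      · have := h.projL_add_projR (k x) (mfderiv (𝓡 d) (𝓡 d) k x v)
        have z3 : h.projR (k x) (mfderiv (𝓡 d) (𝓡 d) k x v) = 0 := (riemNorm_eq_zero γ).1 z2
        rw [z3, add_zero] at this
        rw [← this]; exact h.projL_mem _ _)
    (h.continuous_normL.comp hcT)
    (fun x c v => by rw [hsm, h.normL_smul]; rfl)
  -- The same device places `A'` in a cone of width `C₂` around `A`.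
  obtain ⟨C₂, hC₂0, hC₂⟩ := exists_le_mul_tangent
    (fun v => h'.normR v + h.normL v) h.normR
    (h'.continuous_normR.add h.continuous_normL)
    (fun x c v => by rw [h'.normR_smul, h.normL_smul, mul_add])
    (fun x v hv => by
      have n1 := h'.normR_nonneg ⟨x, v⟩
      have n2 := h.normL_nonneg ⟨x, v⟩
      refine lt_of_le_of_ne (add_nonneg n1 n2) fun h0 => hv ?_
      have z1 : h'.normR ⟨x, v⟩ = 0 := by linarith
      have z2 : h.normL ⟨x, v⟩ = 0 := by linarith
      refine Submodule.disjoint_def.1 (hBA x) v ?_ ?_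
      · have := h'.projL_add_projR x v
        rw [(riemNorm_eq_zero γ).1 z1, add_zero] at this
        rw [← this]; exact h'.projL_mem x v
      · have := h.projL_add_projR x v
        rw [(riemNorm_eq_zero γ).1 z2, zero_add] at this
        rw [← this]; exact h.projR_mem _ _)
    h.continuous_normR h.normR_smul
  -- This constant narrows the cone around `B` until it meets the cone around `A` only in zero; the
  -- factor 2 makes the final comparison strict.
  obtain ⟨m₀, hm₀⟩ := h.dom (1 / (2 * C₁ * C₂)) (by positivity)
  refine ⟨m₀, fun m hm x v hv hvA => ?_⟩
  set w := mfderiv (𝓡 d) (𝓡 d) k x v with hw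
  have hcomp : mfderiv (𝓡 d) (𝓡 d) (f^[m] ∘ k) x v = mfderiv (𝓡 d) (𝓡 d) f^[m] (k x) w := by
    rw [mfderiv_comp x ((f.mdifferentiable_of_one_le hr).iterate m (k x)) (hkd x)]
    rfl
  rw [hcomp] at hvA
  set z := mfderiv (𝓡 d) (𝓡 d) f^[m] (k x) w with hz
  have e1 : h.normL ⟨k x, w⟩ ≤ C₁ * h.normR ⟨k x, w⟩ := by
    have : h.normL ⟨k x, w⟩ ≤ C₁ * (h₀.normL ⟨x, v⟩ + h.normR ⟨k x, w⟩) := hC₁ ⟨x, v⟩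
    have h0 : h₀.normL ⟨x, v⟩ = 0 := by
      simp only [IsDominated.normL, (h₀.proj_of_mem_right hv).1, riemNorm_zero]
    rwa [h0, zero_add] at this
  have e2 : h.normR ⟨f^[m] (k x), z⟩ ≤ C₂ * h.normL ⟨f^[m] (k x), z⟩ := by
    have := hC₂ ⟨f^[m] (k x), z⟩
    have h0 : h'.normR ⟨f^[m] (k x), z⟩ = 0 := by
      simp only [IsDominated.normR, (h'.proj_of_mem_left hvA).2, riemNorm_zero]
    rwa [h0, zero_add] at this
  have e3 := hm₀ m hm (k x) _ (h.projL_mem (k x) w) _ (h.projR_mem (k x) w)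
  have e4 := h.proj_iterate hr m (k x) w
  rw [← e4.1, ← e4.2] at e3
  change h.normL ⟨f^[m] (k x), z⟩ * h.normR ⟨k x, w⟩ ≤ 1 / (2 * C₁ * C₂) *
    (h.normL ⟨k x, w⟩ * h.normR ⟨f^[m] (k x), z⟩) at e3
  by_contra hv0
  have hw0 : w ≠ 0 := fun h0 => hv0 ((mfderiv_bijective hr k x).1 (h0.trans (map_zero _).symm))
  have hz0 : z ≠ 0 := fun h0 => hw0
    ((mfderiv_iterate_bijective hr f m (k x)).1 (h0.trans (map_zero _).symm))
  have p1 := h.norm_add_pos _ w hw0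
  have p2 := h.norm_add_pos _ z hz0
  set a := h.normL ⟨k x, w⟩
  set b := h.normR ⟨k x, w⟩
  set a' := h.normL ⟨f^[m] (k x), z⟩
  set b' := h.normR ⟨f^[m] (k x), z⟩
  have n3 : 0 ≤ b := h.normR_nonneg _
  have n4 : 0 ≤ a' := h.normL_nonneg _
  have n5 : 0 ≤ b' := h.normR_nonneg _
  have hb : 0 < b := by
    rcases n3.eq_or_lt with h0 | h0
    · rw [← h0, mul_zero] at e1; linarith
    · exact h0
  have ha' : 0 < a' := by
    rcases n4.eq_or_lt with h0 | h0
    · rw [← h0, mul_zero] at e2; linarith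
    · exact h0
  have e5 : a * b' ≤ (C₁ * b) * (C₂ * a') := mul_le_mul e1 e2 n5 (by positivity)
  have e6 : 1 / (2 * C₁ * C₂) * (a * b') ≤ 1 / (2 * C₁ * C₂) * ((C₁ * b) * (C₂ * a')) :=
    mul_le_mul_of_nonneg_left e5 (by positivity)
  have e7 : 1 / (2 * C₁ * C₂) * ((C₁ * b) * (C₂ * a')) = (a' * b) / 2 := by
    field_simp
  have := mul_pos ha' hb
  linarith

/-- Compositions of `n` members of a family of diffeomorphisms. -/
inductive IsWord {P : Type*} (F : P → Diffeomorph (𝓡 d) (𝓡 d) M M r) :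
    ℕ → Diffeomorph (𝓡 d) (𝓡 d) M M r → Prop
  | refl : IsWord F 0 (Diffeomorph.refl (𝓡 d) M r)
  | trans {n : ℕ} {k : Diffeomorph (𝓡 d) (𝓡 d) M M r} (h : IsWord F n k) (t : P) :
    IsWord F (n + 1) (k.trans (F t))

lemma IsWord.iterate {P : Type*} {F : P → Diffeomorph (𝓡 d) (𝓡 d) M M r} {n : ℕ}
    {k : Diffeomorph (𝓡 d) (𝓡 d) M M r} (h : IsWord F n k) (t : P) (m : ℕ) :
    ∃ k', IsWord F (n + m) k' ∧ ⇑k' = (F t)^[m] ∘ k := by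
  induction m with
  | zero => exact ⟨k, h, rfl⟩
  | succ m ih =>
    obtain ⟨k', hk', e⟩ := ih
    refine ⟨k'.trans (F t), hk'.trans t, ?_⟩
    rw [Diffeomorph.coe_trans, e, Function.iterate_succ']
    rfl

/-- Along a path of maps with dominated splittings of constant ranks, long suitable compositions
map the dominating bundles of one end to complements of the dominated bundles of the other end. -/
theorem exists_isWord_transverse (hr : 1 ≤ r) {P ι : Type*} [Finite ι] [TopologicalSpace P]
    [PreconnectedSpace P] {F : P → Diffeomorph (𝓡 d) (𝓡 d) M M r} (hF : IsC1Family F)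
    {A B : ι → P → (x : M) → Submodule ℝ (TangentSpace (𝓡 d) x)}
    (h : ∀ i t, IsDominated γ (F t) (A i t) (B i t))
    (hA : ∀ i s t x, Module.finrank ℝ (A i s x) = Module.finrank ℝ (A i t x)) (a b : P) :
    ∃ N₀ : ℕ, ∀ N ≥ N₀, ∃ k, IsWord F N k ∧
      ∀ i x, ∀ v ∈ B i a x, mfderiv (𝓡 d) (𝓡 d) k x v ∈ A i b (k x) → v = 0 := by
  let Z : Set P := {t | ∃ N k, IsWord F N k ∧
      ∀ i x, ∀ v ∈ B i a x, mfderiv (𝓡 d) (𝓡 d) k x v ∈ A i t (k x) → v = 0}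
  have step : ∀ s t, (∀ i x, Disjoint (A i t x) (B i s x)) → s ∈ Z → t ∈ Z := by
    rintro s t hst ⟨N, k, hk, hkt⟩
    choose m₀ hm₀ using fun i => (h i s).exists_forall_transverse hr (h i a) (h i t) (hkt i) (hst i)
    -- The same composition has to serve every `i`, so one number of iterations is taken for all of
    -- the finitely many splittings.
    obtain ⟨m, hm⟩ := (Set.finite_range m₀).bddAbove
    obtain ⟨k', hk', e⟩ := hk.iterate s m
    refine ⟨_, k', hk', fun i x v hv hva => hm₀ i m (hm ⟨i, rfl⟩) x v hv ?_⟩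
    have e2 : k' x = (F s)^[m] (k x) := congrFun e x
    rw [e] at hva
    exact hva
  -- Disjointness of nearby bundles is available in both directions, so membership in `Z` is a
  -- locally constant property.
  have hev : ∀ t, ∀ᶠ s in 𝓝 t, s ∈ Z ↔ t ∈ Z := by
    intro t
    have := fun i => IsDominated.eventually_disjoint hr hF (h i) (hA i) t
    filter_upwards [eventually_all.2 this] with s hs
    exact ⟨step s t fun i x => (hs i x).2, step t s fun i x => (hs i x).1⟩
  have hopen : IsOpen Z := isOpen_iff_mem_nhds.2 fun t ht =>
    (hev t).mono fun s hs => hs.2 ht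
  have hclosed : IsClosed Z := isOpen_compl_iff.1 <| isOpen_iff_mem_nhds.2 fun t ht =>
    (hev t).mono fun s hs h0 => ht (hs.1 h0)
  have ha : a ∈ Z := by
    refine ⟨0, _, IsWord.refl, fun i x v hv hva => ?_⟩
    have e : mfderiv (𝓡 d) (𝓡 d) (Diffeomorph.refl (𝓡 d) M r) x v = v := by
      rw [Diffeomorph.coe_refl, mfderiv_id]; rfl
    rw [e] at hva
    exact Submodule.disjoint_def.1 ((h i a).compl x).disjoint v hva hv
  have huniv : Z = Set.univ := IsClopen.eq_univ ⟨hclosed, hopen⟩ ⟨a, ha⟩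
  obtain ⟨N₀, k, hk, hkb⟩ : b ∈ Z := huniv ▸ Set.mem_univ b
  refine ⟨N₀, fun N hN => ?_⟩
  -- The missing length is filled with iterates of `F b`, which preserve `A i b` and therefore
  -- transversality to it.
  obtain ⟨m, rfl⟩ := Nat.exists_eq_add_of_le hN
  obtain ⟨k', hk', e⟩ := hk.iterate b m
  refine ⟨k', hk', fun i x v hv hva => hkb i x v hv ?_⟩
  have hcomp : mfderiv (𝓡 d) (𝓡 d) k' x v =
      mfderiv (𝓡 d) (𝓡 d) (F b)^[m] (k x) (mfderiv (𝓡 d) (𝓡 d) k x v) := by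
    rw [e, mfderiv_comp x (((F b).mdifferentiable_of_one_le hr).iterate m (k x))
      (k.mdifferentiable_of_one_le hr x)]
    rfl
  rw [hcomp] at hva
  refine (invariant_iterate hr (h i b).inv_left m (k x) _).1 ?_
  have e2 : k' x = (F b)^[m] (k x) := congrFun e x
  rw [e2] at hva
  exact hva

end Transversality

/-! ### From partial hyperbolicity to the two dominated splittings -/

section PartialHyperbolicity

set_option linter.unusedSectionVars false

attribute [local instance 5000] isManifold_one_of_infty instTopologicalSpaceTangentBundle
attribute [local instance] tangentSpace_finiteDimensional

open Filter Topology

variable {d : ℕ} {M : Type*} [TopologicalSpace M]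
  [ChartedSpace (EuclideanSpace ℝ (Fin d)) M] [IsManifold (𝓡 d) ∞ M] {r : ℕ∞}
  {γ : Bundle.ContMDiffRiemannianMetric (𝓡 d) ∞ (EuclideanSpace ℝ (Fin d))
      (fun x : M => TangentSpace (𝓡 d) x)}

/-- The hyperbolicity inequalities concern triples of unit vectors. Comparing two of the bundles
therefore needs a unit vector in the third, which nontriviality provides. -/
lemma exists_riemNorm_eq_one {x : M} {W : Submodule ℝ (TangentSpace (𝓡 d) x)} (hW : W ≠ ⊥) :
    ∃ v ∈ W, riemNorm γ v = 1 := by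
  obtain ⟨v, hv, h0⟩ := W.ne_bot_iff.1 hW
  refine ⟨(riemNorm γ v)⁻¹ • v, W.smul_mem _ hv, ?_⟩
  have := riemNorm_pos γ h0
  rw [riemNorm_smul, abs_of_pos (inv_pos.2 this), inv_mul_cancel₀ this.ne']

/-- The bundle `E'` dominates `E` by the factor `c` after `l` iterations. -/
def DominatesBy (γ : Bundle.ContMDiffRiemannianMetric (𝓡 d) ∞ (EuclideanSpace ℝ (Fin d))
      (fun x : M => TangentSpace (𝓡 d) x)) (f : Diffeomorph (𝓡 d) (𝓡 d) M M r)
    (E E' : (x : M) → Submodule ℝ (TangentSpace (𝓡 d) x)) (l : ℕ) (c : ℝ) : Prop :=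
  ∀ x, ∀ a ∈ E x, ∀ b ∈ E' x,
    riemNorm γ (mfderiv (𝓡 d) (𝓡 d) f^[l] x a) * riemNorm γ b ≤
      c * (riemNorm γ a * riemNorm γ (mfderiv (𝓡 d) (𝓡 d) f^[l] x b))

variable {f : Diffeomorph (𝓡 d) (𝓡 d) M M r}
  {E E' : (x : M) → Submodule ℝ (TangentSpace (𝓡 d) x)}

lemma riemNorm_mfderiv_iterate_add (hr : 1 ≤ r) (l l' : ℕ) (x : M) (v : TangentSpace (𝓡 d) x) :
    riemNorm γ (mfderiv (𝓡 d) (𝓡 d) f^[l + l'] x v) = riemNorm γ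
      (mfderiv (𝓡 d) (𝓡 d) f^[l] (f^[l'] x) (mfderiv (𝓡 d) (𝓡 d) f^[l'] x v)) := by
  have hf := f.mdifferentiable_of_one_le hr
  have h : tangentMap (𝓡 d) (𝓡 d) f^[l + l'] ⟨x, v⟩ =
      tangentMap (𝓡 d) (𝓡 d) f^[l] (tangentMap (𝓡 d) (𝓡 d) f^[l'] ⟨x, v⟩) := by
    rw [tangentMap_iterate hf, tangentMap_iterate hf, tangentMap_iterate hf,
      Function.iterate_add_apply]
  exact congrArg (fun w : TangentBundle (𝓡 d) M => riemNorm γ w.2) h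

/-- The chain rule multiplies the two inequalities, and the length of the intermediate image of `b`
cancels. -/
lemma DominatesBy.add (hr : 1 ≤ r)
    (hE : ∀ x v, mfderiv (𝓡 d) (𝓡 d) f x v ∈ E (f x) ↔ v ∈ E x)
    (hE' : ∀ x v, mfderiv (𝓡 d) (𝓡 d) f x v ∈ E' (f x) ↔ v ∈ E' x)
    {l l' : ℕ} {c c' : ℝ} (hc : 0 ≤ c) (h : DominatesBy γ f E E' l c)
    (h' : DominatesBy γ f E E' l' c') : DominatesBy γ f E E' (l + l') (c * c') := by
  intro x a ha b hb
  rw [riemNorm_mfderiv_iterate_add hr, riemNorm_mfderiv_iterate_add hr]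
  rcases eq_or_ne b 0 with h0 | h0
  · subst h0
    have e : riemNorm γ (mfderiv (𝓡 d) (𝓡 d) f^[l] (f^[l'] x)
        (mfderiv (𝓡 d) (𝓡 d) f^[l'] x 0)) = 0 := by
      rw [map_zero, map_zero]
      exact riemNorm_zero γ _
    rw [e, riemNorm_zero]; simp
  have h1 := h (f^[l'] x) _ ((invariant_iterate hr hE l' x a).2 ha) _
    ((invariant_iterate hr hE' l' x b).2 hb)
  have h2 := h' x a ha b hb
  have hb' : 0 < riemNorm γ (mfderiv (𝓡 d) (𝓡 d) f^[l'] x b) := riemNorm_pos γ fun h3 =>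
    h0 ((mfderiv_iterate_bijective hr f l' x).1 (h3.trans (map_zero _).symm))
  refine le_of_mul_le_mul_left ?_ hb'
  have h3 := mul_le_mul_of_nonneg_left h1 (riemNorm_nonneg γ b)
  have h4 := mul_le_mul_of_nonneg_left h2 (mul_nonneg hc (riemNorm_nonneg γ
    (mfderiv (𝓡 d) (𝓡 d) f^[l] (f^[l'] x) (mfderiv (𝓡 d) (𝓡 d) f^[l'] x b))))
  linarith

variable [T2Space M] [CompactSpace M]

/-- By compactness a single iteration distorts lengths by bounded factors in both directions. This
controls the remainder when the number of iterations is divided by `l`. -/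
lemma exists_dominatesBy_one (hr : 1 ≤ r) (f : Diffeomorph (𝓡 d) (𝓡 d) M M r)
    (E E' : (x : M) → Submodule ℝ (TangentSpace (𝓡 d) x)) :
    ∃ C, 1 ≤ C ∧ DominatesBy γ f E E' 1 C := by
  have hT : Continuous (tangentMap (𝓡 d) (𝓡 d) f) :=
    f.contMDiff.continuous_tangentMap (by exact_mod_cast hr)
  have hn := continuous_riemNorm γ
  have hs : ∀ (x : M) (c : ℝ) (v : TangentSpace (𝓡 d) x),
      riemNorm γ (tangentMap (𝓡 d) (𝓡 d) f ⟨x, c • v⟩).2 =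
        |c| * riemNorm γ (tangentMap (𝓡 d) (𝓡 d) f ⟨x, v⟩).2 := by
    intro x c v
    have : (tangentMap (𝓡 d) (𝓡 d) f ⟨x, c • v⟩).2 = c • mfderiv (𝓡 d) (𝓡 d) f x v :=
      map_smul _ _ _
    rw [this]
    exact riemNorm_smul γ c _
  obtain ⟨C₁, hC₁, h1⟩ := exists_le_mul_tangent (fun v : TangentBundle (𝓡 d) M => riemNorm γ v.2)
    (fun v => riemNorm γ (tangentMap (𝓡 d) (𝓡 d) f v).2) hn (fun x c v => riemNorm_smul γ c v)
    (fun x v hv => riemNorm_pos γ hv) (hn.comp hT) hs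
  obtain ⟨C₂, hC₂, h2⟩ := exists_le_mul_tangent
    (fun v => riemNorm γ (tangentMap (𝓡 d) (𝓡 d) f v).2)
    (fun v : TangentBundle (𝓡 d) M => riemNorm γ v.2) (hn.comp hT) hs
    (fun x v hv => riemNorm_pos γ fun h0 =>
      hv ((mfderiv_bijective hr f x).1 (h0.trans (map_zero _).symm)))
    hn (fun x c v => riemNorm_smul γ c v)
  refine ⟨max (C₁ * C₂) 1, le_max_right _ _, fun x a _ b _ => ?_⟩
  have e1 : riemNorm γ (mfderiv (𝓡 d) (𝓡 d) f x a) ≤ C₁ * riemNorm γ a := h1 ⟨x, a⟩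
  have e2 : riemNorm γ b ≤ C₂ * riemNorm γ (mfderiv (𝓡 d) (𝓡 d) f x b) := h2 ⟨x, b⟩
  have n1 := riemNorm_nonneg γ a
  have n2 := riemNorm_nonneg γ (mfderiv (𝓡 d) (𝓡 d) f x b)
  change riemNorm γ (mfderiv (𝓡 d) (𝓡 d) f x a) * riemNorm γ b ≤ max (C₁ * C₂) 1 *
    (riemNorm γ a * riemNorm γ (mfderiv (𝓡 d) (𝓡 d) f x b))
  have e3 := mul_le_mul e1 e2 (riemNorm_nonneg γ b) (by positivity)
  have e4 := mul_le_mul_of_nonneg_right (le_max_left (C₁ * C₂) 1) (mul_nonneg n1 n2)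
  linarith

/-- A single contraction implies that the domination improves without bound. -/
lemma DominatesBy.eventually (hr : 1 ≤ r)
    (hE : ∀ x v, mfderiv (𝓡 d) (𝓡 d) f x v ∈ E (f x) ↔ v ∈ E x)
    (hE' : ∀ x v, mfderiv (𝓡 d) (𝓡 d) f x v ∈ E' (f x) ↔ v ∈ E' x)
    {l : ℕ} (hl : 0 < l) {κ : ℝ} (hκ0 : 0 ≤ κ) (hκ : κ < 1) (h : DominatesBy γ f E E' l κ)
    (ε : ℝ) (hε : 0 < ε) : ∃ l₀ : ℕ, ∀ l ≥ l₀, DominatesBy γ f E E' l ε := by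
  obtain ⟨C, hC1, hC⟩ := exists_dominatesBy_one (γ := γ) hr f E E'
  have hC0 : 0 ≤ C := zero_le_one.trans hC1
  have hz : DominatesBy γ f E E' 0 1 := by
    intro x a _ b _
    have : mfderiv (𝓡 d) (𝓡 d) f^[0] x = ContinuousLinearMap.id ℝ _ := mfderiv_id
    rw [this, one_mul]
    exact le_rfl
  have hmul : ∀ {l : ℕ} {c : ℝ}, 0 ≤ c → DominatesBy γ f E E' l c → ∀ n : ℕ,
      DominatesBy γ f E E' (n * l) (c ^ n) := by
    intro l c hc hlc n
    induction n with
    | zero => simpa using hz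
    | succ n ih =>
      rw [Nat.succ_mul, pow_succ]
      exact DominatesBy.add hr hE hE' (pow_nonneg hc n) ih hlc
  -- The constant after `m` iterations is `κ ^ (m / l) * C ^ (m % l)`, and the second factor is at
  -- most `C ^ l`.
  obtain ⟨q, hq⟩ := exists_pow_lt_of_lt_one (y := κ) (show 0 < ε / C ^ l by positivity) hκ
  refine ⟨q * l, fun m hm => ?_⟩
  have h1 := DominatesBy.add hr hE hE' (pow_nonneg hκ0 (m / l)) (hmul hκ0 h (m / l))
    (hmul hC0 hC (m % l))
  rw [mul_one, mul_comm, Nat.div_add_mod] at h1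
  have hqm : q ≤ m / l := (Nat.le_div_iff_mul_le hl).2 hm
  have h2 : κ ^ (m / l) * C ^ (m % l) ≤ ε := by
    have e1 : κ ^ (m / l) ≤ κ ^ q := pow_le_pow_of_le_one hκ0 hκ.le hqm
    have e2 : C ^ (m % l) ≤ C ^ l := pow_le_pow_right₀ hC1 (Nat.mod_lt _ hl).le
    have e3 := mul_le_mul (e1.trans hq.le) e2 (by positivity) (by positivity)
    rwa [div_mul_cancel₀ _ (by positivity)] at e3
  intro x a ha b hb
  refine (h1 x a ha b hb).trans (mul_le_mul_of_nonneg_right h2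
    (mul_nonneg (riemNorm_nonneg γ _) (riemNorm_nonneg γ _)))

/-- The quotient `u / v` is continuous and stays away from 1 on a compact set. The maximum with 0 in
the choice of `κ` ensures that `κ` is nonnegative. -/
lemma IsCompact.exists_le_mul_of_lt {X : Type*} [TopologicalSpace X] {K : Set X}
    (hK : IsCompact K) {u v : X → ℝ} (hu : Continuous u) (hv : Continuous v)
    (h0 : ∀ p ∈ K, 0 ≤ u p) (h : ∀ p ∈ K, u p < v p) :
    ∃ κ, 0 ≤ κ ∧ κ < 1 ∧ ∀ p ∈ K, u p ≤ κ * v p := by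
  obtain ⟨c, hc0, hc⟩ := hK.exists_forall_le' (a := 0) (f := fun p => 1 - u p / v p)
    (ContinuousOn.sub continuousOn_const (hu.continuousOn.div hv.continuousOn
      fun p hp => ((h0 p hp).trans_lt (h p hp)).ne'))
    (fun p hp => by
      rw [sub_pos, div_lt_one ((h0 p hp).trans_lt (h p hp))]
      exact h p hp)
  refine ⟨max 0 (1 - c), le_max_left _ _, max_lt one_pos (by linarith), fun p hp => ?_⟩
  rw [← div_le_iff₀ ((h0 p hp).trans_lt (h p hp))]
  exact le_trans (by linarith [hc p hp]) (le_max_right _ _)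

/-- The bundles are closed, so pairs of unit vectors over a common point form a compact set and the
strict inequality has a uniform ratio; homogeneity extends it to all vectors. -/
lemma exists_dominatesBy_of_lt (hr : 1 ≤ r) (f : Diffeomorph (𝓡 d) (𝓡 d) M M r)
    {E E' : (x : M) → Submodule ℝ (TangentSpace (𝓡 d) x)}
    (hE : IsClosed {v : TangentBundle (𝓡 d) M | v.2 ∈ E v.1})
    (hE' : IsClosed {v : TangentBundle (𝓡 d) M | v.2 ∈ E' v.1}) (l : ℕ)
    (h : ∀ x, ∀ a ∈ E x, ∀ b ∈ E' x, riemNorm γ a = 1 → riemNorm γ b = 1 →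
      riemNorm γ (mfderiv (𝓡 d) (𝓡 d) f^[l] x a) < riemNorm γ (mfderiv (𝓡 d) (𝓡 d) f^[l] x b)) :
    ∃ κ, 0 ≤ κ ∧ κ < 1 ∧ DominatesBy γ f E E' l κ := by
  have hf := f.mdifferentiable_of_one_le hr
  have hT : Continuous (tangentMap (𝓡 d) (𝓡 d) f^[l]) := by
    rw [tangentMap_iterate hf]
    exact (f.contMDiff.continuous_tangentMap (by exact_mod_cast hr)).iterate l
  have hn := continuous_riemNorm γ
  have hball := isCompact_tangent_le_one (fun v : TangentBundle (𝓡 d) M => riemNorm γ v.2) hn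
    (fun x c v => riemNorm_smul γ c v) (fun x v hv => riemNorm_pos γ hv)
  have hsph : IsCompact {v : TangentBundle (𝓡 d) M | riemNorm γ v.2 = 1} :=
    hball.of_isClosed_subset (isClosed_eq hn continuous_const) fun v hv => le_of_eq hv
  have hb1 : Continuous fun p : TangentBundle (𝓡 d) M × TangentBundle (𝓡 d) M => p.1.1 :=
    (FiberBundle.continuous_proj _ _).comp continuous_fst
  have hb2 : Continuous fun p : TangentBundle (𝓡 d) M × TangentBundle (𝓡 d) M => p.2.1 :=
    (FiberBundle.continuous_proj _ _).comp continuous_snd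
  have hK : IsCompact ((({v | riemNorm γ v.2 = 1} ∩ {v | v.2 ∈ E v.1}) ×ˢ
      ({v | riemNorm γ v.2 = 1} ∩ {v | v.2 ∈ E' v.1})) ∩
      {p : TangentBundle (𝓡 d) M × TangentBundle (𝓡 d) M | p.1.1 = p.2.1}) :=
    ((hsph.inter_right hE).prod (hsph.inter_right hE')).inter_right (isClosed_eq hb1 hb2)
  have hpos : ∀ p ∈ ((({v | riemNorm γ v.2 = 1} ∩ {v | v.2 ∈ E v.1}) ×ˢ
      ({v | riemNorm γ v.2 = 1} ∩ {v | v.2 ∈ E' v.1})) ∩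
      {p : TangentBundle (𝓡 d) M × TangentBundle (𝓡 d) M | p.1.1 = p.2.1}),
      riemNorm γ (tangentMap (𝓡 d) (𝓡 d) f^[l] p.1).2 <
        riemNorm γ (tangentMap (𝓡 d) (𝓡 d) f^[l] p.2).2 := by
    rintro ⟨⟨x, a⟩, ⟨y, b⟩⟩ ⟨⟨⟨ha1, ha⟩, ⟨hb1, hb⟩⟩, hxy⟩
    obtain rfl : x = y := hxy
    exact h x a ha b hb ha1 hb1
  have hc1 := (hn.comp hT).comp (continuous_fst (X := TangentBundle (𝓡 d) M)
    (Y := TangentBundle (𝓡 d) M))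
  have hc2 := (hn.comp hT).comp (continuous_snd (X := TangentBundle (𝓡 d) M)
    (Y := TangentBundle (𝓡 d) M))
  obtain ⟨κ, hκ0, hκ1, hκ⟩ := hK.exists_le_mul_of_lt hc1 hc2 (fun p _ => riemNorm_nonneg γ _) hpos
  refine ⟨κ, hκ0, hκ1, fun x a ha b hb => ?_⟩
  rcases eq_or_ne a 0 with h0 | h0
  · subst h0
    have e : riemNorm γ (mfderiv (𝓡 d) (𝓡 d) f^[l] x 0) = 0 := by
      rw [map_zero]; exact riemNorm_zero γ _
    rw [e, riemNorm_zero]; simp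
  rcases eq_or_ne b 0 with h1 | h1
  · subst h1
    have e : riemNorm γ (mfderiv (𝓡 d) (𝓡 d) f^[l] x 0) = 0 := by
      rw [map_zero]; exact riemNorm_zero γ _
    rw [e, riemNorm_zero]; simp
  have pa := riemNorm_pos γ h0
  have pb := riemNorm_pos γ h1
  have hunit : ∀ {v : TangentSpace (𝓡 d) x}, 0 < riemNorm γ v →
      riemNorm γ ((riemNorm γ v)⁻¹ • v) = 1 := fun hv => by
    rw [riemNorm_smul, abs_of_pos (inv_pos.2 hv), inv_mul_cancel₀ hv.ne']
  have hmem : ((⟨x, (riemNorm γ a)⁻¹ • a⟩, ⟨x, (riemNorm γ b)⁻¹ • b⟩) :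
      TangentBundle (𝓡 d) M × TangentBundle (𝓡 d) M) ∈
      ((({v | riemNorm γ v.2 = 1} ∩ {v | v.2 ∈ E v.1}) ×ˢ
      ({v | riemNorm γ v.2 = 1} ∩ {v | v.2 ∈ E' v.1})) ∩
      {p : TangentBundle (𝓡 d) M × TangentBundle (𝓡 d) M | p.1.1 = p.2.1}) :=
    ⟨⟨⟨hunit pa, Submodule.smul_mem _ _ ha⟩, ⟨hunit pb, Submodule.smul_mem _ _ hb⟩⟩, rfl⟩
  have h2 := hκ _ hmem
  have hs : ∀ (c : ℝ) (v : TangentSpace (𝓡 d) x),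
      riemNorm γ (tangentMap (𝓡 d) (𝓡 d) f^[l] ⟨x, c • v⟩).2 =
        |c| * riemNorm γ (mfderiv (𝓡 d) (𝓡 d) f^[l] x v) := by
    intro c v
    have : (tangentMap (𝓡 d) (𝓡 d) f^[l] ⟨x, c • v⟩).2 = c • mfderiv (𝓡 d) (𝓡 d) f^[l] x v :=
      map_smul _ _ _
    rw [this]
    exact riemNorm_smul γ c _
  simp only [Function.comp_apply, hs] at h2
  rw [abs_of_pos (inv_pos.2 pa), abs_of_pos (inv_pos.2 pb)] at h2
  set α := riemNorm γ a
  set β := riemNorm γ b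
  set α' := riemNorm γ (mfderiv (𝓡 d) (𝓡 d) f^[l] x a)
  set β' := riemNorm γ (mfderiv (𝓡 d) (𝓡 d) f^[l] x b)
  have h5 := mul_le_mul_of_nonneg_left h2 (mul_pos pa pb).le
  have h6 : α * β * (α⁻¹ * α') = α' * β := by field_simp
  have h7 : α * β * (κ * (β⁻¹ * β')) = κ * (α * β') := by field_simp
  rw [h6, h7] at h5
  exact h5

/-- `A` is the kernel of the continuous projection to `B` along `A`. -/
lemma isClosed_of_isCompl {A B : (x : M) → Submodule ℝ (TangentSpace (𝓡 d) x)}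
    (γ : Bundle.ContMDiffRiemannianMetric (𝓡 d) ∞ (EuclideanSpace ℝ (Fin d))
      (fun x : M => TangentSpace (𝓡 d) x))
    (hA : IsContinuousSubbundle A) (hB : IsContinuousSubbundle B)
    (hAB : ∀ x, IsCompl (A x) (B x)) : IsClosed {v : TangentBundle (𝓡 d) M | v.2 ∈ A v.1} := by
  have h := (continuous_riemNorm γ).comp (hB.continuous_projection hA fun x => (hAB x).symm)
  have : {v : TangentBundle (𝓡 d) M | v.2 ∈ A v.1} = {v | riemNorm γ
      ((B v.1).projection (A v.1) (hAB v.1).symm v.2) = 0} := by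
    ext v
    simp only [Set.mem_ofPred_eq]
    rw [riemNorm_eq_zero, Submodule.projection_apply_eq_zero_iff]
  rw [this]
  exact isClosed_eq h continuous_const

lemma exists_projection_le {A B : (x : M) → Submodule ℝ (TangentSpace (𝓡 d) x)}
    (γ : Bundle.ContMDiffRiemannianMetric (𝓡 d) ∞ (EuclideanSpace ℝ (Fin d))
      (fun x : M => TangentSpace (𝓡 d) x))
    (hA : IsContinuousSubbundle A) (hB : IsContinuousSubbundle B)
    (hAB : ∀ x, IsCompl (A x) (B x)) :
    ∃ C, 0 < C ∧ ∀ x, ∀ a ∈ A x, ∀ b ∈ B x, riemNorm γ a ≤ C * riemNorm γ (a + b) := by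
  obtain ⟨C, hC0, hC⟩ := exists_le_mul_tangent (fun v : TangentBundle (𝓡 d) M => riemNorm γ v.2)
    (fun v => riemNorm γ ((A v.1).projection (B v.1) (hAB v.1) v.2)) (continuous_riemNorm γ)
    (fun x c v => riemNorm_smul γ c v) (fun x v hv => riemNorm_pos γ hv)
    ((continuous_riemNorm γ).comp (hA.continuous_projection hB hAB))
    (fun x c v => by rw [map_smul, riemNorm_smul])
  refine ⟨C, hC0, fun x a ha b hb => ?_⟩
  have h1 := hC ⟨x, a + b⟩
  have e1 := Submodule.projection_apply_left (hAB x) ⟨a, ha⟩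
  have e2 := (Submodule.projection_apply_eq_zero_iff (hAB x)).2 hb
  simp only [map_add, e2, add_zero] at h1
  rwa [show (A x).projection (B x) (hAB x) a = a from e1] at h1

lemma mfderiv_mem_iff_of_map_eq (hr : 1 ≤ r)
    (hE : ∀ x, (E x).map (mfderiv (𝓡 d) (𝓡 d) f x).toLinearMap = E (f x)) (x : M)
    (v : TangentSpace (𝓡 d) x) : mfderiv (𝓡 d) (𝓡 d) f x v ∈ E (f x) ↔ v ∈ E x := by
  rw [← hE x]
  constructor
  · rintro ⟨w, hw, e⟩
    rwa [← (mfderiv_bijective hr f x).1 e]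
  · exact fun hv => ⟨v, hv, rfl⟩

namespace PartiallyHyperbolicSplitting

lemma isCompl_ss_cu (S : PartiallyHyperbolicSplitting γ f) (x : M) :
    IsCompl (S.Ess x) (S.Ec x ⊔ S.Euu x) := by
  refine ⟨(S.disjoint_ess_ec x).disjoint_sup_right_of_disjoint_sup_left
    (S.isCompl_cs_uu x).disjoint, ?_⟩
  rw [codisjoint_iff, ← sup_assoc]
  exact (S.isCompl_cs_uu x).sup_eq_top

lemma disjoint_ec_euu (S : PartiallyHyperbolicSplitting γ f) (x : M) :
    Disjoint (S.Ec x) (S.Euu x) :=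
  (S.isCompl_cs_uu x).disjoint.mono_left le_sup_right

lemma isCompl_c_su (S : PartiallyHyperbolicSplitting γ f) (x : M) :
    IsCompl (S.Ec x) (S.Ess x ⊔ S.Euu x) := by
  refine ⟨(S.disjoint_ess_ec x).symm.disjoint_sup_right_of_disjoint_sup_left ?_, ?_⟩
  · rw [sup_comm]; exact (S.isCompl_cs_uu x).disjoint
  · rw [codisjoint_iff, ← sup_assoc, sup_comm (S.Ec x)]
    exact (S.isCompl_cs_uu x).sup_eq_top

lemma map_sup_eq {A B : (x : M) → Submodule ℝ (TangentSpace (𝓡 d) x)}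
    (hA : ∀ x, (A x).map (mfderiv (𝓡 d) (𝓡 d) f x).toLinearMap = A (f x))
    (hB : ∀ x, (B x).map (mfderiv (𝓡 d) (𝓡 d) f x).toLinearMap = B (f x)) (x : M) :
    (A x ⊔ B x).map (mfderiv (𝓡 d) (𝓡 d) f x).toLinearMap = A (f x) ⊔ B (f x) := by
  rw [Submodule.map_sup, hA, hB]

/-- The three pairwise dominations of a partially hyperbolic splitting. -/
lemma dominates (hr : 1 ≤ r) (S : PartiallyHyperbolicSplitting γ f) (ε : ℝ) (hε : 0 < ε) :
    ∃ l₀ : ℕ, ∀ l ≥ l₀, DominatesBy γ f S.Ess S.Ec l ε ∧ DominatesBy γ f S.Ess S.Euu l ε ∧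
      DominatesBy γ f S.Ec S.Euu l ε := by
  obtain ⟨l, hl0, hl⟩ := S.hyperbolic
  have hcs := S.ess_continuous.sup S.ec_continuous S.disjoint_ess_ec
  have hcu := S.ec_continuous.sup S.euu_continuous S.disjoint_ec_euu
  have hsu := S.ess_continuous.sup S.euu_continuous fun x =>
    (S.isCompl_ss_cu x).disjoint.mono_right le_sup_right
  have cs := isClosed_of_isCompl γ S.ess_continuous hcu S.isCompl_ss_cu
  have cc := isClosed_of_isCompl γ S.ec_continuous hsu S.isCompl_c_su
  have cu := isClosed_of_isCompl γ S.euu_continuous hcs fun x => (S.isCompl_cs_uu x).symm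
  have is := mfderiv_mem_iff_of_map_eq hr S.ess_invariant
  have ic := mfderiv_mem_iff_of_map_eq hr S.ec_invariant
  have iu := mfderiv_mem_iff_of_map_eq hr S.euu_invariant
  obtain ⟨κ₁, k10, k11, h1⟩ := exists_dominatesBy_of_lt hr f cs cc l (fun x a ha b hb ha1 hb1 => by
    obtain ⟨u, hu, hu1⟩ := exists_riemNorm_eq_one (γ := γ) (S.euu_nontrivial x)
    exact (lt_min_iff.1 (hl x a ha b hb u hu ha1 hb1 hu1).1).2)
  obtain ⟨κ₂, k20, k21, h2⟩ := exists_dominatesBy_of_lt hr f cs cu l (fun x a ha b hb ha1 hb1 => by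
    obtain ⟨u, hu, hu1⟩ := exists_riemNorm_eq_one (γ := γ) (S.ec_nontrivial x)
    have := hl x a ha u hu b hb ha1 hu1 hb1
    exact (lt_min_iff.1 this.1).1.trans (max_lt_iff.1 this.2).1)
  obtain ⟨κ₃, k30, k31, h3⟩ := exists_dominatesBy_of_lt hr f cc cu l (fun x a ha b hb ha1 hb1 => by
    obtain ⟨u, hu, hu1⟩ := exists_riemNorm_eq_one (γ := γ) (S.ess_nontrivial x)
    exact (max_lt_iff.1 (hl x u hu a ha b hb hu1 ha1 hb1).2).2)
  obtain ⟨l₁, H1⟩ := h1.eventually hr is ic hl0 k10 k11 ε hε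
  obtain ⟨l₂, H2⟩ := h2.eventually hr is iu hl0 k20 k21 ε hε
  obtain ⟨l₃, H3⟩ := h3.eventually hr ic iu hl0 k30 k31 ε hε
  refine ⟨max l₁ (max l₂ l₃), fun m hm => ?_⟩
  simp only [ge_iff_le, max_le_iff] at hm
  exact ⟨H1 m hm.1, H2 m hm.2.1, H3 m hm.2.2⟩

/-- Each summand of `Ess ⊔ Ec` is dominated by `Euu`. Recombining the summands costs the factor `2 *
C + 1`, with `C` the norm of the projection to `Ess` along `Ecu`, and is paid for by a smaller
constant. -/
lemma isDominated_cs_uu (hr : 1 ≤ r) (S : PartiallyHyperbolicSplitting γ f) :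
    IsDominated γ f (fun x => S.Ess x ⊔ S.Ec x) S.Euu := by
  have hcs := S.ess_continuous.sup S.ec_continuous S.disjoint_ess_ec
  have hcu := S.ec_continuous.sup S.euu_continuous S.disjoint_ec_euu
  refine ⟨S.isCompl_cs_uu, hcs.continuous_projection S.euu_continuous S.isCompl_cs_uu,
    S.euu_continuous.continuous_projection hcs fun x => (S.isCompl_cs_uu x).symm,
    mfderiv_mem_iff_of_map_eq (E := fun x => S.Ess x ⊔ S.Ec x) hr
      (map_sup_eq S.ess_invariant S.ec_invariant),
    mfderiv_mem_iff_of_map_eq hr S.euu_invariant, fun ε hε => ?_⟩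
  obtain ⟨C, hC0, hC⟩ := exists_projection_le γ S.ess_continuous hcu S.isCompl_ss_cu
  obtain ⟨l₀, hl₀⟩ := S.dominates hr (ε / (2 * C + 1)) (by positivity)
  refine ⟨l₀, fun l hl x a ha b hb => ?_⟩
  obtain ⟨-, h2, h3⟩ := hl₀ l hl
  obtain ⟨s, hs, c, hc, rfl⟩ := Submodule.mem_sup.1 ha
  have e1 := h2 x s hs b hb
  have e2 := h3 x c hc b hb
  have e3 := hC x s hs c (Submodule.mem_sup_left hc)
  have e4 : riemNorm γ c ≤ riemNorm γ (s + c) + riemNorm γ s := by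
    have := riemNorm_add_le γ (s + c) ((-1 : ℝ) • s)
    rw [riemNorm_smul] at this
    simpa using this
  have e5 := riemNorm_add_le γ (mfderiv (𝓡 d) (𝓡 d) f^[l] x s) (mfderiv (𝓡 d) (𝓡 d) f^[l] x c)
  have e6 : mfderiv (𝓡 d) (𝓡 d) f^[l] x (s + c) =
      mfderiv (𝓡 d) (𝓡 d) f^[l] x s + mfderiv (𝓡 d) (𝓡 d) f^[l] x c := map_add _ _ _
  rw [e6]
  have n1 := riemNorm_nonneg γ b
  have n2 := riemNorm_nonneg γ (mfderiv (𝓡 d) (𝓡 d) f^[l] x b)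
  have e7 : riemNorm γ s + riemNorm γ c ≤ (2 * C + 1) * riemNorm γ (s + c) := by linarith
  have e8 := mul_le_mul_of_nonneg_right e5 n1
  have e9 := mul_le_mul_of_nonneg_right e7 n2
  have e10 := mul_le_mul_of_nonneg_left e9 (show 0 ≤ ε / (2 * C + 1) by positivity)
  have e11 : ε / (2 * C + 1) * ((2 * C + 1) * riemNorm γ (s + c) *
    riemNorm γ (mfderiv (𝓡 d) (𝓡 d) f^[l] x b)) = ε * (riemNorm γ (s + c) *
    riemNorm γ (mfderiv (𝓡 d) (𝓡 d) f^[l] x b)) := by field_simp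
  linarith

/-- Here the dominating bundle is the sum, so the angle estimate is applied at the image point, to
the images of the two components. -/
lemma isDominated_ss_cu (hr : 1 ≤ r) (S : PartiallyHyperbolicSplitting γ f) :
    IsDominated γ f S.Ess (fun x => S.Ec x ⊔ S.Euu x) := by
  have hcs := S.ess_continuous.sup S.ec_continuous S.disjoint_ess_ec
  have hcu := S.ec_continuous.sup S.euu_continuous S.disjoint_ec_euu
  refine ⟨S.isCompl_ss_cu, S.ess_continuous.continuous_projection hcu S.isCompl_ss_cu,
    hcu.continuous_projection S.ess_continuous fun x => (S.isCompl_ss_cu x).symm,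
    mfderiv_mem_iff_of_map_eq hr S.ess_invariant,
    mfderiv_mem_iff_of_map_eq (E := fun x => S.Ec x ⊔ S.Euu x) hr
      (map_sup_eq S.ec_invariant S.euu_invariant), fun ε hε => ?_⟩
  obtain ⟨C, hC0, hC⟩ := exists_projection_le γ S.euu_continuous hcs
    fun x => (S.isCompl_cs_uu x).symm
  obtain ⟨l₀, hl₀⟩ := S.dominates hr (ε / (2 * C + 1)) (by positivity)
  refine ⟨l₀, fun l hl x a ha b hb => ?_⟩
  obtain ⟨h1, h2, -⟩ := hl₀ l hl
  obtain ⟨c, hc, u, hu, rfl⟩ := Submodule.mem_sup.1 hb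
  have e1 := h1 x a ha c hc
  have e2 := h2 x a ha u hu
  have hcf := (invariant_iterate hr (mfderiv_mem_iff_of_map_eq hr S.ec_invariant) l x c).2 hc
  have huf := (invariant_iterate hr (mfderiv_mem_iff_of_map_eq hr S.euu_invariant) l x u).2 hu
  have e3 := hC (f^[l] x) _ huf _ (Submodule.mem_sup_right hcf)
  have e4 : riemNorm γ (mfderiv (𝓡 d) (𝓡 d) f^[l] x c) ≤ riemNorm γ
      (mfderiv (𝓡 d) (𝓡 d) f^[l] x u + mfderiv (𝓡 d) (𝓡 d) f^[l] x c) +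
      riemNorm γ (mfderiv (𝓡 d) (𝓡 d) f^[l] x u) := by
    have := riemNorm_add_le γ (mfderiv (𝓡 d) (𝓡 d) f^[l] x u + mfderiv (𝓡 d) (𝓡 d) f^[l] x c)
      ((-1 : ℝ) • mfderiv (𝓡 d) (𝓡 d) f^[l] x u)
    rw [riemNorm_smul] at this
    simpa using this
  have e5 := riemNorm_add_le γ c u
  have e6 : mfderiv (𝓡 d) (𝓡 d) f^[l] x (c + u) =
      mfderiv (𝓡 d) (𝓡 d) f^[l] x u + mfderiv (𝓡 d) (𝓡 d) f^[l] x c := by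
    rw [add_comm c u]; exact map_add _ _ _
  rw [e6]
  have n1 := riemNorm_nonneg γ a
  have n2 := riemNorm_nonneg γ (mfderiv (𝓡 d) (𝓡 d) f^[l] x a)
  have e7 : riemNorm γ (mfderiv (𝓡 d) (𝓡 d) f^[l] x u) +
      riemNorm γ (mfderiv (𝓡 d) (𝓡 d) f^[l] x c) ≤ (2 * C + 1) * riemNorm γ
      (mfderiv (𝓡 d) (𝓡 d) f^[l] x u + mfderiv (𝓡 d) (𝓡 d) f^[l] x c) := by linarith
  have e8 := mul_le_mul_of_nonneg_left e5 n2
  have e9 := mul_le_mul_of_nonneg_left e7 n1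
  have e10 := mul_le_mul_of_nonneg_left e9 (show 0 ≤ ε / (2 * C + 1) by positivity)
  have e11 : ε / (2 * C + 1) * (riemNorm γ a * ((2 * C + 1) * riemNorm γ
      (mfderiv (𝓡 d) (𝓡 d) f^[l] x u + mfderiv (𝓡 d) (𝓡 d) f^[l] x c))) =
      ε * (riemNorm γ a * riemNorm γ
      (mfderiv (𝓡 d) (𝓡 d) f^[l] x u + mfderiv (𝓡 d) (𝓡 d) f^[l] x c)) := by field_simp
  linarith

end PartiallyHyperbolicSplitting

end PartialHyperbolicity

/-! ### Isotopies, and ranks of bundles along paths -/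

section Isotopies

set_option linter.unusedSectionVars false

attribute [local instance 5000] isManifold_one_of_infty instTopologicalSpaceTangentBundle
attribute [local instance] tangentSpace_finiteDimensional

open Filter Topology

variable {d : ℕ} {M : Type*} [TopologicalSpace M]
  [ChartedSpace (EuclideanSpace ℝ (Fin d)) M] [IsManifold (𝓡 d) ∞ M] {r : ℕ∞}

section Families

variable {P Q : Type*} [TopologicalSpace P] [TopologicalSpace Q]

lemma IsC1Family.trans (hr : 1 ≤ r) {F G : P → Diffeomorph (𝓡 d) (𝓡 d) M M r}
    (hF : IsC1Family F) (hG : IsC1Family G) : IsC1Family fun p => (F p).trans (G p) := by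
  have : (fun p : P × TangentBundle (𝓡 d) M =>
      tangentMap (𝓡 d) (𝓡 d) ((F p.1).trans (G p.1)) p.2) = fun p =>
      tangentMap (𝓡 d) (𝓡 d) (G p.1) (tangentMap (𝓡 d) (𝓡 d) (F p.1) p.2) := by
    funext p
    rw [Diffeomorph.coe_trans, tangentMap_comp ((G p.1).mdifferentiable_of_one_le hr)
      ((F p.1).mdifferentiable_of_one_le hr)]
    rfl
  unfold IsC1Family
  rw [this]
  exact hG.comp (continuous_fst.prodMk hF)

lemma IsC1Family.comp_continuous {F : P → Diffeomorph (𝓡 d) (𝓡 d) M M r} (hF : IsC1Family F)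
    {φ : Q → P} (hφ : Continuous φ) : IsC1Family fun q => F (φ q) :=
  Continuous.comp (g := fun p : P × TangentBundle (𝓡 d) M => tangentMap (𝓡 d) (𝓡 d) (F p.1) p.2)
    hF ((hφ.comp continuous_fst).prodMk continuous_snd)

lemma isC1Family_const (hr : 1 ≤ r) (f : Diffeomorph (𝓡 d) (𝓡 d) M M r) :
    IsC1Family fun _ : P => f :=
  (f.contMDiff.continuous_tangentMap (by exact_mod_cast hr)).comp continuous_snd

lemma IsC1Family.continuous_apply {F : P → Diffeomorph (𝓡 d) (𝓡 d) M M r} (hF : IsC1Family F)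
    (x : M) : Continuous fun p => F p x :=
  ((FiberBundle.continuous_proj _ _).comp hF).comp
    (continuous_id.prodMk (continuous_const (y := (⟨x, 0⟩ : TangentBundle (𝓡 d) M))))

end Families

lemma DiffIsotopic.symm {a b : M → M} (h : DiffIsotopic d r a b) : DiffIsotopic d r b a := by
  obtain ⟨F, hF, h0, h1⟩ := h
  refine ⟨fun t => F (unitInterval.symm t),
    IsC1Family.comp_continuous hF unitInterval.continuous_symm, ?_, ?_⟩
  · simpa using h1
  · simpa using h0

/-- The path `G t ∘ (F 1)⁻¹ ∘ F t` has the right endpoints, so no concatenation of paths is needed.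
-/
lemma DiffIsotopic.trans (hr : 1 ≤ r) {a b c : M → M} (h : DiffIsotopic d r a b)
    (h' : DiffIsotopic d r b c) : DiffIsotopic d r a c := by
  obtain ⟨F, hF, h0, h1⟩ := h
  obtain ⟨G, hG, h2, h3⟩ := h'
  refine ⟨fun t => ((F t).trans (F 1).symm).trans (G t),
    IsC1Family.trans hr (IsC1Family.trans hr hF (isC1Family_const hr _)) hG, ?_, ?_⟩
  · have : F 1 = G 0 := Diffeomorph.coeFn_injective (h1.trans h2.symm)
    funext x
    rw [← h0]
    simp only [Diffeomorph.coe_trans, Function.comp_apply, this]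
    exact (G 0).apply_symm_apply _
  · funext x
    rw [← h3]
    simp only [Diffeomorph.coe_trans, Function.comp_apply, Diffeomorph.symm_apply_apply]

lemma DiffIsotopic.iterate (hr : 1 ≤ r) {a b : M → M} (h : DiffIsotopic d r a b) (n : ℕ) :
    DiffIsotopic d r a^[n] b^[n] := by
  induction n with
  | zero => exact ⟨fun _ => Diffeomorph.refl (𝓡 d) M r, isC1Family_const hr _, rfl, rfl⟩
  | succ n ih =>
    obtain ⟨F, hF, rfl, rfl⟩ := h
    obtain ⟨G, hG, h2, h3⟩ := ih
    refine ⟨fun t => (F t).trans (G t), IsC1Family.trans hr hF hG, ?_, ?_⟩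
    · rw [Function.iterate_succ, ← h2]; rfl
    · rw [Function.iterate_succ, ← h3]; rfl

/-- The implications between isotopies to the identity. -/
lemma DiffIsotopic.of_isotopic_id (hr : 1 ≤ r) {f : unitInterval → Diffeomorph (𝓡 d) (𝓡 d) M M r}
    (hf : IsC1Path f) {h : M → M} {N : ℕ} (hh : DiffIsotopic d r h (f 0)^[N])
    (h0 : DiffIsotopic d r (f 0) id) : DiffIsotopic d r (f 1) id ∧ DiffIsotopic d r h id := by
  refine ⟨(DiffIsotopic.symm ⟨f, hf, rfl, rfl⟩).trans hr h0, hh.trans hr ?_⟩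
  have := h0.iterate hr N
  rwa [Function.iterate_id] at this

/-- Multiplying all parameters of the word by `s` deforms it to a power of `F 0`. -/
lemma IsWord.exists_path (hr : 1 ≤ r) {F : unitInterval → Diffeomorph (𝓡 d) (𝓡 d) M M r}
    (hF : IsC1Path F) {n : ℕ} {k : Diffeomorph (𝓡 d) (𝓡 d) M M r} (h : IsWord F n k) :
    ∃ K : unitInterval → Diffeomorph (𝓡 d) (𝓡 d) M M r, IsC1Path K ∧ ⇑(K 0) = (F 0)^[n] ∧
      K 1 = k := by
  induction h with
  | refl => exact ⟨fun _ => Diffeomorph.refl (𝓡 d) M r, isC1Family_const hr _, rfl, rfl⟩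
  | trans _ t ih =>
    obtain ⟨K, hK, h0, rfl⟩ := ih
    refine ⟨fun s => (K s).trans (F (s * t)), IsC1Family.trans hr hK
      (IsC1Family.comp_continuous hF (continuous_id.mul continuous_const)), ?_, ?_⟩
    · change ⇑((K 0).trans (F (0 * t))) = _
      rw [Function.iterate_succ', ← h0, zero_mul]; rfl
    · simp only [one_mul]

lemma IsContinuousSubbundle.isLocallyConstant_finrank
    {A : (x : M) → Submodule ℝ (TangentSpace (𝓡 d) x)} (hA : IsContinuousSubbundle A) :
    IsLocallyConstant fun x => Module.finrank ℝ (A x) := by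
  rw [IsLocallyConstant.iff_eventually_eq]
  intro x₀
  obtain ⟨U, hU, k, X, -, hX⟩ := hA x₀
  have : ∀ x ∈ U, Module.finrank ℝ (A x) = k := by
    intro x hx
    rw [← (hX x hx).2, finrank_span_eq_card (hX x hx).1, Fintype.card_fin]
  filter_upwards [hU] with x hx
  rw [this x hx, this x₀ (mem_of_mem_nhds hU)]

/-- As `M` may be disconnected, ranks of bundles are only locally constant. This allows their
comparison at points joined by an orbit of the path. -/
lemma IsLocallyConstant.apply_path {Y : Type*} {ρ : M → Y} (hρ : IsLocallyConstant ρ)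
    {F : unitInterval → Diffeomorph (𝓡 d) (𝓡 d) M M r} (hF : IsC1Path F) (x : M)
    (s t : unitInterval) : ρ (F s x) = ρ (F t x) :=
  (hρ.comp_continuous (IsC1Family.continuous_apply hF x)).apply_eq_of_preconnectedSpace s t

end Isotopies

/-! ### Conjugation of dominated splittings -/

section Conjugation

set_option linter.unusedSectionVars false

attribute [local instance 5000] isManifold_one_of_infty instTopologicalSpaceTangentBundle
attribute [local instance] tangentSpace_finiteDimensional

open Filter Topology

variable {d : ℕ} {M : Type*} [TopologicalSpace M]
  [ChartedSpace (EuclideanSpace ℝ (Fin d)) M] [IsManifold (𝓡 d) ∞ M] {r : ℕ∞}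
  {γ : Bundle.ContMDiffRiemannianMetric (𝓡 d) ∞ (EuclideanSpace ℝ (Fin d))
      (fun x : M => TangentSpace (𝓡 d) x)}

/-- The pullback of a family of subspaces under a diffeomorphism. -/
noncomputable def pullbackBundle (g : Diffeomorph (𝓡 d) (𝓡 d) M M r)
    (A : (x : M) → Submodule ℝ (TangentSpace (𝓡 d) x)) (x : M) :
    Submodule ℝ (TangentSpace (𝓡 d) x) :=
  (A (g x)).comap (mfderiv (𝓡 d) (𝓡 d) g x).toLinearMap

lemma mem_pullbackBundle {g : Diffeomorph (𝓡 d) (𝓡 d) M M r}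
    {A : (x : M) → Submodule ℝ (TangentSpace (𝓡 d) x)} {x : M} {v : TangentSpace (𝓡 d) x} :
    v ∈ pullbackBundle g A x ↔ mfderiv (𝓡 d) (𝓡 d) g x v ∈ A (g x) := Iff.rfl

/-- The diffeomorphism `g⁻¹ ∘ f ∘ g`. -/
noncomputable def conjDiffeo (g f : Diffeomorph (𝓡 d) (𝓡 d) M M r) : Diffeomorph (𝓡 d) (𝓡 d) M M r :=
  (g.trans f).trans g.symm

lemma apply_conjDiffeo (g f : Diffeomorph (𝓡 d) (𝓡 d) M M r) (x : M) :
    g (conjDiffeo g f x) = f (g x) :=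
  g.apply_symm_apply _

lemma finrank_pullbackBundle (hr : 1 ≤ r) (g : Diffeomorph (𝓡 d) (𝓡 d) M M r)
    (A : (x : M) → Submodule ℝ (TangentSpace (𝓡 d) x)) (x : M) :
    Module.finrank ℝ (pullbackBundle g A x) = Module.finrank ℝ (A (g x)) :=
  finrank_comap_iterate hr g 1 x (A (g x))

lemma finrank_map_mfderiv (hr : 1 ≤ r) (g : Diffeomorph (𝓡 d) (𝓡 d) M M r) (x : M)
    (W : Submodule ℝ (TangentSpace (𝓡 d) x)) :
    Module.finrank ℝ (W.map (mfderiv (𝓡 d) (𝓡 d) g x).toLinearMap) = Module.finrank ℝ W :=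
  LinearEquiv.finrank_map_eq (LinearEquiv.ofBijective (mfderiv (𝓡 d) (𝓡 d) g x).toLinearMap
    (mfderiv_bijective hr g x)) W

lemma tangentMap_symm_tangentMap (hr : 1 ≤ r) (g : Diffeomorph (𝓡 d) (𝓡 d) M M r)
    (v : TangentBundle (𝓡 d) M) :
    tangentMap (𝓡 d) (𝓡 d) g.symm (tangentMap (𝓡 d) (𝓡 d) g v) = v := by
  have h := tangentMap_comp (g.symm.mdifferentiable_of_one_le hr) (g.mdifferentiable_of_one_le hr)
  have h2 : (g.symm : M → M) ∘ g = id := funext g.symm_apply_apply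
  rw [h2, tangentMap_id] at h
  exact (congrFun h v).symm

lemma isCompl_pullbackBundle (hr : 1 ≤ r) (g : Diffeomorph (𝓡 d) (𝓡 d) M M r)
    {A B : (x : M) → Submodule ℝ (TangentSpace (𝓡 d) x)} {x : M} (h : IsCompl (A (g x)) (B (g x))) :
    IsCompl (pullbackBundle g A x) (pullbackBundle g B x) := by
  refine isCompl_of_disjoint_of_finrank ?_ ?_
  · rw [Submodule.disjoint_def]
    intro v hv hw
    exact (mfderiv_bijective hr g x).1
      ((Submodule.disjoint_def.1 h.disjoint _ hv hw).trans (map_zero _).symm)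
  · rw [finrank_pullbackBundle hr, finrank_pullbackBundle hr, finrank_add_of_isCompl h]

/-- The projection of the pulled back splitting is the original one conjugated by the tangent map of
`g`. -/
lemma continuous_projection_pullbackBundle (hr : 1 ≤ r) (g : Diffeomorph (𝓡 d) (𝓡 d) M M r)
    {A B : (x : M) → Submodule ℝ (TangentSpace (𝓡 d) x)} (h : ∀ x, IsCompl (A x) (B x))
    (hc : Continuous fun v : TangentBundle (𝓡 d) M =>
      (⟨v.1, (A v.1).projection (B v.1) (h v.1) v.2⟩ : TangentBundle (𝓡 d) M)) :
    Continuous fun v : TangentBundle (𝓡 d) M =>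
      (⟨v.1, (pullbackBundle g A v.1).projection (pullbackBundle g B v.1)
        (isCompl_pullbackBundle hr g (h _)) v.2⟩ : TangentBundle (𝓡 d) M) := by
  have hT : Continuous (tangentMap (𝓡 d) (𝓡 d) g) :=
    g.contMDiff.continuous_tangentMap (by exact_mod_cast hr)
  have hT' : Continuous (tangentMap (𝓡 d) (𝓡 d) g.symm) :=
    g.symm.contMDiff.continuous_tangentMap (by exact_mod_cast hr)
  convert (hT'.comp hc).comp hT using 1
  funext v
  obtain ⟨x, v⟩ := v
  have hcx : IsCompl (pullbackBundle g A x) (pullbackBundle g B x) :=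
    isCompl_pullbackBundle hr g (h (g x))
  set a := (pullbackBundle g A x).projection (pullbackBundle g B x) hcx v with ha
  set b := (pullbackBundle g B x).projection (pullbackBundle g A x) hcx.symm v with hb
  have hab : a + b = v := Submodule.projection_add_projection_eq_self hcx v
  have hA : mfderiv (𝓡 d) (𝓡 d) g x a ∈ A (g x) :=
    mem_pullbackBundle.1 (Submodule.projection_apply_mem hcx v)
  have hB : mfderiv (𝓡 d) (𝓡 d) g x b ∈ B (g x) :=
    mem_pullbackBundle.1 (Submodule.projection_apply_mem hcx.symm v)
  have hp : (A (g x)).projection (B (g x)) (h (g x)) (mfderiv (𝓡 d) (𝓡 d) g x v) =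
      mfderiv (𝓡 d) (𝓡 d) g x a := by
    have e1 := Submodule.projection_apply_left (h (g x)) ⟨_, hA⟩
    have e2 := (Submodule.projection_apply_eq_zero_iff (h (g x))).2 hB
    rw [← hab, map_add, map_add, e2, add_zero]
    exact e1
  have : (⟨g x, (A (g x)).projection (B (g x)) (h (g x)) (mfderiv (𝓡 d) (𝓡 d) g x v)⟩ :
      TangentBundle (𝓡 d) M) = tangentMap (𝓡 d) (𝓡 d) g ⟨x, a⟩ := by
    rw [hp]; rfl
  change (⟨x, a⟩ : TangentBundle (𝓡 d) M) = tangentMap (𝓡 d) (𝓡 d) g.symm _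
  refine (tangentMap_symm_tangentMap hr g ⟨x, a⟩).symm.trans ?_
  rw [← this]
  rfl

lemma tangentMap_conjDiffeo_iterate (hr : 1 ≤ r) (g f : Diffeomorph (𝓡 d) (𝓡 d) M M r) (n : ℕ)
    (v : TangentBundle (𝓡 d) M) :
    tangentMap (𝓡 d) (𝓡 d) g (tangentMap (𝓡 d) (𝓡 d) (conjDiffeo g f)^[n] v) =
      tangentMap (𝓡 d) (𝓡 d) f^[n] (tangentMap (𝓡 d) (𝓡 d) g v) := by
  have hg := g.mdifferentiable_of_one_le hr
  have hf := (f.mdifferentiable_of_one_le hr).iterate n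
  have hc := ((conjDiffeo g f).mdifferentiable_of_one_le hr).iterate n
  have h : (g : M → M) ∘ (conjDiffeo g f)^[n] = f^[n] ∘ g := by
    funext x
    exact (Function.Semiconj.iterate_right (fun y => apply_conjDiffeo g f y) n) x
  have h1 := congrFun (tangentMap_comp hg hc) v
  have h2 := congrFun (tangentMap_comp hf hg) v
  rw [h] at h1
  exact h1.symm.trans h2

lemma mem_pullbackBundle_conj (hr : 1 ≤ r) (g : Diffeomorph (𝓡 d) (𝓡 d) M M r)
    {f : Diffeomorph (𝓡 d) (𝓡 d) M M r} {A : (x : M) → Submodule ℝ (TangentSpace (𝓡 d) x)}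
    (hA : ∀ x v, mfderiv (𝓡 d) (𝓡 d) f x v ∈ A (f x) ↔ v ∈ A x) (x : M)
    (v : TangentSpace (𝓡 d) x) :
    mfderiv (𝓡 d) (𝓡 d) (conjDiffeo g f) x v ∈ pullbackBundle g A (conjDiffeo g f x) ↔
      v ∈ pullbackBundle g A x := by
  have h := tangentMap_conjDiffeo_iterate hr g f 1 ⟨x, v⟩
  have h1 : mfderiv (𝓡 d) (𝓡 d) (conjDiffeo g f) x v ∈ pullbackBundle g A (conjDiffeo g f x) ↔
      (tangentMap (𝓡 d) (𝓡 d) g (tangentMap (𝓡 d) (𝓡 d) (conjDiffeo g f)^[1] ⟨x, v⟩)).2 ∈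
      A (tangentMap (𝓡 d) (𝓡 d) g (tangentMap (𝓡 d) (𝓡 d) (conjDiffeo g f)^[1] ⟨x, v⟩)).1 := Iff.rfl
  rw [h1, h]
  exact hA (g x) _

variable [T2Space M] [CompactSpace M]

/-- The derivative of `g` distorts lengths by bounded factors. Each of the four lengths in the
inequality costs one such factor, and domination with arbitrarily small constants absorbs them. -/
lemma IsDominated.conj (hr : 1 ≤ r) (g : Diffeomorph (𝓡 d) (𝓡 d) M M r)
    {f : Diffeomorph (𝓡 d) (𝓡 d) M M r} {A B : (x : M) → Submodule ℝ (TangentSpace (𝓡 d) x)}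
    (h : IsDominated γ f A B) :
    IsDominated γ (conjDiffeo g f) (pullbackBundle g A) (pullbackBundle g B) := by
  refine ⟨fun x => isCompl_pullbackBundle hr g (h.compl _),
    continuous_projection_pullbackBundle hr g h.compl h.cont_left,
    continuous_projection_pullbackBundle hr g (fun x => (h.compl x).symm) h.cont_right,
    mem_pullbackBundle_conj hr g h.inv_left, mem_pullbackBundle_conj hr g h.inv_right,
    fun ε hε => ?_⟩
  have hT : Continuous (tangentMap (𝓡 d) (𝓡 d) g) :=
    g.contMDiff.continuous_tangentMap (by exact_mod_cast hr)
  have hn := continuous_riemNorm γ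
  have hs : ∀ (x : M) (c : ℝ) (v : TangentSpace (𝓡 d) x),
      riemNorm γ (tangentMap (𝓡 d) (𝓡 d) g ⟨x, c • v⟩).2 =
        |c| * riemNorm γ (tangentMap (𝓡 d) (𝓡 d) g ⟨x, v⟩).2 := by
    intro x c v
    have : (tangentMap (𝓡 d) (𝓡 d) g ⟨x, c • v⟩).2 = c • mfderiv (𝓡 d) (𝓡 d) g x v :=
      map_smul _ _ _
    rw [this]
    exact riemNorm_smul γ c _
  obtain ⟨C₁, hC₁, h1⟩ := exists_le_mul_tangent (fun v : TangentBundle (𝓡 d) M => riemNorm γ v.2)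
    (fun v => riemNorm γ (tangentMap (𝓡 d) (𝓡 d) g v).2) hn (fun x c v => riemNorm_smul γ c v)
    (fun x v hv => riemNorm_pos γ hv) (hn.comp hT) hs
  obtain ⟨C₂, hC₂, h2⟩ := exists_le_mul_tangent
    (fun v => riemNorm γ (tangentMap (𝓡 d) (𝓡 d) g v).2)
    (fun v : TangentBundle (𝓡 d) M => riemNorm γ v.2) (hn.comp hT) hs
    (fun x v hv => riemNorm_pos γ fun h0 =>
      hv ((mfderiv_bijective hr g x).1 (h0.trans (map_zero _).symm)))
    hn (fun x c v => riemNorm_smul γ c v)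
  obtain ⟨l₀, hl₀⟩ := h.dom (ε / (C₂ * C₂ * (C₁ * C₁))) (by positivity)
  refine ⟨l₀, fun l hl x a ha b hb => ?_⟩
  have e0 := hl₀ l hl (g x) _ (mem_pullbackBundle.1 ha) _ (mem_pullbackBundle.1 hb)
  have hit : ∀ v : TangentSpace (𝓡 d) x, riemNorm γ (tangentMap (𝓡 d) (𝓡 d) g
      (tangentMap (𝓡 d) (𝓡 d) (conjDiffeo g f)^[l] ⟨x, v⟩)).2 =
      riemNorm γ (mfderiv (𝓡 d) (𝓡 d) f^[l] (g x) (mfderiv (𝓡 d) (𝓡 d) g x v)) := fun v =>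
    congrArg (fun w : TangentBundle (𝓡 d) M => riemNorm γ w.2)
      (tangentMap_conjDiffeo_iterate hr g f l ⟨x, v⟩)
  have e1 := h2 (tangentMap (𝓡 d) (𝓡 d) (conjDiffeo g f)^[l] ⟨x, a⟩)
  have e2 := h2 ⟨x, b⟩
  have e3 := h1 ⟨x, a⟩
  have e4 := h1 (tangentMap (𝓡 d) (𝓡 d) (conjDiffeo g f)^[l] ⟨x, b⟩)
  simp only [hit] at e1 e4
  change riemNorm γ (tangentMap (𝓡 d) (𝓡 d) (conjDiffeo g f)^[l] ⟨x, a⟩).2 * riemNorm γ b ≤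
    ε * (riemNorm γ a * riemNorm γ (tangentMap (𝓡 d) (𝓡 d) (conjDiffeo g f)^[l] ⟨x, b⟩).2)
  change riemNorm γ b ≤ C₂ * riemNorm γ (mfderiv (𝓡 d) (𝓡 d) g x b) at e2
  change riemNorm γ (mfderiv (𝓡 d) (𝓡 d) g x a) ≤ C₁ * riemNorm γ a at e3
  have n1 := riemNorm_nonneg γ b
  have n2 := riemNorm_nonneg γ a
  have n3 := riemNorm_nonneg γ (mfderiv (𝓡 d) (𝓡 d) f^[l] (g x) (mfderiv (𝓡 d) (𝓡 d) g x a))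
  have n4 := riemNorm_nonneg γ (mfderiv (𝓡 d) (𝓡 d) f^[l] (g x) (mfderiv (𝓡 d) (𝓡 d) g x b))
  have e5 := mul_le_mul e1 e2 n1 (by positivity)
  have e6 := mul_le_mul e3 e4 n4 (by positivity)
  have e7 := mul_le_mul_of_nonneg_left e6 (show 0 ≤ ε / (C₂ * C₂ * (C₁ * C₁)) by positivity)
  have e8 := mul_le_mul_of_nonneg_left (e0.trans e7) (show 0 ≤ C₂ * C₂ by positivity)
  have e9 : C₂ * C₂ * (ε / (C₂ * C₂ * (C₁ * C₁)) * (C₁ * riemNorm γ a * (C₁ *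
      riemNorm γ (tangentMap (𝓡 d) (𝓡 d) (conjDiffeo g f)^[l] ⟨x, b⟩).2))) =
      ε * (riemNorm γ a *
        riemNorm γ (tangentMap (𝓡 d) (𝓡 d) (conjDiffeo g f)^[l] ⟨x, b⟩).2) := by field_simp
  rw [e9] at e8
  linarith

end Conjugation

/-! ### Transversality for a conjugated path -/

section ConjugatedTransversality

set_option linter.unusedSectionVars false

attribute [local instance 5000] isManifold_one_of_infty instTopologicalSpaceTangentBundle
attribute [local instance] tangentSpace_finiteDimensional

open Filter Topology

variable {d : ℕ} {M : Type*} [TopologicalSpace M] [T2Space M] [CompactSpace M]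
  [ChartedSpace (EuclideanSpace ℝ (Fin d)) M] [IsManifold (𝓡 d) ∞ M] {r : ℕ∞}
  {γ : Bundle.ContMDiffRiemannianMetric (𝓡 d) ∞ (EuclideanSpace ℝ (Fin d))
      (fun x : M => TangentSpace (𝓡 d) x)}

/-- Transversality for a path of partially hyperbolic maps that is conjugated by a path of
diffeomorphisms starting at the identity. -/
theorem exists_hTransverse_of_conj (hr : 1 ≤ r)
    {f : unitInterval → Diffeomorph (𝓡 d) (𝓡 d) M M r} (hf : IsC1Path f)
    (S : (t : unitInterval) → PartiallyHyperbolicSplitting γ (f t))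
    (hss : ∀ t x, Module.finrank ℝ ((S t).Ess x) = Module.finrank ℝ ((S 0).Ess x))
    (huu : ∀ t x, Module.finrank ℝ ((S t).Euu x) = Module.finrank ℝ ((S 0).Euu x))
    {G : unitInterval → Diffeomorph (𝓡 d) (𝓡 d) M M r} (hG : IsC1Path G)
    (hG' : IsC1Path fun t => (G t).symm) (hG0 : ⇑(G 0) = id) :
    ∃ N₀ : ℕ, ∀ N ≥ N₀, ∃ k : Diffeomorph (𝓡 d) (𝓡 d) M M r,
      IsWord (fun t => conjDiffeo (G t) (f t)) N k ∧ HTransverse (S 0) (S 1) (k.trans (G 1)) ∧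
      DiffIsotopic d r (k.trans (G 1)) (f 0)^[N] := by
  set F : unitInterval → Diffeomorph (𝓡 d) (𝓡 d) M M r := fun t => conjDiffeo (G t) (f t) with hFdef
  have hF : IsC1Path F := by
    have h1 : IsC1Family fun t => (G t).trans (f t) := IsC1Family.trans hr hG hf
    exact IsC1Family.trans (G := fun t => (G t).symm) hr h1 hG'
  have hF0 : ⇑(F 0) = f 0 := by
    funext x
    have := apply_conjDiffeo (G 0) (f 0) x
    rw [hG0] at this
    exact this
  have hGd := (G 1).mdifferentiable_of_one_le hr
  have ls := (S 0).ess_continuous.isLocallyConstant_finrank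
  have lu := (S 0).euu_continuous.isLocallyConstant_finrank
  have hcs : ∀ t x, Module.finrank ℝ ((S t).Ess x ⊔ (S t).Ec x : Submodule ℝ _) +
      Module.finrank ℝ ((S 0).Euu x) = d := fun t x => by
    rw [← huu t]
    exact finrank_add_of_isCompl ((S t).isCompl_cs_uu x)
  have hcu : ∀ t x, Module.finrank ℝ ((S t).Ec x ⊔ (S t).Euu x : Submodule ℝ _) +
      Module.finrank ℝ ((S 0).Ess x) = d := fun t x => by
    rw [← hss t, add_comm]
    exact finrank_add_of_isCompl ((S t).isCompl_ss_cu x)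
  -- `true` stands for Ecs ⊕ Euu and `false` for Ess ⊕ Ecu. Transversality of `k` to a bundle pulled
  -- back by `G 1` is transversality of `G 1 ∘ k` to the bundle itself, and at parameter 0 the
  -- pullback is trivial.
  obtain ⟨N₀, hN₀⟩ := exists_isWord_transverse (γ := γ) hr (ι := Bool) hF
    (A := fun i t => pullbackBundle (G t)
      (cond i (fun x => (S t).Ess x ⊔ (S t).Ec x) (S t).Ess))
    (B := fun i t => pullbackBundle (G t)
      (cond i (S t).Euu (fun x => (S t).Ec x ⊔ (S t).Euu x)))
    (fun i t => by
      cases i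
      · exact ((S t).isDominated_ss_cu hr).conj hr (G t)
      · exact ((S t).isDominated_cs_uu hr).conj hr (G t))
    (fun i s t x => by
      rw [finrank_pullbackBundle hr, finrank_pullbackBundle hr]
      cases i
      · change Module.finrank ℝ ((S s).Ess (G s x)) = Module.finrank ℝ ((S t).Ess (G t x))
        rw [hss s, hss t]
        exact ls.apply_path hG x s t
      · change Module.finrank ℝ ((S s).Ess (G s x) ⊔ (S s).Ec (G s x) : Submodule ℝ _) =
          Module.finrank ℝ ((S t).Ess (G t x) ⊔ (S t).Ec (G t x) : Submodule ℝ _)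
        have h1 := hcs s (G s x)
        have h2 := hcs t (G t x)
        have h3 := lu.apply_path hG x s t
        change Module.finrank ℝ ((S 0).Euu (G s x)) = Module.finrank ℝ ((S 0).Euu (G t x)) at h3
        omega) 0 1
  refine ⟨N₀, fun N hN => ?_⟩
  obtain ⟨k, hk, hkt⟩ := hN₀ N hN
  obtain ⟨K, hK, hK0, rfl⟩ := hk.exists_path hr hF
  set h := (K 1).trans (G 1) with hh
  have hpath : IsC1Path fun t => (K t).trans (G t) := IsC1Family.trans hr hK hG
  have hpath0 : ⇑((K 0).trans (G 0)) = (f 0)^[N] := by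
    rw [Diffeomorph.coe_trans, hK0, hG0, hF0]; rfl
  have hdh : ∀ x v, mfderiv (𝓡 d) (𝓡 d) h x v =
      mfderiv (𝓡 d) (𝓡 d) (G 1) (K 1 x) (mfderiv (𝓡 d) (𝓡 d) (K 1) x v) := by
    intro x v
    rw [hh, Diffeomorph.coe_trans, mfderiv_comp x (hGd _) ((K 1).mdifferentiable_of_one_le hr x)]
    rfl
  have hB : ∀ (B : (x : M) → Submodule ℝ (TangentSpace (𝓡 d) x)) x v, v ∈ B x →
      v ∈ pullbackBundle (G 0) B x := by
    intro B x v hv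
    have e : mfderiv (𝓡 d) (𝓡 d) (G 0) x v = v := by rw [hG0, mfderiv_id]; rfl
    rw [mem_pullbackBundle, e, hG0]
    exact hv
  have tr1 : ∀ x, ∀ v ∈ (S 0).Euu x, mfderiv (𝓡 d) (𝓡 d) h x v ∈
      (S 1).Ess (h x) ⊔ (S 1).Ec (h x) → v = 0 := fun x v hv hv2 =>
    hkt true x v (hB _ x v hv) (by rw [hdh] at hv2; exact hv2)
  have tr2 : ∀ x, ∀ v ∈ (S 0).Ec x ⊔ (S 0).Euu x, mfderiv (𝓡 d) (𝓡 d) h x v ∈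
      (S 1).Ess (h x) → v = 0 := fun x v hv hv2 =>
    hkt false x v (hB (fun x => (S 0).Ec x ⊔ (S 0).Euu x) x v hv) (by rw [hdh] at hv2; exact hv2)
  have iu := mfderiv_mem_iff_of_map_eq hr (S 0).euu_invariant
  have is := mfderiv_mem_iff_of_map_eq hr (S 0).ess_invariant
  -- The isotopy joins `h x` to the `N`-th iterate of `x` under `f 0`, where invariance gives the
  -- same rank as at `x`.
  have ru : ∀ x, Module.finrank ℝ ((S 0).Euu (h x)) = Module.finrank ℝ ((S 0).Euu x) := by
    intro x
    rw [← finrank_map_iterate hr iu N x]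
    have := lu.apply_path hpath x 1 0
    rw [hpath0] at this
    exact this
  have rs : ∀ x, Module.finrank ℝ ((S 0).Ess (h x)) = Module.finrank ℝ ((S 0).Ess x) := by
    intro x
    rw [← finrank_map_iterate hr is N x]
    have := ls.apply_path hpath x 1 0
    rw [hpath0] at this
    exact this
  refine ⟨K 1, hk, ⟨fun x => ?_, fun y => ?_⟩, DiffIsotopic.symm ⟨_, hpath, hpath0, rfl⟩⟩
  · refine isCompl_of_disjoint_of_finrank ?_ ?_
    · rw [Submodule.disjoint_def]
      rintro _ ⟨v, hv, rfl⟩ hw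
      rw [tr1 x v hv hw]
      exact map_zero _
    · rw [finrank_map_mfderiv hr, ← ru x, add_comm]
      exact hcs 1 (h x)
  -- A vector of Ess_g sent by the inverse into Ecu_f is, read forwards, a vector of Ecu_f that the
  -- derivative of `h` maps into Ess_g; this is the case excluded by `tr2`.
  · refine isCompl_of_disjoint_of_finrank ?_ ?_
    · rw [Submodule.disjoint_def]
      rintro _ ⟨v, hv, rfl⟩ hw
      refine tr2 (h.symm y) _ hw ?_
      have e := tangentMap_symm_tangentMap hr h.symm ⟨y, v⟩
      have e2 : (tangentMap (𝓡 d) (𝓡 d) h (tangentMap (𝓡 d) (𝓡 d) h.symm ⟨y, v⟩)).2 ∈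
        (S 1).Ess (tangentMap (𝓡 d) (𝓡 d) h (tangentMap (𝓡 d) (𝓡 d) h.symm ⟨y, v⟩)).1 := by
        have e' : tangentMap (𝓡 d) (𝓡 d) h (tangentMap (𝓡 d) (𝓡 d) h.symm ⟨y, v⟩) = ⟨y, v⟩ := e
        rw [e']; exact hv
      exact e2
    · have e1 := hcu 0 (h.symm y)
      have e2 := rs (h.symm y)
      rw [h.apply_symm_apply] at e2
      rw [finrank_map_mfderiv hr, hss 1, e2,
        add_comm]
      exact e1

end ConjugatedTransversality

/-! ### Families of smooth maps, continuous in the C¹ topology -/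

section C1Families
set_option linter.unusedSectionVars false
open Filter Topology

/-- A family of smooth maps that is continuous for the `C¹` topology. -/
structure IsC1Fam {P E F : Type*} [TopologicalSpace P] [NormedAddCommGroup E] [NormedSpace ℝ E]
    [NormedAddCommGroup F] [NormedSpace ℝ F] (u : P → E → F) : Prop where
  smooth : ∀ p, ContDiff ℝ ∞ (u p)
  cont : Continuous fun q : P × E => u q.1 q.2
  cont_fderiv : Continuous fun q : P × E => fderiv ℝ (u q.1) q.2

namespace IsC1Fam

variable {P Q E F G : Type*} [TopologicalSpace P] [TopologicalSpace Q]
  [NormedAddCommGroup E] [NormedSpace ℝ E] [NormedAddCommGroup F] [NormedSpace ℝ F]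
  [NormedAddCommGroup G] [NormedSpace ℝ G]

lemma differentiableAt {u : P → E → F} (hu : IsC1Fam u) (p : P) (y : E) :
    DifferentiableAt ℝ (u p) y :=
  ((hu.smooth p).differentiable (by simp)).differentiableAt

lemma of_contDiff {f : E → F} (hf : ContDiff ℝ ∞ f) : IsC1Fam fun _ : P => f :=
  ⟨fun _ => hf, hf.continuous.comp continuous_snd,
    (hf.continuous_fderiv (by simp)).comp continuous_snd⟩

lemma of_continuous {c : P → F} (hc : Continuous c) : IsC1Fam fun p (_ : E) => c p :=
  ⟨fun _ => contDiff_const, hc.comp continuous_fst, by simpa using continuous_const⟩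

lemma reparam {u : P → E → F} (hu : IsC1Fam u) {a : Q → P} (ha : Continuous a) :
    IsC1Fam fun q => u (a q) :=
  ⟨fun q => hu.smooth (a q), hu.cont.comp ((ha.comp continuous_fst).prodMk continuous_snd),
    hu.cont_fderiv.comp ((ha.comp continuous_fst).prodMk continuous_snd)⟩

lemma comp {v : P → F → G} {u : P → E → F} (hv : IsC1Fam v) (hu : IsC1Fam u) :
    IsC1Fam fun p y => v p (u p y) := by
  refine ⟨fun p => (hv.smooth p).comp (hu.smooth p), hv.cont.comp (continuous_fst.prodMk hu.cont), ?_⟩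
  have : (fun q : P × E => fderiv ℝ (fun y => v q.1 (u q.1 y)) q.2) =
      fun q => (fderiv ℝ (v q.1) (u q.1 q.2)).comp (fderiv ℝ (u q.1) q.2) := by
    ext1 q
    exact fderiv_comp q.2 (hv.differentiableAt _ _) (hu.differentiableAt _ _)
  rw [this]
  exact (hv.cont_fderiv.comp (continuous_fst.prodMk hu.cont)).clm_comp hu.cont_fderiv

lemma prodMk {v : P → E → G} {u : P → E → F} (hv : IsC1Fam v) (hu : IsC1Fam u) :
    IsC1Fam fun p y => (v p y, u p y) := by
  refine ⟨fun p => (hv.smooth p).prodMk (hu.smooth p), hv.cont.prodMk hu.cont, ?_⟩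
  have : (fun q : P × E => fderiv ℝ (fun y => (v q.1 y, u q.1 y)) q.2) =
      fun q => (fderiv ℝ (v q.1) q.2).prod (fderiv ℝ (u q.1) q.2) := by
    ext1 q
    exact (hv.differentiableAt _ _).fderiv_prodMk (hu.differentiableAt _ _)
  rw [this]
  exact ((ContinuousLinearMap.prodₗᵢ ℝ).continuous.comp
    (hv.cont_fderiv.prodMk hu.cont_fderiv) : )

lemma contDiff_comp {f : F → G} (hf : ContDiff ℝ ∞ f) {u : P → E → F} (hu : IsC1Fam u) :
    IsC1Fam fun p y => f (u p y) :=
  (of_contDiff hf).comp hu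

lemma add {u v : P → E → F} (hu : IsC1Fam u) (hv : IsC1Fam v) : IsC1Fam fun p y => u p y + v p y :=
  contDiff_comp (contDiff_fst.add contDiff_snd) (hu.prodMk hv)

lemma sub {u v : P → E → F} (hu : IsC1Fam u) (hv : IsC1Fam v) : IsC1Fam fun p y => u p y - v p y :=
  contDiff_comp (contDiff_fst.sub contDiff_snd) (hu.prodMk hv)

lemma smul {u : P → E → ℝ} {v : P → E → F} (hu : IsC1Fam u) (hv : IsC1Fam v) :
    IsC1Fam fun p y => u p y • v p y :=
  contDiff_comp (contDiff_fst.smul contDiff_snd) (hu.prodMk hv)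

lemma mul {u v : P → E → ℝ} (hu : IsC1Fam u) (hv : IsC1Fam v) :
    IsC1Fam fun p y => u p y * v p y :=
  contDiff_comp (contDiff_fst.mul contDiff_snd) (hu.prodMk hv)

end IsC1Fam

lemma continuous_intervalIntegral_param {X F : Type*} [TopologicalSpace X]
    [NormedAddCommGroup F] [NormedSpace ℝ F]
    [FirstCountableTopology X] [LocallyCompactSpace X] {f : X → ℝ → F}
    (hf : Continuous fun q : X × ℝ => f q.1 q.2) (a b : ℝ) :
    Continuous fun x => ∫ s in a..b, f x s :=
  intervalIntegral.continuous_parametric_intervalIntegral_of_continuous' hf a b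

section Integral

universe u
variable {E : Type u} [NormedAddCommGroup E] [NormedSpace ℝ E] [FiniteDimensional ℝ E]

lemma hasFDerivAt_intervalIntegral {F : Type*} [NormedAddCommGroup F] [NormedSpace ℝ F]
    {f : E → ℝ → F} {f' : E → ℝ → E →L[ℝ] F}
    (hf : Continuous fun q : E × ℝ => f q.1 q.2) (hf' : Continuous fun q : E × ℝ => f' q.1 q.2)
    (h : ∀ y s, HasFDerivAt (fun y => f y s) (f' y s) y) (a b : ℝ) (y : E) :
    HasFDerivAt (fun y => ∫ s in a..b, f y s) (∫ s in a..b, f' y s) y := by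
  have hK : IsCompact (Metric.closedBall y 1 ×ˢ Set.uIcc a b) :=
    (isCompact_closedBall y 1).prod isCompact_uIcc
  obtain ⟨C, hC⟩ := hK.exists_bound_of_continuousOn hf'.continuousOn
  have hs (y : E) : Continuous fun s => f y s := hf.comp (continuous_const.prodMk continuous_id)
  have hs' (y : E) : Continuous fun s => f' y s := hf'.comp (continuous_const.prodMk continuous_id)
  refine intervalIntegral.hasFDerivAt_integral_of_dominated_of_fderiv_le (bound := fun _ => C)
    (Metric.closedBall_mem_nhds y one_pos) (.of_forall fun x => (hs x).aestronglyMeasurable)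
    ((hs y).intervalIntegrable _ _) (hs' y).aestronglyMeasurable
    (.of_forall fun s hs x hx => hC (x, s) ⟨hx, Set.uIoc_subset_uIcc hs⟩)
    (by simp) (.of_forall fun s _ x _ => h x s)

lemma hasFDerivAt_slice {F : Type*} [NormedAddCommGroup F] [NormedSpace ℝ F] {f : E × ℝ → F}
    (hf : Differentiable ℝ f) (y : E) (s : ℝ) :
    HasFDerivAt (fun y => f (y, s)) ((fderiv ℝ f (y, s)).comp (.inl ℝ E ℝ)) y :=
  (hf (y, s)).hasFDerivAt.comp y (hasFDerivAt_prodMk_left y s)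

/-- The derivative of the integral is the integral of the partial derivative, which takes values in
`E →L[ℝ] F`. The induction therefore varies `F`, and `F` has to live in the universe of `E`. -/
lemma contDiff_intervalIntegral_nat (n : ℕ) {F : Type u} [NormedAddCommGroup F] [NormedSpace ℝ F]
    {f : E × ℝ → F} (hf : ContDiff ℝ n f) (a b : ℝ) :
    ContDiff ℝ n fun y => ∫ s in a..b, f (y, s) := by
  induction n generalizing F with
  | zero =>
    rw [Nat.cast_zero, contDiff_zero] at hf ⊢
    exact continuous_intervalIntegral_param hf a b
  | succ n ih =>
    have h1 : ((n + 1 : ℕ) : WithTop ℕ∞) = n + 1 := by norm_cast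
    rw [h1] at hf
    rw [h1, contDiff_succ_iff_hasFDerivAt]
    have hd : ContDiff ℝ n fun q : E × ℝ => (fderiv ℝ f q).comp (.inl ℝ E ℝ) :=
      (hf.fderiv_right (m := n) le_rfl).clm_comp contDiff_const
    exact ⟨_, ih hd, hasFDerivAt_intervalIntegral hf.continuous hd.continuous
      (hasFDerivAt_slice (hf.differentiable (by simp))) a b⟩

lemma IsC1Fam.intervalIntegral {P : Type*} [TopologicalSpace P] [FirstCountableTopology P]
    [LocallyCompactSpace P] {F : Type u} [NormedAddCommGroup F] [NormedSpace ℝ F]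
    {u : P → E × ℝ → F} (hu : IsC1Fam u) (a b : ℝ) :
    IsC1Fam fun p y => ∫ s in a..b, u p (y, s) := by
  have hd : Continuous fun q : (P × E) × ℝ =>
      (fderiv ℝ (u q.1.1) (q.1.2, q.2)).comp (.inl ℝ E ℝ) :=
    (hu.cont_fderiv.comp ((continuous_fst.comp continuous_fst).prodMk
      ((continuous_snd.comp continuous_fst).prodMk continuous_snd))).clm_comp continuous_const
  refine ⟨fun p => contDiff_infty.2 fun n => contDiff_intervalIntegral_nat n
    ((hu.smooth p).of_le (by exact_mod_cast le_top)) a b, ?_, ?_⟩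
  · exact continuous_intervalIntegral_param (X := P × E) (f := fun q s => u q.1 (q.2, s))
      (hu.cont.comp ((continuous_fst.comp continuous_fst).prodMk
      ((continuous_snd.comp continuous_fst).prodMk continuous_snd))) a b
  · have : (fun q : P × E => fderiv ℝ (fun y => ∫ s in a..b, u q.1 (y, s)) q.2) =
        fun q => ∫ s in a..b, (fderiv ℝ (u q.1) (q.2, s)).comp (.inl ℝ E ℝ) := by
      ext1 q
      refine (hasFDerivAt_intervalIntegral (f := fun y s => u q.1 (y, s))
        (f' := fun y s => (fderiv ℝ (u q.1) (y, s)).comp (.inl ℝ E ℝ))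
        (hu.smooth q.1).continuous ?_ 
        (hasFDerivAt_slice ((hu.smooth q.1).differentiable (by simp))) a b q.2).fderiv
      exact hd.comp ((continuous_const.prodMk continuous_fst).prodMk continuous_snd)
    rw [this]
    exact continuous_intervalIntegral_param hd a b

end Integral
end C1Families

/-! ### Shears along parallel lines and monotone rearrangement -/

section Shears
set_option linter.unusedSectionVars false
open Filter Topology

section Lines

variable {E F : Type} [NormedAddCommGroup E] [NormedSpace ℝ E] [FiniteDimensional ℝ E]
  [NormedAddCommGroup F] [NormedSpace ℝ F]
  {ℓ : E →L[ℝ] ℝ} {v : E}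

/-- The point of the line through `y` with direction `v` at which `ℓ` takes the value `s`
(if `ℓ v = 1`). -/
def slideTo (ℓ : E →L[ℝ] ℝ) (v y : E) (s : ℝ) : E := y + (s - ℓ y) • v

@[simp] lemma slideTo_self (y : E) : slideTo ℓ v y (ℓ y) = y := by simp [slideTo]

lemma apply_slideTo (hv : ℓ v = 1) (y : E) (s : ℝ) : ℓ (slideTo ℓ v y s) = s := by
  simp [slideTo, hv]

lemma slideTo_slideTo (hv : ℓ v = 1) (y : E) (s t : ℝ) :
    slideTo ℓ v (slideTo ℓ v y s) t = slideTo ℓ v y t := by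
  simp only [slideTo, map_add, map_smul, hv, smul_eq_mul, mul_one]
  module

lemma contDiff_slideTo : ContDiff ℝ ∞ fun q : E × ℝ => slideTo ℓ v q.1 q.2 := by
  unfold slideTo
  fun_prop

lemma hasDerivAt_slideTo (y : E) (s : ℝ) : HasDerivAt (slideTo ℓ v y) v s := by
  have := (((hasDerivAt_id s).sub_const (ℓ y)).smul_const v).const_add y
  rwa [one_smul] at this

variable {P : Type*} [TopologicalSpace P]

lemma IsC1Fam.slideTo {t : P → E → ℝ} (ht : IsC1Fam t) :
    IsC1Fam fun p y => slideTo ℓ v y (t p y) :=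
  IsC1Fam.contDiff_comp contDiff_slideTo ((IsC1Fam.of_contDiff contDiff_id).prodMk ht)

variable [FirstCountableTopology P] [LocallyCompactSpace P]

lemma IsC1Fam.lineIntegral {u : P → E → F} (hu : IsC1Fam u) (l r : ℝ) :
    IsC1Fam fun p y => ∫ s in l..r, u p (_root_.slideTo ℓ v y s) :=
  (hu.comp (IsC1Fam.of_contDiff contDiff_slideTo)).intervalIntegral l r

/-- Rescaling to fixed limits moves the variable endpoint into the integrand, where it can be
differentiated as a parameter. -/
lemma linePrimitive_eq (u : E → F) (l : ℝ) (y : E) :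
    ∫ s in l..ℓ y, u (slideTo ℓ v y s) =
      (ℓ y - l) • ∫ θ in (0 : ℝ)..1, u (slideTo ℓ v y (l + (ℓ y - l) * θ)) := by
  rw [intervalIntegral.smul_integral_comp_add_mul (fun s => u (slideTo ℓ v y s))]
  simp

lemma IsC1Fam.linePrimitive {u : P → E → F} (hu : IsC1Fam u) (l : ℝ) :
    IsC1Fam fun p y => ∫ s in l..ℓ y, u p (_root_.slideTo ℓ v y s) := by
  simp only [linePrimitive_eq]
  refine IsC1Fam.smul (IsC1Fam.of_contDiff (ℓ.contDiff.sub contDiff_const))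
    (IsC1Fam.intervalIntegral
      (u := fun p q => u p (_root_.slideTo ℓ v q.1 (l + (ℓ q.1 - l) * q.2))) (hu.comp
      (IsC1Fam.of_contDiff (contDiff_slideTo.comp (g := fun q : E × ℝ => _root_.slideTo ℓ v q.1 q.2)
        (f := fun q : E × ℝ => (q.1, l + (ℓ q.1 - l) * q.2)) ?_))) 0 1)
  fun_prop

lemma hasDerivAt_linePrimitive (hv : ℓ v = 1) [CompleteSpace F] {u : E → F} (hu : Continuous u)
    (l : ℝ) (y : E) (t : ℝ) :
    HasDerivAt (fun t => ∫ s in l..ℓ (slideTo ℓ v y t), u (slideTo ℓ v (slideTo ℓ v y t) s))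
      (u (slideTo ℓ v y t)) t := by
  simp only [apply_slideTo hv, slideTo_slideTo hv]
  have hc : Continuous fun s => u (slideTo ℓ v y s) :=
    hu.comp (contDiff_slideTo.continuous.comp (continuous_const.prodMk continuous_id))
  exact intervalIntegral.integral_hasDerivAt_right (hc.intervalIntegrable _ _)
    (hc.stronglyMeasurableAtFilter _ _) hc.continuousAt

lemma HasDerivAt.slideTo_of_differentiable {a : E → F} (ha : Differentiable ℝ a) (y : E) (t : ℝ) :
    HasDerivAt (fun t => a (slideTo ℓ v y t)) (fderiv ℝ a (slideTo ℓ v y t) v) t :=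
  (ha _).hasFDerivAt.comp_hasDerivAt t (hasDerivAt_slideTo y t)

/-- Moving `y` in the direction `v` keeps the line of integration and changes only the upper limit.
-/
lemma fderiv_linePrimitive (hv : ℓ v = 1) [CompleteSpace F] {u : P → E → F} (hu : IsC1Fam u)
    (l : ℝ) (p : P) (y : E) :
    fderiv ℝ (fun y => ∫ s in l..ℓ y, u p (slideTo ℓ v y s)) y v = u p y := by
  have h1 := HasDerivAt.slideTo_of_differentiable (ℓ := ℓ) (v := v)
    (((hu.linePrimitive (ℓ := ℓ) (v := v) l).smooth p).differentiable (by simp)) y (ℓ y)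
  have h2 := hasDerivAt_linePrimitive hv (hu.smooth p).continuous l y (ℓ y)
  simpa using h1.unique h2

end Lines

section Inverse

variable {E : Type} [NormedAddCommGroup E] [NormedSpace ℝ E] [FiniteDimensional ℝ E]
  {ℓ : E →L[ℝ] ℝ} {v : E} {P : Type*} [TopologicalSpace P]

/-- The inverse of `id + μ ⊗ v`. -/
noncomputable def shearEquiv (μ : E →L[ℝ] ℝ) (v : E) (h : 1 + μ v ≠ 0) : E ≃L[ℝ] E :=
  ContinuousLinearEquiv.equivOfInverse (.id ℝ E + μ.smulRight v)
    (.id ℝ E - (1 + μ v)⁻¹ • μ.smulRight v)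
    (fun x => by
      simp only [_root_.sub_apply, _root_.add_apply, _root_.smul_apply,
        ContinuousLinearMap.id_apply, ContinuousLinearMap.smulRight_apply, map_add, map_smul]
      match_scalars <;> (field_simp; try ring))
    (fun x => by
      simp only [_root_.sub_apply, _root_.add_apply, _root_.smul_apply,
        ContinuousLinearMap.id_apply, ContinuousLinearMap.smulRight_apply, map_sub, map_smul]
      match_scalars <;> (field_simp; try ring))

lemma hasFDerivAt_slideTo_apply {a : E → ℝ} (ha : Differentiable ℝ a) (y : E) :
    HasFDerivAt (fun y => slideTo ℓ v y (a y))
      (.id ℝ E + (fderiv ℝ a y - ℓ).smulRight v) y :=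
  (hasFDerivAt_id y).add (((ha y).hasFDerivAt.sub ℓ.hasFDerivAt).smul_const v)

lemma le_abs_sub_of_le_fderiv {a : E → ℝ} (ha : Differentiable ℝ a) {c : ℝ}
    (h : ∀ y, c ≤ fderiv ℝ a y v) (y : E) (s t : ℝ) :
    c * |s - t| ≤ |a (slideTo ℓ v y s) - a (slideTo ℓ v y t)| := by
  wlog hst : t ≤ s generalizing s t
  · rw [abs_sub_comm s, abs_sub_comm (a _)]
    exact this t s (le_of_not_ge hst)
  have hd (t : ℝ) := HasDerivAt.slideTo_of_differentiable (ℓ := ℓ) (v := v) ha y t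
  have := mul_sub_le_image_sub_of_le_deriv (f := fun t => a (slideTo ℓ v y t)) (C := c)
    (fun t => (hd t).differentiableAt) (fun t => by rw [(hd t).deriv]; exact h _) hst
  rw [abs_of_nonneg (sub_nonneg.2 hst)]
  exact this.trans (le_abs_self _)

lemma surjective_of_le_fderiv {a : E → ℝ} (ha : Differentiable ℝ a) {c : ℝ} (hc : 0 < c)
    (h : ∀ y, c ≤ fderiv ℝ a y v) (y : E) : Function.Surjective fun t => a (slideTo ℓ v y t) := by
  have hd (t : ℝ) := HasDerivAt.slideTo_of_differentiable (ℓ := ℓ) (v := v) ha y t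
  have hle {s t : ℝ} (hst : t ≤ s) : c * (s - t) ≤ a (slideTo ℓ v y s) - a (slideTo ℓ v y t) :=
    mul_sub_le_image_sub_of_le_deriv (f := fun t => a (slideTo ℓ v y t)) (C := c)
      (fun t => (hd t).differentiableAt) (fun t => by rw [(hd t).deriv]; exact h _) hst
  refine Continuous.surjective
    (continuous_iff_continuousAt.2 fun t => (hd t).differentiableAt.continuousAt) ?_ ?_
  · refine tendsto_atTop_mono' atTop (f₁ := fun t => c * t + a (slideTo ℓ v y 0)) ?_ ?_
    · filter_upwards [eventually_ge_atTop 0] with t ht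
      have := hle ht
      rw [sub_zero] at this
      linarith
    · exact tendsto_atTop_add_const_right _ _ (tendsto_id.const_mul_atTop hc)
  · refine tendsto_atBot_mono' atBot (f₁ := fun t => c * t + a (slideTo ℓ v y 0)) ?_ ?_
    · filter_upwards [eventually_le_atBot 0] with t ht
      have := hle ht
      rw [zero_sub] at this
      linarith
    · exact tendsto_atBot_add_const_right _ _ (tendsto_id.const_mul_atBot hc)

/-- On every line parallel to `v` the function `a p` has slope at least `c`, so it is a bijection
and the shear is inverted line by line. The slope bound makes the inverse jointly continuous, and
the formula for the inverse of a rank-one perturbation of the identity makes its derivative so. -/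
lemma IsC1Fam.exists_inverse_shear (hv : ℓ v = 1) {a : P → E → ℝ} (ha : IsC1Fam a) {c : ℝ}
    (hc : 0 < c) (h : ∀ p y, c ≤ fderiv ℝ (a p) y v) :
    ∃ B : P → E → E, IsC1Fam B ∧ (∀ p y, B p (_root_.slideTo ℓ v y (a p y)) = y) ∧
      ∀ p y, _root_.slideTo ℓ v (B p y) (a p (B p y)) = y := by
  have hd (p : P) : Differentiable ℝ (a p) := (ha.smooth p).differentiable (by simp)
  -- `τ p z` is the `ℓ`-coordinate of the preimage of `z`, which lies on the same line.
  choose τ hτ using fun p z => surjective_of_le_fderiv (ℓ := ℓ) (hd p) hc (h p) z (ℓ z)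
  simp only at hτ
  have hcτ : Continuous fun q : P × E => τ q.1 q.2 := by
    rw [continuous_iff_continuousAt]
    rintro ⟨p, z⟩
    rw [ContinuousAt, tendsto_iff_norm_sub_tendsto_zero]
    -- By the slope bound this function dominates the change of `τ`, and it is continuous and
    -- vanishes at `(p, z)`.
    have hlim : Tendsto (fun q : P × E =>
        c⁻¹ * |ℓ q.2 - a q.1 (_root_.slideTo ℓ v q.2 (τ p z))|) (𝓝 (p, z)) (𝓝 0) := by
      have hcont : Continuous fun q : P × E =>
          c⁻¹ * |ℓ q.2 - a q.1 (_root_.slideTo ℓ v q.2 (τ p z))| :=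
        continuous_const.mul ((ℓ.continuous.comp continuous_snd).sub
          (ha.cont.comp (continuous_fst.prodMk (contDiff_slideTo.continuous.comp
            (continuous_snd.prodMk continuous_const))))).abs
      convert hcont.tendsto (p, z)
      simp [hτ]
    refine squeeze_zero (fun _ => norm_nonneg _) (fun q => ?_) hlim
    have := le_abs_sub_of_le_fderiv (ℓ := ℓ) (hd q.1) (h q.1) q.2 (τ q.1 q.2) (τ p z)
    rw [hτ] at this
    rw [Real.norm_eq_abs, inv_mul_eq_div, le_div_iff₀ hc, mul_comm]
    exact this
  set B : P → E → E := fun p z => _root_.slideTo ℓ v z (τ p z) with hB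
  have hAB (p : P) (z : E) : _root_.slideTo ℓ v (B p z) (a p (B p z)) = z := by
    simp [hB, hτ, slideTo_slideTo hv]
  have hBA (p : P) (y : E) : B p (_root_.slideTo ℓ v y (a p y)) = y := by
    have h1 := hτ p (_root_.slideTo ℓ v y (a p y))
    simp only [hB, slideTo_slideTo hv, apply_slideTo hv] at h1 ⊢
    have h2 := le_abs_sub_of_le_fderiv (ℓ := ℓ) (hd p) (h p) y
      (τ p (_root_.slideTo ℓ v y (a p y))) (ℓ y)
    rw [h1, slideTo_self, sub_self, abs_zero] at h2
    have h3 : τ p (_root_.slideTo ℓ v y (a p y)) = ℓ y := by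
      rw [← sub_eq_zero, ← abs_eq_zero]
      nlinarith [abs_nonneg (τ p (_root_.slideTo ℓ v y (a p y)) - ℓ y)]
    rw [h3, slideTo_self]
  have hcB : Continuous fun q : P × E => B q.1 q.2 :=
    contDiff_slideTo.continuous.comp (continuous_snd.prodMk hcτ)
  let H (p : P) : E ≃ₜ E :=
    { toFun := fun y => _root_.slideTo ℓ v y (a p y)
      invFun := B p
      left_inv := hBA p
      right_inv := hAB p
      continuous_toFun := contDiff_slideTo.continuous.comp
        (continuous_id.prodMk (ha.smooth p).continuous)
      continuous_invFun := hcB.comp (continuous_const.prodMk continuous_id) }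
  have hne (p : P) (y : E) : 1 + (fderiv ℝ (a p) y - ℓ) v ≠ 0 := by
    have := h p y
    simp only [_root_.sub_apply, hv]
    linarith
  have hH (p : P) (y : E) : HasFDerivAt (H p)
      (shearEquiv (fderiv ℝ (a p) y - ℓ) v (hne p y) : E →L[ℝ] E) y :=
    hasFDerivAt_slideTo_apply (hd p) y
  refine ⟨B, ⟨fun p => (H p).contDiff_symm (hH p) ((ha.slideTo).smooth p), hcB, ?_⟩, hBA, hAB⟩
  have : (fun q : P × E => fderiv ℝ (B q.1) q.2) = fun q =>
      .id ℝ E - (1 + (fderiv ℝ (a q.1) (B q.1 q.2) - ℓ) v)⁻¹ •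
        (fderiv ℝ (a q.1) (B q.1 q.2) - ℓ).smulRight v := by
    ext1 q
    exact ((H q.1).toOpenPartialHomeomorph.hasFDerivAt_symm (Set.mem_univ q.2)
      (hH q.1 (B q.1 q.2))).fderiv
  rw [this]
  have hD : Continuous fun q : P × E => fderiv ℝ (a q.1) (B q.1 q.2) - ℓ :=
    (ha.cont_fderiv.comp (continuous_fst.prodMk hcB)).sub continuous_const
  refine continuous_const.sub (((continuous_const.add
    (hD.clm_apply continuous_const)).inv₀ fun q => hne _ _).smul ?_)
  exact (ContinuousLinearMap.smulRightL ℝ E E).continuous₂.comp (hD.prodMk continuous_const)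

end Inverse

section Measure

variable {E : Type} [NormedAddCommGroup E] [NormedSpace ℝ E] [FiniteDimensional ℝ E]
  [MeasurableSpace E] [BorelSpace E] {ℓ : E →L[ℝ] ℝ} {v : E} {μ : Measure E} [μ.IsAddHaarMeasure]

/-- The derivative of the shear is the identity plus `(Da - ℓ) ⊗ v`, of determinant `1 + Da v - ℓ v
= Da v`. -/
lemma measure_image_shear (hv : ℓ v = 1) {a : E → ℝ} (ha : Differentiable ℝ a)
    (h : ∀ y, 0 ≤ fderiv ℝ a y v) (hinj : Function.Injective fun y => slideTo ℓ v y (a y))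
    {s : Set E} (hs : MeasurableSet s) :
    μ ((fun y => slideTo ℓ v y (a y)) '' s) = ∫⁻ y in s, ENNReal.ofReal (fderiv ℝ a y v) ∂μ := by
  rw [← lintegral_abs_det_fderiv_eq_addHaar_image μ hs
    (fun y _ => (hasFDerivAt_slideTo_apply ha y).hasFDerivWithinAt) hinj.injOn]
  congr 1
  ext1 y
  have : ((ContinuousLinearMap.id ℝ E + (fderiv ℝ a y - ℓ).smulRight v : E →L[ℝ] E) : E →ₗ[ℝ] E) =
      LinearMap.transvection ((fderiv ℝ a y - ℓ : E →L[ℝ] ℝ) : E →ₗ[ℝ] ℝ) v := by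
    ext w
    simp [LinearMap.transvection]
  rw [ContinuousLinearMap.det, this, LinearMap.transvection.det]
  simp [hv, abs_of_nonneg (h y)]

variable {P : Type*} [TopologicalSpace P] [FirstCountableTopology P] [LocallyCompactSpace P]

/-- Let `a` and `a'` be the primitives of `m` and `m'` in the direction `v`. The shears they define
carry the measures with densities `m` and `m'` to `μ`, so `T` is the first shear followed by the
inverse of the second. It is the identity wherever the primitives agree. -/
theorem exists_isC1Fam_line_transport (hv : ℓ v = 1) {m m' : P → E → ℝ} (hm : IsC1Fam m)
    (hm' : IsC1Fam m') {c : ℝ} (hc : 0 < c) (hcm : ∀ p y, c ≤ m p y) (hcm' : ∀ p y, c ≤ m' p y)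
    {l r : ℝ} (hsupp : ∀ p y, ℓ y ∉ Set.Icc l r → m' p y = m p y)
    (hint : ∀ p y, ∫ s in l..r, (m' p (slideTo ℓ v y s) - m p (slideTo ℓ v y s)) = 0) :
    ∃ T T' : P → E → E, IsC1Fam T ∧ IsC1Fam T' ∧ (∀ p y, T' p (T p y) = y) ∧
      (∀ p y, T p (T' p y) = y) ∧
      (∀ p y, (ℓ y ∉ Set.Icc l r ∨ ∀ s, m' p (slideTo ℓ v y s) = m p (slideTo ℓ v y s)) →
        T p y = y) ∧
      ∀ p s, MeasurableSet s →
        ∫⁻ y in T p '' s, ENNReal.ofReal (m' p y) ∂μ = ∫⁻ y in s, ENNReal.ofReal (m p y) ∂μ := by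
  set a : P → E → ℝ := fun p y => ∫ s in l..ℓ y, m p (slideTo ℓ v y s) with ha
  set a' : P → E → ℝ := fun p y => ∫ s in l..ℓ y, m' p (slideTo ℓ v y s) with ha'
  have hCa : IsC1Fam a := hm.linePrimitive l
  have hCa' : IsC1Fam a' := hm'.linePrimitive l
  have hda (p : P) (y : E) : fderiv ℝ (a p) y v = m p y := fderiv_linePrimitive hv hm l p y
  have hda' (p : P) (y : E) : fderiv ℝ (a' p) y v = m' p y := fderiv_linePrimitive hv hm' l p y
  obtain ⟨B, hB, hBA, hAB⟩ := hCa.exists_inverse_shear hv hc (fun p y => (hda p y).symm ▸ hcm p y)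
  obtain ⟨B', hB', hBA', hAB'⟩ :=
    hCa'.exists_inverse_shear hv hc (fun p y => (hda' p y).symm ▸ hcm' p y)
  refine ⟨fun p y => B' p (slideTo ℓ v y (a p y)), fun p y => B p (slideTo ℓ v y (a' p y)),
    hB'.comp hCa.slideTo, hB.comp hCa'.slideTo, fun p y => ?_, fun p y => ?_, fun p y hy => ?_,
    fun p s hs => ?_⟩
  · simp only [hAB', hBA]
  · simp only [hAB, hBA']
  · have : a p y = a' p y := by
      have hcl (u : P → E → ℝ) (hu : IsC1Fam u) : Continuous fun s => u p (slideTo ℓ v y s) :=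
        (hu.smooth p).continuous.comp
          (contDiff_slideTo.continuous.comp (continuous_const.prodMk continuous_id))
      have hii (x z : ℝ) := (hcl m hm).intervalIntegrable (μ := volume) x z
      have hii' (x z : ℝ) := (hcl m' hm').intervalIntegrable (μ := volume) x z
      -- Outside the slab the primitives agree: before `l` the integrands coincide, and beyond `r`
      -- the only other contribution to the difference is its integral from `l` to `r`, which is
      -- zero.
      rcases hy with hy | hy
      · rw [← sub_eq_zero, ← neg_sub, neg_eq_zero]
        simp only [ha, ha']
        rw [← intervalIntegral.integral_sub (hii' _ _) (hii _ _)]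
        have hz (s : ℝ) (hs : s ∉ Set.Icc l r) :
            m' p (slideTo ℓ v y s) - m p (slideTo ℓ v y s) = 0 := by
          rw [sub_eq_zero]
          exact hsupp p _ (by rwa [apply_slideTo hv])
        rw [Set.mem_Icc, not_and_or, not_le, not_le] at hy
        rcases hy with hy | hy
        · refine intervalIntegral.integral_zero_ae ?_
          filter_upwards [compl_mem_ae_iff.2 (measure_singleton l)] with s hsl hs
          rw [Set.uIoc_of_ge hy.le] at hs
          exact hz s fun h => hsl (le_antisymm hs.2 h.1)
        · rw [← intervalIntegral.integral_add_adjacent_intervals (b := r)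
            ((hii' _ _).sub (hii _ _)) ((hii' _ _).sub (hii _ _)), hint, zero_add]
          refine intervalIntegral.integral_zero_ae (.of_forall fun s hs => hz s fun h => ?_)
          rw [Set.uIoc_of_le hy.le] at hs
          exact absurd hs.1 (not_lt.2 h.2)
      · simp [ha, ha', hy]
    simp only [this, hBA']
  · have himg : (fun y => slideTo ℓ v y (a' p y)) '' ((fun y => B' p (slideTo ℓ v y (a p y))) '' s)
        = (fun y => slideTo ℓ v y (a p y)) '' s := by
      rw [Set.image_image]
      simp only [hAB']
    have hinj : Function.Injective fun y => slideTo ℓ v y (a p y) :=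
      (Function.LeftInverse.injective (hBA p))
    have hinj' : Function.Injective fun y => slideTo ℓ v y (a' p y) :=
      (Function.LeftInverse.injective (hBA' p))
    have hs' : MeasurableSet ((fun y => B' p (slideTo ℓ v y (a p y))) '' s) := by
      have : (fun y => B' p (slideTo ℓ v y (a p y))) '' s =
          (fun y => B p (slideTo ℓ v y (a' p y))) ⁻¹' s :=
        congrFun (Set.image_eq_preimage_of_inverse (fun y => by simp only [hAB', hBA])
          (fun y => by simp only [hAB, hBA'])) s
      rw [this]
      exact ((hB.comp hCa'.slideTo).smooth p).continuous.measurable hs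
    have h1 := measure_image_shear (μ := μ) hv ((hCa.smooth p).differentiable (by simp))
      (fun y => by rw [hda]; exact hc.le.trans (hcm p y)) hinj hs
    have h2 := measure_image_shear (μ := μ) hv ((hCa'.smooth p).differentiable (by simp))
      (fun y => by rw [hda']; exact hc.le.trans (hcm' p y)) hinj' hs'
    rw [himg, h1] at h2
    simp only [hda, hda'] at h2
    exact h2.symm

end Measure
end Shears

/-! ### Decomposition of functions of zero integral on a cube -/

section Boxes
set_option linter.unusedSectionVars false
open Filter Topology

variable {d : ℕ} {P : Type*} [TopologicalSpace P]

/-- The closed cube with center `c` and radius `ρ` in Euclidean space. -/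
def cube (c : EuclideanSpace ℝ (Fin d)) (ρ : ℝ) : Set (EuclideanSpace ℝ (Fin d)) :=
  {y | ∀ i, |y i - c i| ≤ ρ}

/-- Replacement of the `j`-th coordinate of `y` by `s`. -/
noncomputable def updCoord (j : Fin d) (y : EuclideanSpace ℝ (Fin d)) (s : ℝ) : EuclideanSpace ℝ (Fin d) :=
  slideTo (EuclideanSpace.proj j : EuclideanSpace ℝ (Fin d) →L[ℝ] ℝ) (EuclideanSpace.single j 1) y s

lemma proj_single_self (j : Fin d) :
    (EuclideanSpace.proj j : EuclideanSpace ℝ (Fin d) →L[ℝ] ℝ) (EuclideanSpace.single j 1) = 1 := by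
  simp

lemma updCoord_same (j : Fin d) (y : EuclideanSpace ℝ (Fin d)) (s : ℝ) : updCoord j y s j = s := by
  simp [updCoord, slideTo]

lemma updCoord_of_ne {i j : Fin d} (h : i ≠ j) (y : EuclideanSpace ℝ (Fin d)) (s : ℝ) :
    updCoord j y s i = y i := by
  simp [updCoord, slideTo, h]

lemma continuous_updCoord (j : Fin d) (y : EuclideanSpace ℝ (Fin d)) : Continuous (updCoord j y) :=
  contDiff_slideTo.continuous.comp (continuous_const.prodMk continuous_id)

lemma intervalIntegrable_updCoord {u : EuclideanSpace ℝ (Fin d) → ℝ} (hu : Continuous u)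
    (j : Fin d) (y : EuclideanSpace ℝ (Fin d)) (a b : ℝ) :
    IntervalIntegrable (fun s => u (updCoord j y s)) volume a b :=
  (hu.comp (continuous_updCoord j y)).intervalIntegrable _ _

lemma isClosed_cube (c : EuclideanSpace ℝ (Fin d)) (ρ : ℝ) : IsClosed (cube c ρ) := by
  simp only [cube, Set.ofPred_forall]
  exact isClosed_iInter fun i => isClosed_le (by fun_prop) continuous_const

lemma isCompact_cube (c : EuclideanSpace ℝ (Fin d)) (ρ : ℝ) : IsCompact (cube c ρ) := by
  have : cube c ρ = (EuclideanSpace.equiv (Fin d) ℝ) ⁻¹'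
      (Set.univ.pi fun i => Set.Icc (c i - ρ) (c i + ρ)) := by
    ext y
    change (∀ i, |y i - c i| ≤ ρ) ↔ ∀ i ∈ Set.univ, y i ∈ Set.Icc (c i - ρ) (c i + ρ)
    refine ⟨fun h i _ => ?_, fun h i => ?_⟩
    · obtain ⟨h1, h2⟩ := abs_le.1 (h i)
      exact ⟨by linarith, by linarith⟩
    · obtain ⟨h1, h2⟩ := h i (Set.mem_univ i)
      exact abs_le.2 ⟨by linarith, by linarith⟩
  rw [this]
  exact (EuclideanSpace.equiv (Fin d) ℝ).toHomeomorph.isCompact_preimage.2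
    (isCompact_univ_pi fun i => isCompact_Icc)

lemma hasCompactSupport_of_cube {F : Type*} [Zero F] {c : EuclideanSpace ℝ (Fin d)} {ρ : ℝ}
    {u : EuclideanSpace ℝ (Fin d) → F} (h : ∀ y ∉ cube c ρ, u y = 0) : HasCompactSupport u :=
  HasCompactSupport.intro (isCompact_cube c ρ) h

/-- A family of functions supported in a cube whose integrals along all lines parallel to the `j`-th
axis vanish. -/
structure IsLineZero (c : EuclideanSpace ℝ (Fin d)) (ρ : ℝ) (j : Fin d)
    (e : P → EuclideanSpace ℝ (Fin d) → ℝ) : Prop where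
  fam : IsC1Fam e
  supp : ∀ p, ∀ y ∉ cube c ρ, e p y = 0
  integral : ∀ p y, ∫ s in (c j - ρ)..(c j + ρ), e p (updCoord j y s) = 0

namespace IsLineZero

variable {c : EuclideanSpace ℝ (Fin d)} {ρ : ℝ} {j : Fin d} {e : P → EuclideanSpace ℝ (Fin d) → ℝ}

/-- Either the whole line misses the cube, or the range of integration contains none of the cube up
to an endpoint, or it contains all of it and the integral vanishes by assumption. -/
lemma primitive_eq_zero (he : IsLineZero c ρ j e) (p : P) {y : EuclideanSpace ℝ (Fin d)}
    (hy : y ∉ cube c ρ) : ∫ s in (c j - ρ)..y j, e p (updCoord j y s) = 0 := by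
  by_cases h : ∃ i, i ≠ j ∧ ¬ |y i - c i| ≤ ρ
  · obtain ⟨i, hij, hi⟩ := h
    have (s : ℝ) : e p (updCoord j y s) = 0 :=
      he.supp p _ fun h => hi (by simpa [updCoord_of_ne hij] using h i)
    simp [this]
  · push Not at h
    have hj : ρ < |y j - c j| := by
      by_contra! hj
      exact hy fun i => if hi : i = j then hi ▸ hj else h i hi
    have hz (s : ℝ) (hs : ρ < |s - c j|) : e p (updCoord j y s) = 0 :=
      he.supp p _ fun h => not_le.2 hs (by simpa [updCoord_same] using h j)
    have hii (a b : ℝ) : IntervalIntegrable (fun s => e p (updCoord j y s)) volume a b :=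
      intervalIntegrable_updCoord (he.fam.smooth p).continuous j y _ _
    rcases lt_abs.1 hj with hj | hj
    · rw [← intervalIntegral.integral_add_adjacent_intervals (b := c j + ρ) (hii _ _) (hii _ _),
        he.integral, zero_add]
      refine intervalIntegral.integral_zero_ae (.of_forall fun s hs => hz s (lt_abs.2 (.inl ?_)))
      rw [Set.uIoc_of_le (by linarith)] at hs
      linarith [hs.1]
    · refine intervalIntegral.integral_zero_ae ?_
      filter_upwards [compl_mem_ae_iff.2 (measure_singleton (c j - ρ))] with s hsl hs
      rw [Set.uIoc_of_ge (by linarith)] at hs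
      refine hz s (lt_abs.2 (.inr ?_))
      have := lt_of_le_of_ne hs.2 hsl
      linarith

lemma reparam {Q : Type*} [TopologicalSpace Q] (he : IsLineZero c ρ j e) {a : Q → P}
    (ha : Continuous a) : IsLineZero c ρ j fun q => e (a q) :=
  ⟨he.fam.reparam ha, fun q => he.supp (a q), fun q => he.integral (a q)⟩

lemma sub {e' : P → EuclideanSpace ℝ (Fin d) → ℝ} (he : IsLineZero c ρ j e)
    (he' : IsLineZero c ρ j e') : IsLineZero c ρ j fun p y => e p y - e' p y := by
  refine ⟨he.fam.sub he'.fam, fun p y hy => by rw [he.supp p y hy, he'.supp p y hy, sub_zero],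
    fun p y => ?_⟩
  rw [intervalIntegral.integral_sub
    (intervalIntegrable_updCoord (he.fam.smooth p).continuous j y _ _)
    (intervalIntegrable_updCoord (he'.fam.smooth p).continuous j y _ _),
    he.integral, he'.integral, sub_zero]

lemma smul {a : P → ℝ} (ha : Continuous a) (he : IsLineZero c ρ j e) :
    IsLineZero c ρ j fun p y => a p * e p y := by
  refine ⟨(IsC1Fam.of_continuous ha).mul he.fam, fun p y hy => by rw [he.supp p y hy, mul_zero],
    fun p y => ?_⟩
  rw [intervalIntegral.integral_const_mul, he.integral, mul_zero]

variable [FirstCountableTopology P] [LocallyCompactSpace P]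

/-- The function is the derivative, in the `j`-th direction, of its compactly supported primitive;
integrating by parts against 1 gives zero. -/
lemma integral_eq_zero (he : IsLineZero c ρ j e) (p : P) : ∫ y, e p y = 0 := by
  set H : P → EuclideanSpace ℝ (Fin d) → ℝ :=
    fun p y => ∫ s in (c j - ρ)..y j, e p (updCoord j y s) with hH
  have hHfam : IsC1Fam H := he.fam.linePrimitive (ℓ := EuclideanSpace.proj j) (c j - ρ)
  have hd (y : EuclideanSpace ℝ (Fin d)) : HasLineDerivAt ℝ (H p) (e p y) y (EuclideanSpace.single j 1) := by
    rw [← fderiv_linePrimitive (proj_single_self j) he.fam (c j - ρ) p y]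
    exact (hHfam.differentiableAt p y).hasFDerivAt.hasLineDerivAt _
  have hi : Integrable (e p) := (he.fam.smooth p).continuous.integrable_of_hasCompactSupport
    (hasCompactSupport_of_cube (he.supp p))
  have hi' : Integrable (H p) := (hHfam.smooth p).continuous.integrable_of_hasCompactSupport
    (hasCompactSupport_of_cube fun y => he.primitive_eq_zero p)
  have := integral_bilinear_hasLineDerivAt_right_eq_neg_left_of_integrable
    (μ := (volume : Measure (EuclideanSpace ℝ (Fin d))))
    (f := fun _ => (1 : ℝ)) (f' := fun _ => 0) (g := H p) (g' := e p)
    (v := EuclideanSpace.single j 1) (B := ContinuousLinearMap.mul ℝ ℝ) (by simp) (by simpa using hi)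
    (by simpa using hi') (fun y _ => (hasFDerivAt_const (1 : ℝ) y).hasLineDerivAt _) (fun y _ => hd y)
  simpa using this

end IsLineZero

variable [FirstCountableTopology P] [LocallyCompactSpace P]

lemma exists_bump_integral_one {ρ : ℝ} (hρ : 0 < ρ) : ∃ θ : ℝ → ℝ, ContDiff ℝ ∞ θ ∧ (∀ s, 0 ≤ θ s) ∧
    0 < θ 0 ∧ (∀ s, ρ < |s| → θ s = 0) ∧ ∀ a, ∫ s in (a - ρ)..(a + ρ), θ (s - a) = 1 := by
  let f : ContDiffBump (0 : ℝ) := ⟨ρ / 2, ρ, by positivity, by linarith⟩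
  have hz (s : ℝ) (hs : ρ ≤ |s|) : f.normed volume s = 0 := by
    rw [← Function.notMem_support, f.support_normed_eq]
    simpa [f] using hs
  refine ⟨f.normed volume, f.contDiff_normed, fun s => f.nonneg_normed s, ?_, fun s hs => hz s hs.le,
    fun a => ?_⟩
  · have : (0 : ℝ) ∈ Function.support (f.normed volume) := by
      rw [f.support_normed_eq]; simpa [f] using hρ
    exact lt_of_le_of_ne (f.nonneg_normed 0) (Ne.symm this)
  · rw [intervalIntegral.integral_comp_sub_right (fun s => f.normed volume s),
      intervalIntegral.integral_of_le (by linarith), ← f.integral_normed (μ := volume)]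
    refine setIntegral_eq_integral_of_forall_compl_eq_zero fun s hs => hz s ?_
    rw [Set.mem_Ioc, not_and_or, not_lt, not_le] at hs
    rw [le_abs]
    rcases hs with hs | hs
    · right; linarith
    · left; linarith

/-- The coordinates are integrated out one by one. At `j` the remainder `r` is replaced by a fixed
bump in the `j`-th coordinate times the integral of `r` along the `j`-lines. The bump has integral
one, so the difference has zero line integrals. The final remainder is a multiple of a product of
bumps and has zero integral, so it vanishes. -/
theorem exists_sum_isLineZero {c : EuclideanSpace ℝ (Fin d)} {ρ : ℝ} (hρ : 0 < ρ)
    {g : P → EuclideanSpace ℝ (Fin d) → ℝ} (hg : IsC1Fam g) (hsupp : ∀ p, ∀ y ∉ cube c ρ, g p y = 0)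
    (hint : ∀ p, ∫ y, g p y = 0) :
    ∃ e : Fin d → P → EuclideanSpace ℝ (Fin d) → ℝ, (∀ j, IsLineZero c ρ j (e j)) ∧
      ∀ p y, g p y = ∑ j, e j p y := by
  obtain ⟨θ, hθ, hθ0, hθpos, hθz, hθint⟩ := exists_bump_integral_one hρ
  set Θ : Finset (Fin d) → EuclideanSpace ℝ (Fin d) → ℝ := fun S y => ∏ i ∈ S, θ (y i - c i) with hΘ
  -- The last clause says without division that `r` is `Θ S` times a function of the coordinates
  -- outside `S`.
  have key (S : Finset (Fin d)) : ∃ (e : Fin d → P → EuclideanSpace ℝ (Fin d) → ℝ)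
      (r : P → EuclideanSpace ℝ (Fin d) → ℝ), (∀ j ∈ S, IsLineZero c ρ j (e j)) ∧ IsC1Fam r ∧
      (∀ p, ∀ y ∉ cube c ρ, r p y = 0) ∧ (∀ p y, g p y = ∑ j ∈ S, e j p y + r p y) ∧
      ∀ p y y', (∀ i ∉ S, y i = y' i) → Θ S y' * r p y = Θ S y * r p y' := by
    induction S using Finset.induction_on with
    | empty =>
      refine ⟨0, g, by simp, hg, hsupp, by simp, fun p y y' h => ?_⟩
      have : y = y' := by ext i; exact h i (Finset.notMem_empty i)
      rw [this]
    | insert j S hj ih =>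
      obtain ⟨e, r, he, hr, hrs, hgr, hsym⟩ := ih
      set I : P → EuclideanSpace ℝ (Fin d) → ℝ :=
        fun p y => ∫ s in (c j - ρ)..(c j + ρ), r p (updCoord j y s) with hI
      have hIfam : IsC1Fam I := hr.lineIntegral (ℓ := EuclideanSpace.proj j) _ _
      have hIupd (p : P) (y : EuclideanSpace ℝ (Fin d)) (s : ℝ) : I p (updCoord j y s) = I p y := by
        simp only [hI, updCoord, slideTo_slideTo (proj_single_self j)]
      set r' : P → EuclideanSpace ℝ (Fin d) → ℝ := fun p y => θ (y j - c j) * I p y with hr'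
      have hr'fam : IsC1Fam r' := (IsC1Fam.of_contDiff (hθ.comp
        (((EuclideanSpace.proj j : EuclideanSpace ℝ (Fin d) →L[ℝ] ℝ).contDiff).sub contDiff_const))).mul hIfam
      have hr's (p : P) (y : EuclideanSpace ℝ (Fin d)) (hy : y ∉ cube c ρ) : r' p y = 0 := by
        by_cases h : ρ < |y j - c j|
        · simp only [hr', hθz _ h, zero_mul]
        · have : ∃ i, ρ < |y i - c i| := by simpa [cube] using hy
          obtain ⟨i, hi⟩ := this
          have hij : i ≠ j := by rintro rfl; exact h hi
          have (s : ℝ) : r p (updCoord j y s) = 0 :=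
            hrs p _ fun h => not_le.2 hi (by simpa [updCoord_of_ne hij] using h i)
          simp [hr', hI, this]
      refine ⟨Function.update e j fun p y => r p y - r' p y, r', fun i hi => ?_, hr'fam, hr's,
        fun p y => ?_, fun p y y' hyy' => ?_⟩
      · rcases eq_or_ne i j with rfl | hij
        · rw [Function.update_self]
          refine ⟨hr.sub hr'fam, fun p y hy => by rw [hrs p y hy, hr's p y hy, sub_zero],
            fun p y => ?_⟩
          rw [intervalIntegral.integral_sub
            (intervalIntegrable_updCoord (hr.smooth p).continuous i y _ _)
            (intervalIntegrable_updCoord (hr'fam.smooth p).continuous i y _ _)]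
          simp only [hr', hIupd, updCoord_same, intervalIntegral.integral_mul_const, hθint, one_mul]
          exact sub_self _
        · rw [Function.update_of_ne hij]
          exact he i (Finset.mem_of_mem_insert_of_ne hi hij)
      · rw [Finset.sum_insert hj, Function.update_self, hgr p y]
        have : ∑ i ∈ S, Function.update e j (fun p y => r p y - r' p y) i p y = ∑ i ∈ S, e i p y :=
          Finset.sum_congr rfl fun i hi => by
            rw [Function.update_of_ne (ne_of_mem_of_not_mem hi hj)]
        rw [this]
        ring
      · have hΘupd (y : EuclideanSpace ℝ (Fin d)) (s : ℝ) : Θ S (updCoord j y s) = Θ S y :=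
          Finset.prod_congr rfl fun i hi => by
            rw [updCoord_of_ne (ne_of_mem_of_not_mem hi hj)]
        have hs : Θ S y' * I p y = Θ S y * I p y' := by
          simp only [hI, ← intervalIntegral.integral_const_mul]
          refine intervalIntegral.integral_congr fun s _ => ?_
          have := hsym p (updCoord j y s) (updCoord j y' s) fun i hi => by
            rcases eq_or_ne i j with rfl | hij
            · simp [updCoord_same]
            · simp only [updCoord_of_ne hij]
              exact hyy' i (by simp [hij, hi])
          simpa only [hΘupd] using this
        have hΘi (y : EuclideanSpace ℝ (Fin d)) : Θ (insert j S) y = θ (y j - c j) * Θ S y :=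
          Finset.prod_insert hj
        simp only [hΘi, hr']
        linear_combination (θ (y j - c j) * θ (y' j - c j)) * hs
  obtain ⟨e, r, he, hr, hrs, hgr, hsym⟩ := key Finset.univ
  refine ⟨e, fun j => he j (Finset.mem_univ j), fun p y => ?_⟩
  rw [hgr p y, add_eq_left]
  have hci {u : EuclideanSpace ℝ (Fin d) → ℝ} (hu : Continuous u) (h : ∀ y ∉ cube c ρ, u y = 0) :
      Integrable u := hu.integrable_of_hasCompactSupport (hasCompactSupport_of_cube h)
  have hei (j : Fin d) : Integrable (e j p) :=
    hci ((he j (Finset.mem_univ j)).fam.smooth p).continuous ((he j (Finset.mem_univ j)).supp p)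
  have hr0 : ∫ y, r p y = 0 := by
    have := hint p
    simp only [hgr p] at this
    rw [integral_add (integrable_finsetSum _ fun j _ => hei j) (hci (hr.smooth p).continuous (hrs p)),
      integral_finsetSum _ fun j _ => hei j] at this
    simpa [(he _ (Finset.mem_univ _)).integral_eq_zero p] using this
  have hΘc : Continuous (Θ Finset.univ) := continuous_finsetProd _ fun i _ =>
    hθ.continuous.comp (by fun_prop)
  have hΘs (y : EuclideanSpace ℝ (Fin d)) (hy : y ∉ cube c ρ) : Θ Finset.univ y = 0 := by
    have : ∃ i, ρ < |y i - c i| := by simpa [cube] using hy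
    obtain ⟨i, hi⟩ := this
    exact Finset.prod_eq_zero (Finset.mem_univ i) (hθz _ hi)
  have hΘpos : 0 < ∫ y, Θ Finset.univ y := by
    refine hΘc.integral_pos_of_hasCompactSupport_nonneg_nonzero (x := c)
      (hasCompactSupport_of_cube hΘs) (fun y => Finset.prod_nonneg fun i _ => hθ0 _) ?_
    simp only [hΘ, sub_self]
    exact (Finset.prod_pos fun i _ => hθpos).ne'
  -- With every coordinate used, the clause compares arbitrary points; integrating it over `z`
  -- leaves `(∫ Θ) * r p y = 0`.
  have h1 : ∫ z, Θ Finset.univ y * r p z = ∫ z, Θ Finset.univ z * r p y :=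
    integral_congr_ae (.of_forall fun z => hsym p z y (by simp))
  rw [integral_const_mul, integral_mul_const, hr0, mul_zero] at h1
  exact (mul_eq_zero.1 h1.symm).resolve_left hΘpos.ne'

end Boxes

/-! ### C¹-continuous families on open sets and extension by zero -/

section LocalFamilies
set_option linter.unusedSectionVars false
open Filter Topology

/-- A family of maps that is smooth on `s`, continuously so in the `C¹` topology. -/
structure IsC1FamOn {P E F : Type*} [TopologicalSpace P] [NormedAddCommGroup E] [NormedSpace ℝ E]
    [NormedAddCommGroup F] [NormedSpace ℝ F] (u : P → E → F) (s : Set E) : Prop where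
  smooth : ∀ p, ContDiffOn ℝ ∞ (u p) s
  cont : ContinuousOn (fun q : P × E => u q.1 q.2) (Set.univ ×ˢ s)
  cont_fderiv : ContinuousOn (fun q : P × E => fderiv ℝ (u q.1) q.2) (Set.univ ×ˢ s)

variable {P Q E F G : Type*} [TopologicalSpace P] [TopologicalSpace Q]
  [NormedAddCommGroup E] [NormedSpace ℝ E] [NormedAddCommGroup F] [NormedSpace ℝ F]
  [NormedAddCommGroup G] [NormedSpace ℝ G] {s t : Set E}

lemma IsC1Fam.on {u : P → E → F} (hu : IsC1Fam u) (s : Set E) : IsC1FamOn u s :=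
  ⟨fun p => (hu.smooth p).contDiffOn, hu.cont.continuousOn, hu.cont_fderiv.continuousOn⟩

lemma IsC1FamOn.isC1Fam {u : P → E → F} (hu : IsC1FamOn u Set.univ) : IsC1Fam u :=
  ⟨fun p => contDiffOn_univ.1 (hu.smooth p), by simpa [continuousOn_univ] using hu.cont,
    by simpa [continuousOn_univ] using hu.cont_fderiv⟩

namespace IsC1FamOn

lemma mono {u : P → E → F} (hu : IsC1FamOn u s) (h : t ⊆ s) : IsC1FamOn u t :=
  ⟨fun p => (hu.smooth p).mono h, hu.cont.mono (Set.prod_mono_right h),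
    hu.cont_fderiv.mono (Set.prod_mono_right h)⟩

lemma differentiableAt {u : P → E → F} (hu : IsC1FamOn u s) (hs : IsOpen s) (p : P) {y : E}
    (hy : y ∈ s) : DifferentiableAt ℝ (u p) y :=
  ((hu.smooth p).contDiffAt (hs.mem_nhds hy)).differentiableAt (by simp)

lemma reparam {u : P → E → F} (hu : IsC1FamOn u s) {a : Q → P} (ha : Continuous a) :
    IsC1FamOn (fun q => u (a q)) s := by
  have hc : Continuous fun q : Q × E => (a q.1, q.2) :=
    (ha.comp continuous_fst).prodMk continuous_snd
  exact ⟨fun q => hu.smooth (a q), hu.cont.comp hc.continuousOn fun q hq => ⟨trivial, hq.2⟩,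
    hu.cont_fderiv.comp hc.continuousOn fun q hq => ⟨trivial, hq.2⟩⟩

lemma of_contDiffOn (hs : IsOpen s) {f : E → F} (hf : ContDiffOn ℝ ∞ f s) :
    IsC1FamOn (fun _ : P => f) s :=
  ⟨fun _ => hf, hf.continuousOn.comp continuousOn_snd fun _ hq => hq.2,
    (hf.continuousOn_fderiv_of_isOpen hs (by simp)).comp continuousOn_snd fun _ hq => hq.2⟩

lemma comp {v : P → F → G} {u : P → E → F} {t : Set F} (hv : IsC1FamOn v t) (hu : IsC1FamOn u s)
    (ht : IsOpen t) (hs : IsOpen s) (h : ∀ p, ∀ y ∈ s, u p y ∈ t) :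
    IsC1FamOn (fun p y => v p (u p y)) s := by
  have hc : ContinuousOn (fun q : P × E => (q.1, u q.1 q.2)) (Set.univ ×ˢ s) :=
    continuousOn_fst.prodMk hu.cont
  have hm : Set.MapsTo (fun q : P × E => (q.1, u q.1 q.2)) (Set.univ ×ˢ s) (Set.univ ×ˢ t) :=
    fun q hq => ⟨trivial, h q.1 q.2 hq.2⟩
  refine ⟨fun p => (hv.smooth p).comp (hu.smooth p) (h p), hv.cont.comp hc hm, ?_⟩
  refine ((hv.cont_fderiv.comp hc hm).clm_comp hu.cont_fderiv).congr fun q hq => ?_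
  exact fderiv_comp q.2 (hv.differentiableAt ht _ (h q.1 q.2 hq.2)) (hu.differentiableAt hs _ hq.2)

lemma prodMk {v : P → E → G} {u : P → E → F} (hv : IsC1FamOn v s) (hu : IsC1FamOn u s)
    (hs : IsOpen s) : IsC1FamOn (fun p y => (v p y, u p y)) s := by
  refine ⟨fun p => (hv.smooth p).prodMk (hu.smooth p), hv.cont.prodMk hu.cont, ?_⟩
  refine ((ContinuousLinearMap.prodₗᵢ ℝ).continuous.comp_continuousOn
    (hv.cont_fderiv.prodMk hu.cont_fderiv) : ).congr fun q hq => ?_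
  exact (hv.differentiableAt hs _ hq.2).fderiv_prodMk (hu.differentiableAt hs _ hq.2)

lemma contDiff_comp {f : F → G} (hf : ContDiff ℝ ∞ f) {u : P → E → F} (hu : IsC1FamOn u s)
    (hs : IsOpen s) : IsC1FamOn (fun p y => f (u p y)) s :=
  ((IsC1Fam.of_contDiff hf).on Set.univ).comp hu isOpen_univ hs fun _ _ _ => trivial

lemma add {u v : P → E → F} (hu : IsC1FamOn u s) (hv : IsC1FamOn v s) (hs : IsOpen s) :
    IsC1FamOn (fun p y => u p y + v p y) s :=
  contDiff_comp (contDiff_fst.add contDiff_snd) (hu.prodMk hv hs) hs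

lemma sub {u v : P → E → F} (hu : IsC1FamOn u s) (hv : IsC1FamOn v s) (hs : IsOpen s) :
    IsC1FamOn (fun p y => u p y - v p y) s :=
  contDiff_comp (contDiff_fst.sub contDiff_snd) (hu.prodMk hv hs) hs

lemma mul {u v : P → E → ℝ} (hu : IsC1FamOn u s) (hv : IsC1FamOn v s) (hs : IsOpen s) :
    IsC1FamOn (fun p y => u p y * v p y) s :=
  contDiff_comp (contDiff_fst.mul contDiff_snd) (hu.prodMk hv hs) hs

lemma congr {u v : P → E → F} (hu : IsC1FamOn u s) (hs : IsOpen s) (h : ∀ p, ∀ y ∈ s, v p y = u p y) :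
    IsC1FamOn v s :=
  ⟨fun p => (hu.smooth p).congr (h p), hu.cont.congr fun q hq => h q.1 q.2 hq.2,
    hu.cont_fderiv.congr fun q hq =>
      ((Set.EqOn.eventuallyEq_of_mem (h q.1) (hs.mem_nhds hq.2)).fderiv_eq)⟩

lemma union {u : P → E → F} (hu : IsC1FamOn u s) (hu' : IsC1FamOn u t) (hs : IsOpen s)
    (ht : IsOpen t) : IsC1FamOn u (s ∪ t) := by
  refine ⟨fun p => (hu.smooth p).union_of_isOpen (hu'.smooth p) hs ht, ?_, ?_⟩ <;> rw [Set.prod_union]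
  · exact hu.cont.union_of_isOpen hu'.cont (isOpen_univ.prod hs) (isOpen_univ.prod ht)
  · exact hu.cont_fderiv.union_of_isOpen hu'.cont_fderiv (isOpen_univ.prod hs) (isOpen_univ.prod ht)

/-- The open sets `s` and `Kᶜ` cover the space, and the extended family vanishes on the second. -/
lemma indicator {u : P → E → F} (hu : IsC1FamOn u s) (hs : IsOpen s) {K : Set E} (hK : IsClosed K)
    (hKs : K ⊆ s) (h : ∀ p, ∀ y ∈ s, y ∉ K → u p y = 0) : IsC1Fam fun p => s.indicator (u p) := by
  have h1 : IsC1FamOn (fun p => s.indicator (u p)) s :=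
    hu.congr hs fun p y hy => Set.indicator_of_mem hy _
  have h2 : IsC1FamOn (fun p => s.indicator (u p)) Kᶜ :=
    ((IsC1Fam.of_contDiff (P := P) (contDiff_const (c := (0 : F)))).on Kᶜ).congr hK.isOpen_compl
      fun p y hy => by
        by_cases hys : y ∈ s
        · rw [Set.indicator_of_mem hys, h p y hys hy]
        · exact Set.indicator_of_notMem hys _
  have h3 := h1.union h2 hs hK.isOpen_compl
  rw [show s ∪ Kᶜ = Set.univ from Set.eq_univ_of_forall fun y =>
    (em (y ∈ K)).imp (fun h => hKs h) id] at h3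
  exact h3.isC1Fam

end IsC1FamOn

end LocalFamilies

/-! ### C¹-continuous families of functions on a manifold -/

section ManifoldFamilies
set_option linter.unusedSectionVars false
open Filter Topology

variable {d : ℕ} {M : Type*} [TopologicalSpace M]
    [ChartedSpace (EuclideanSpace ℝ (Fin d)) M] [IsManifold (𝓡 d) ∞ M]
    {P Q : Type*} [TopologicalSpace P] [TopologicalSpace Q]

/-- A family of smooth functions on a manifold that is continuous for the `C¹` topology. -/
def IsC1FamM (d : ℕ) {M : Type*} [TopologicalSpace M]
    [ChartedSpace (EuclideanSpace ℝ (Fin d)) M] {P : Type*} [TopologicalSpace P]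
    (u : P → M → ℝ) : Prop :=
  ∀ x₀ : M, IsC1FamOn (fun p y => u p ((extChartAt (𝓡 d) x₀).symm y)) (extChartAt (𝓡 d) x₀).target

namespace IsC1FamM

lemma reparam {u : P → M → ℝ} (hu : IsC1FamM d u) {a : Q → P} (ha : Continuous a) :
    IsC1FamM d fun q => u (a q) := fun x₀ => (hu x₀).reparam ha

lemma add {u v : P → M → ℝ} (hu : IsC1FamM d u) (hv : IsC1FamM d v) :
    IsC1FamM d fun p x => u p x + v p x :=
  fun x₀ => (hu x₀).add (hv x₀) (isOpen_extChartAt_target x₀)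

lemma sub {u v : P → M → ℝ} (hu : IsC1FamM d u) (hv : IsC1FamM d v) :
    IsC1FamM d fun p x => u p x - v p x :=
  fun x₀ => (hu x₀).sub (hv x₀) (isOpen_extChartAt_target x₀)

lemma mul {u v : P → M → ℝ} (hu : IsC1FamM d u) (hv : IsC1FamM d v) :
    IsC1FamM d fun p x => u p x * v p x :=
  fun x₀ => (hu x₀).mul (hv x₀) (isOpen_extChartAt_target x₀)

lemma of_continuous {c : P → ℝ} (hc : Continuous c) : IsC1FamM d fun p (_ : M) => c p :=
  fun _ => (IsC1Fam.of_continuous hc).on _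

lemma of_contMDiff {f : M → ℝ} (hf : ContMDiff (𝓡 d) 𝓘(ℝ, ℝ) ∞ f) : IsC1FamM d fun _ : P => f :=
  fun x₀ => .of_contDiffOn (isOpen_extChartAt_target x₀) (contMDiffOn_iff_contDiffOn.1
    (hf.comp_contMDiffOn (contMDiffOn_extChartAt_symm x₀)))

lemma continuous {u : P → M → ℝ} (hu : IsC1FamM d u) : Continuous fun q : P × M => u q.1 q.2 := by
  rw [continuous_iff_continuousAt]
  rintro ⟨p, x⟩
  have h1 : ContinuousAt (fun q : P × EuclideanSpace ℝ (Fin d) =>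
      u q.1 ((extChartAt (𝓡 d) x).symm q.2)) (p, extChartAt (𝓡 d) x x) :=
    (hu x).cont.continuousAt ((isOpen_univ.prod (isOpen_extChartAt_target x)).mem_nhds
      ⟨trivial, mem_extChartAt_target x⟩)
  have h2 : ContinuousAt (fun q : P × M => (q.1, extChartAt (𝓡 d) x q.2)) (p, x) :=
    continuousAt_fst.prodMk ((continuousAt_extChartAt (I := 𝓡 d) x).comp_of_eq continuousAt_snd rfl)
  refine (h1.comp_of_eq h2 rfl).congr ?_
  filter_upwards [continuousAt_snd.eventually_mem (extChartAt_source_mem_nhds (I := 𝓡 d) x)] with q hq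
  exact congrArg (u q.1) ((extChartAt (𝓡 d) x).left_inv hq)

/-- A family supported in a compact subset of a chart domain extends by zero to the manifold. -/
lemma indicator_chart [T2Space M] (x₀ : M) {g : P → EuclideanSpace ℝ (Fin d) → ℝ}
    (hg : IsC1FamOn g (extChartAt (𝓡 d) x₀).target) {K : Set (EuclideanSpace ℝ (Fin d))}
    (hK : IsCompact K) (hKt : K ⊆ (extChartAt (𝓡 d) x₀).target)
    (h : ∀ p, ∀ y ∈ (extChartAt (𝓡 d) x₀).target, y ∉ K → g p y = 0) :
    IsC1FamM d fun p => (extChartAt (𝓡 d) x₀).source.indicator fun x => g p (extChartAt (𝓡 d) x₀ x) := by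
  intro x₁
  set φ := extChartAt (𝓡 d) x₀ with hφ
  set ψ := extChartAt (𝓡 d) x₁ with hψ
  have hψc : ContinuousOn ψ.symm ψ.target := continuousOn_extChartAt_symm x₁
  have ho1 : IsOpen (ψ.target ∩ ψ.symm ⁻¹' φ.source) :=
    hψc.isOpen_inter_preimage (isOpen_extChartAt_target x₁) (isOpen_extChartAt_source x₀)
  have hKM : IsClosed (φ.symm '' K) :=
    (hK.image_of_continuousOn ((continuousOn_extChartAt_symm x₀).mono hKt)).isClosed
  have ho2 : IsOpen (ψ.target ∩ ψ.symm ⁻¹' (φ.symm '' K)ᶜ) :=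
    hψc.isOpen_inter_preimage (isOpen_extChartAt_target x₁) hKM.isOpen_compl
  have h1 : IsC1FamOn (fun p y => φ.source.indicator (fun x => g p (φ x)) (ψ.symm y))
      (ψ.target ∩ ψ.symm ⁻¹' φ.source) := by
    have hcc : ContDiffOn ℝ ∞ (φ ∘ ψ.symm) (ψ.target ∩ ψ.symm ⁻¹' φ.source) :=
      contDiffOn_ext_coord_change x₀ x₁
    refine (hg.comp (.of_contDiffOn ho1 hcc) (isOpen_extChartAt_target x₀) ho1
      fun p y hy => φ.map_source hy.2).congr ho1 fun p y hy => ?_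
    exact Set.indicator_of_mem (show ψ.symm y ∈ φ.source from hy.2) fun x => g p (φ x)
  have h2 : IsC1FamOn (fun p y => φ.source.indicator (fun x => g p (φ x)) (ψ.symm y))
      (ψ.target ∩ ψ.symm ⁻¹' (φ.symm '' K)ᶜ) := by
    refine ((IsC1Fam.of_contDiff (P := P) (contDiff_const (c := (0 : ℝ)))).on _).congr ho2
      fun p y hy => ?_
    by_cases hys : ψ.symm y ∈ φ.source
    · rw [Set.indicator_of_mem hys]
      exact h p _ (φ.map_source hys) fun hyK => hy.2 ⟨_, hyK, φ.left_inv hys⟩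
    · exact Set.indicator_of_notMem hys _
  refine (h1.union h2 ho1 ho2).mono fun y hy => ?_
  rw [← Set.inter_union_distrib_left, ← Set.preimage_union]
  refine ⟨hy, ?_⟩
  by_cases hys : ψ.symm y ∈ φ.source
  · exact .inl hys
  · refine .inr fun ⟨z, hz, hzy⟩ => hys (hzy ▸ φ.map_target (hKt hz))

end IsC1FamM
end ManifoldFamilies

/-! ### Transplanting diffeomorphisms of Euclidean space through a chart -/

section Transplant
set_option linter.unusedSectionVars false
attribute [local instance 5000] isManifold_one_of_infty instTopologicalSpaceTangentBundle
open Filter Topology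

variable {d : ℕ} {M : Type*} [TopologicalSpace M]
    [ChartedSpace (EuclideanSpace ℝ (Fin d)) M] [IsManifold (𝓡 d) ∞ M]
    {P : Type*} [TopologicalSpace P]

lemma IsC1Fam.continuous_tangentMap {T : P → EuclideanSpace ℝ (Fin d) → EuclideanSpace ℝ (Fin d)}
    (hT : IsC1Fam T) : Continuous fun q : P × TangentBundle (𝓡 d) (EuclideanSpace ℝ (Fin d)) =>
      tangentMap (𝓡 d) (𝓡 d) (T q.1) q.2 := by
  have hh : Continuous fun v : TangentBundle (𝓡 d) (EuclideanSpace ℝ (Fin d)) =>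
      ((v.1, v.2) : EuclideanSpace ℝ (Fin d) × EuclideanSpace ℝ (Fin d)) :=
    (tangentBundleModelSpaceHomeomorph (𝓡 d)).continuous
  have hh' : Continuous fun z : EuclideanSpace ℝ (Fin d) × EuclideanSpace ℝ (Fin d) =>
      (⟨z.1, z.2⟩ : TangentBundle (𝓡 d) (EuclideanSpace ℝ (Fin d))) :=
    (tangentBundleModelSpaceHomeomorph (𝓡 d)).symm.continuous
  have h1 : Continuous fun q : P × TangentBundle (𝓡 d) (EuclideanSpace ℝ (Fin d)) => (q.1, q.2.1) :=
    continuous_fst.prodMk ((continuous_fst.comp hh).comp continuous_snd)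
  have h2 : Continuous fun q : P × TangentBundle (𝓡 d) (EuclideanSpace ℝ (Fin d)) =>
      ((T q.1 q.2.1, fderiv ℝ (T q.1) q.2.1 q.2.2) :
        EuclideanSpace ℝ (Fin d) × EuclideanSpace ℝ (Fin d)) :=
    (hT.cont.comp h1).prodMk
      ((hT.cont_fderiv.comp h1).clm_apply ((continuous_snd.comp hh).comp continuous_snd))
  refine (hh'.comp h2).congr fun q => ?_
  simp only [Function.comp_apply, tangentMap, mfderiv_eq_fderiv]
  rfl

lemma tangentMap_eq_of_eventuallyEq {f g : M → M} {v : TangentBundle (𝓡 d) M}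
    (h : f =ᶠ[𝓝 v.1] g) : tangentMap (𝓡 d) (𝓡 d) f v = tangentMap (𝓡 d) (𝓡 d) g v := by
  have key (a b : M) (hab : a = b) (u w : EuclideanSpace ℝ (Fin d)) (huw : u = w) :
      (⟨a, u⟩ : TangentBundle (𝓡 d) M) = ⟨b, w⟩ := by rw [hab, huw]
  refine key _ _ h.eq_of_nhds _ _ ?_
  exact congrArg (fun L : EuclideanSpace ℝ (Fin d) →L[ℝ] EuclideanSpace ℝ (Fin d) => L v.2)
    h.mfderiv_eq

open Classical in
/-- The self-map of a manifold that in the chart at `x₀` is given by `τ`, and the identity outside the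
domain of the chart. -/
noncomputable def transplant (d : ℕ) {M : Type*} [TopologicalSpace M]
    [ChartedSpace (EuclideanSpace ℝ (Fin d)) M] (x₀ : M)
    (τ : EuclideanSpace ℝ (Fin d) → EuclideanSpace ℝ (Fin d)) (x : M) : M :=
  if x ∈ (extChartAt (𝓡 d) x₀).source then (extChartAt (𝓡 d) x₀).symm (τ (extChartAt (𝓡 d) x₀ x)) else x

variable {x₀ : M} {K : Set (EuclideanSpace ℝ (Fin d))}
  {τ : EuclideanSpace ℝ (Fin d) → EuclideanSpace ℝ (Fin d)}

/-- If `τ y` left `A`, it would be fixed by `τ`, and injectivity would give `τ y = y`, a point of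
`A`. -/
lemma mapsTo_of_eq_id {α : Type*} {τ : α → α} {K : Set α} (hinj : Function.Injective τ)
    (hid : ∀ y ∉ K, τ y = y) {A : Set α} (hKA : K ⊆ A) : Set.MapsTo τ A A := by
  intro y hy
  by_contra h
  have h1 := hid (τ y) fun h' => h (hKA h')
  rw [hinj h1] at h
  exact h hy

lemma transplant_of_mem {x : M} (hx : x ∈ (extChartAt (𝓡 d) x₀).source) :
    transplant d x₀ τ x = (extChartAt (𝓡 d) x₀).symm (τ (extChartAt (𝓡 d) x₀ x)) := if_pos hx

lemma transplant_of_notMem (hid : ∀ y ∉ K, τ y = y) {x : M}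
    (hx : x ∉ (extChartAt (𝓡 d) x₀).symm '' K) : transplant d x₀ τ x = x := by
  by_cases h : x ∈ (extChartAt (𝓡 d) x₀).source
  · rw [transplant_of_mem h, hid, (extChartAt (𝓡 d) x₀).left_inv h]
    exact fun h' => hx ⟨_, h', (extChartAt (𝓡 d) x₀).left_inv h⟩
  · exact if_neg h

lemma transplant_comp {τ' : EuclideanSpace ℝ (Fin d) → EuclideanSpace ℝ (Fin d)}
    (hmt : Set.MapsTo τ (extChartAt (𝓡 d) x₀).target (extChartAt (𝓡 d) x₀).target)
    (h : ∀ y, τ' (τ y) = y) (x : M) : transplant d x₀ τ' (transplant d x₀ τ x) = x := by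
  by_cases hx : x ∈ (extChartAt (𝓡 d) x₀).source
  · have h1 := hmt ((extChartAt (𝓡 d) x₀).map_source hx)
    rw [transplant_of_mem hx, transplant_of_mem ((extChartAt (𝓡 d) x₀).map_target h1),
      (extChartAt (𝓡 d) x₀).right_inv h1, h, (extChartAt (𝓡 d) x₀).left_inv hx]
  · have h1 (τ) : transplant d x₀ τ x = x := if_neg hx
    rw [h1, h1]

variable [T2Space M]

lemma isClosed_chart_image (hK : IsCompact K) (hKt : K ⊆ (extChartAt (𝓡 d) x₀).target) :
    IsClosed ((extChartAt (𝓡 d) x₀).symm '' K) :=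
  (hK.image_of_continuousOn ((continuousOn_extChartAt_symm x₀).mono hKt)).isClosed

lemma contMDiff_transplant (hK : IsCompact K) (hKt : K ⊆ (extChartAt (𝓡 d) x₀).target)
    (hτ : ContDiff ℝ ∞ τ) (hinj : Function.Injective τ) (hid : ∀ y ∉ K, τ y = y) :
    ContMDiff (𝓡 d) (𝓡 d) ∞ (transplant d x₀ τ) := by
  intro x
  by_cases hx : x ∈ (extChartAt (𝓡 d) x₀).source
  · have ho := isOpen_extChartAt_source (I := 𝓡 d) x₀
    have h1 : ContMDiffOn (𝓡 d) (𝓡 d) ∞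
        ((extChartAt (𝓡 d) x₀).symm ∘ τ ∘ extChartAt (𝓡 d) x₀) (extChartAt (𝓡 d) x₀).source := by
      refine (contMDiffOn_extChartAt_symm x₀).comp
        (hτ.contMDiff.comp_contMDiffOn (f := extChartAt (𝓡 d) x₀) ?_) ?_
      · rw [extChartAt_source]
        exact contMDiffOn_extChartAt
      · exact fun y hy => mapsTo_of_eq_id hinj hid hKt ((extChartAt (𝓡 d) x₀).map_source hy)
    refine (h1.contMDiffAt (ho.mem_nhds hx)).congr_of_eventuallyEq ?_
    filter_upwards [ho.mem_nhds hx] with y hy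
    exact transplant_of_mem hy
  · have hx' : x ∈ ((extChartAt (𝓡 d) x₀).symm '' K)ᶜ := by
      rintro ⟨z, hz, rfl⟩
      exact hx ((extChartAt (𝓡 d) x₀).map_target (hKt hz))
    refine contMDiffAt_id.congr_of_eventuallyEq ?_
    filter_upwards [(isClosed_chart_image hK hKt).isOpen_compl.mem_nhds hx'] with y hy
    exact transplant_of_notMem hid hy

/-- Over the chart domain the tangent map is a composition through the chart. Any other point lies
off the closed image of `K`, where the map is the identity for all parameters at once. -/
lemma continuous_tangentMap_transplant (hK : IsCompact K) (hKt : K ⊆ (extChartAt (𝓡 d) x₀).target)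
    {T : P → EuclideanSpace ℝ (Fin d) → EuclideanSpace ℝ (Fin d)} (hT : IsC1Fam T)
    (hinj : ∀ p, Function.Injective (T p)) (hid : ∀ p, ∀ y ∉ K, T p y = y) :
    Continuous fun q : P × TangentBundle (𝓡 d) M =>
      tangentMap (𝓡 d) (𝓡 d) (transplant d x₀ (T q.1)) q.2 := by
  set φ := extChartAt (𝓡 d) x₀ with hφ
  have hproj : Continuous fun v : TangentBundle (𝓡 d) M => v.1 := FiberBundle.continuous_proj _ _
  have hos : IsOpen φ.source := isOpen_extChartAt_source x₀
  have hot : IsOpen φ.target := isOpen_extChartAt_target x₀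
  have hmt (p : P) : Set.MapsTo (T p) φ.target φ.target := mapsTo_of_eq_id (hinj p) (hid p) hKt
  have hφm : ContMDiffOn (𝓡 d) (𝓡 d) ∞ φ φ.source := by
    rw [hφ, extChartAt_source]; exact contMDiffOn_extChartAt
  have hψm : ContMDiffOn (𝓡 d) (𝓡 d) ∞ φ.symm φ.target := contMDiffOn_extChartAt_symm x₀
  have hA : ContinuousOn (tangentMap (𝓡 d) (𝓡 d) φ)
      {v : TangentBundle (𝓡 d) M | v.1 ∈ φ.source} :=
    (hφm.continuousOn_tangentMapWithin (by simp) hos.uniqueMDiffOn).congr fun v hv =>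
      (tangentMapWithin_eq_tangentMap (hos.uniqueMDiffWithinAt hv)
        ((hφm.contMDiffAt (hos.mem_nhds hv)).mdifferentiableAt (by simp))).symm
  have hC : ContinuousOn (tangentMap (𝓡 d) (𝓡 d) φ.symm)
      {v : TangentBundle (𝓡 d) (EuclideanSpace ℝ (Fin d)) | v.1 ∈ φ.target} :=
    (hψm.continuousOn_tangentMapWithin (by simp) hot.uniqueMDiffOn).congr fun v hv =>
      (tangentMapWithin_eq_tangentMap (hot.uniqueMDiffWithinAt hv)
        ((hψm.contMDiffAt (hot.mem_nhds hv)).mdifferentiableAt (by simp))).symm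
  rw [continuous_iff_continuousAt]
  rintro ⟨p, v⟩
  by_cases hv : v.1 ∈ φ.source
  · have hv' : {w : TangentBundle (𝓡 d) M | w.1 ∈ φ.source} ∈ 𝓝 v :=
      hproj.continuousAt.eventually_mem (hos.mem_nhds hv)
    have h1 : ContinuousAt (fun q : P × TangentBundle (𝓡 d) M =>
        tangentMap (𝓡 d) (𝓡 d) φ q.2) (p, v) :=
      (hA.continuousAt hv').comp_of_eq continuousAt_snd rfl
    have h2 : ContinuousAt (fun q : P × TangentBundle (𝓡 d) M =>
        tangentMap (𝓡 d) (𝓡 d) (T q.1) (tangentMap (𝓡 d) (𝓡 d) φ q.2)) (p, v) :=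
      hT.continuous_tangentMap.continuousAt.comp_of_eq (continuousAt_fst.prodMk h1) rfl
    have hpE : Continuous fun w : TangentBundle (𝓡 d) (EuclideanSpace ℝ (Fin d)) => w.1 :=
      FiberBundle.continuous_proj _ _
    have h3 : ContinuousAt (fun q : P × TangentBundle (𝓡 d) M => tangentMap (𝓡 d) (𝓡 d) φ.symm
        (tangentMap (𝓡 d) (𝓡 d) (T q.1) (tangentMap (𝓡 d) (𝓡 d) φ q.2))) (p, v) := by
      refine ContinuousAt.comp_of_eq (hC.continuousAt ?_) h2 rfl
      exact hpE.continuousAt.eventually_mem (hot.mem_nhds (hmt p (φ.map_source hv)))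
    refine h3.congr ?_
    filter_upwards [continuousAt_snd.eventually_mem hv'] with q hq
    have hq : q.2.1 ∈ φ.source := hq
    have e1 : MDifferentiableAt (𝓡 d) (𝓡 d) φ q.2.1 :=
      (hφm.contMDiffAt (hos.mem_nhds hq)).mdifferentiableAt (by simp)
    have e2 : MDifferentiableAt (𝓡 d) (𝓡 d) (T q.1) (φ q.2.1) :=
      (hT.smooth q.1).contMDiff.mdifferentiable (by simp) _
    have e3 : MDifferentiableAt (𝓡 d) (𝓡 d) φ.symm (T q.1 (φ q.2.1)) :=
      (hψm.contMDiffAt (hot.mem_nhds (hmt _ (φ.map_source hq)))).mdifferentiableAt (by simp)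
    rw [← tangentMap_comp_at q.2 e2 e1, ← tangentMap_comp_at q.2 e3 (e2.comp _ e1)]
    have heq : transplant d x₀ (T q.1) =ᶠ[𝓝 q.2.1] φ.symm ∘ T q.1 ∘ φ := by
      filter_upwards [hos.mem_nhds hq] with y hy
      exact transplant_of_mem hy
    exact (tangentMap_eq_of_eventuallyEq heq).symm
  · have hv' : v.1 ∈ (φ.symm '' K)ᶜ := by
      rintro ⟨z, hz, h⟩
      exact hv (h ▸ φ.map_target (hKt hz))
    refine continuousAt_snd.congr ?_
    filter_upwards [(hproj.comp continuous_snd).continuousAt.eventually_mem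
      ((isClosed_chart_image hK hKt).isOpen_compl.mem_nhds hv')] with q hq
    have heq : transplant d x₀ (T q.1) =ᶠ[𝓝 q.2.1] id := by
      filter_upwards [(isClosed_chart_image hK hKt).isOpen_compl.mem_nhds hq] with y hy
      exact transplant_of_notMem (hid q.1) hy
    rw [tangentMap_eq_of_eventuallyEq heq, tangentMap_id]
    rfl

/-- The family of diffeomorphisms transplanted from a family of diffeomorphisms of Euclidean space. -/
lemma exists_isC1Family_transplant (hK : IsCompact K) (hKt : K ⊆ (extChartAt (𝓡 d) x₀).target)
    {T T' : P → EuclideanSpace ℝ (Fin d) → EuclideanSpace ℝ (Fin d)} (hT : IsC1Fam T)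
    (hT' : IsC1Fam T') (hl : ∀ p y, T' p (T p y) = y) (hr : ∀ p y, T p (T' p y) = y)
    (hid : ∀ p, ∀ y ∉ K, T p y = y) (r : ℕ∞) :
    ∃ G : P → Diffeomorph (𝓡 d) (𝓡 d) M M r, IsC1Family G ∧ (IsC1Family fun p => (G p).symm) ∧
      ∀ p, ⇑(G p) = transplant d x₀ (T p) := by
  have hinj (p : P) : Function.Injective (T p) := Function.LeftInverse.injective (hl p)
  have hinj' (p : P) : Function.Injective (T' p) := Function.LeftInverse.injective (hr p)
  have hid' (p : P) (y : EuclideanSpace ℝ (Fin d)) (hy : y ∉ K) : T' p y = y := by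
    conv_lhs => rw [← hid p y hy]
    exact hl p y
  have hle : (r : WithTop ℕ∞) ≤ ∞ := by exact_mod_cast le_top
  refine ⟨fun p =>
    { toFun := transplant d x₀ (T p)
      invFun := transplant d x₀ (T' p)
      left_inv := transplant_comp (mapsTo_of_eq_id (hinj p) (hid p) hKt) (hl p)
      right_inv := transplant_comp (mapsTo_of_eq_id (hinj' p) (hid' p) hKt) (hr p)
      contMDiff_toFun := (contMDiff_transplant hK hKt (hT.smooth p) (hinj p) (hid p)).of_le hle
      contMDiff_invFun := (contMDiff_transplant hK hKt (hT'.smooth p) (hinj' p) (hid' p)).of_le hle },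
    continuous_tangentMap_transplant hK hKt hT hinj hid,
    continuous_tangentMap_transplant hK hKt hT' hinj' hid', fun p => rfl⟩

end Transplant

/-! ### Measures with a density in a chart -/

section ChartDensity
set_option linter.unusedSectionVars false
open Filter Topology

variable {d : ℕ} {M : Type*} [TopologicalSpace M]
    [ChartedSpace (EuclideanSpace ℝ (Fin d)) M] [MeasurableSpace M]

/-- The measure `μ` has density `ρ` in the chart at `x₀`. -/
structure IsChartDensity (μ : Measure M) (x₀ : M) (ρ : EuclideanSpace ℝ (Fin d) → ℝ) : Prop where
  smooth : ContDiffOn ℝ ∞ ρ (extChartAt (𝓡 d) x₀).target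
  pos : ∀ y ∈ (extChartAt (𝓡 d) x₀).target, 0 < ρ y
  measure_eq : ∀ s : Set M, MeasurableSet s → s ⊆ (extChartAt (𝓡 d) x₀).source →
      μ s = ∫⁻ y in extChartAt (𝓡 d) x₀ '' s, ENNReal.ofReal (ρ y)

variable [BorelSpace M] {μ : Measure M} {x₀ : M} {ρ : EuclideanSpace ℝ (Fin d) → ℝ}

lemma measurableSet_extChartAt_image {s : Set M} (hs : MeasurableSet s)
    (hsub : s ⊆ (extChartAt (𝓡 d) x₀).source) : MeasurableSet (extChartAt (𝓡 d) x₀ '' s) := by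
  have h1 : extChartAt (𝓡 d) x₀ '' s =
      Subtype.val '' ((extChartAt (𝓡 d) x₀).target.domRestrict (extChartAt (𝓡 d) x₀).symm ⁻¹' s) := by
    ext y
    constructor
    · rintro ⟨x, hx, rfl⟩
      exact ⟨⟨_, (extChartAt (𝓡 d) x₀).map_source (hsub hx)⟩,
        show (extChartAt (𝓡 d) x₀).symm (extChartAt (𝓡 d) x₀ x) ∈ s by
          rwa [(extChartAt (𝓡 d) x₀).left_inv (hsub hx)], rfl⟩
    · rintro ⟨⟨y, hy⟩, hys, rfl⟩
      exact ⟨_, hys, (extChartAt (𝓡 d) x₀).right_inv hy⟩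
  rw [h1]
  exact ((isOpen_extChartAt_target x₀).measurableSet).subtype_image
    ((continuousOn_extChartAt_symm x₀).domRestrict.measurable hs)

namespace IsChartDensity

lemma aemeasurable (h : IsChartDensity μ x₀ ρ) {A : Set (EuclideanSpace ℝ (Fin d))}
    (hA : MeasurableSet A) (hAt : A ⊆ (extChartAt (𝓡 d) x₀).target) :
    AEMeasurable (fun y => ENNReal.ofReal (ρ y)) (volume.restrict A) :=
  ((h.smooth.continuousOn.mono hAt).aemeasurable hA).ennreal_ofReal

/-- This upgrades the formula for measures of sets to an identity of measures, through which
integrals of functions can be transported to the chart. -/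
lemma restrict_eq (h : IsChartDensity μ x₀ ρ) {s : Set M} (hs : MeasurableSet s)
    (hsub : s ⊆ (extChartAt (𝓡 d) x₀).source) : μ.restrict s =
      ((volume.restrict (extChartAt (𝓡 d) x₀ '' s)).withDensity
        fun y => ENNReal.ofReal (ρ y)).map (extChartAt (𝓡 d) x₀).symm := by
  have hA := measurableSet_extChartAt_image hs hsub
  have hAt : extChartAt (𝓡 d) x₀ '' s ⊆ (extChartAt (𝓡 d) x₀).target := by
    rintro _ ⟨x, hx, rfl⟩
    exact (extChartAt (𝓡 d) x₀).map_source (hsub hx)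
  have hm : AEMeasurable (extChartAt (𝓡 d) x₀).symm
      ((volume.restrict (extChartAt (𝓡 d) x₀ '' s)).withDensity fun y => ENNReal.ofReal (ρ y)) :=
    (((continuousOn_extChartAt_symm x₀).mono hAt).aemeasurable hA).mono_ac
      (withDensity_absolutelyContinuous _ _)
  ext t ht
  rw [Measure.restrict_apply ht, Measure.map_apply_of_aemeasurable hm ht, withDensity_apply' _ _,
    Measure.restrict_restrict' hA, h.measure_eq _ (ht.inter hs) (Set.inter_subset_right.trans hsub)]
  congr 2
  ext y
  constructor
  · rintro ⟨x, ⟨hx1, hx2⟩, rfl⟩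
    exact ⟨by rwa [Set.mem_preimage, (extChartAt (𝓡 d) x₀).left_inv (hsub hx2)], ⟨x, hx2, rfl⟩⟩
  · rintro ⟨hx1, ⟨x, hx2, rfl⟩⟩
    rw [Set.mem_preimage, (extChartAt (𝓡 d) x₀).left_inv (hsub hx2)] at hx1
    exact ⟨x, ⟨hx1, hx2⟩, rfl⟩

lemma setLIntegral_eq (h : IsChartDensity μ x₀ ρ) {s : Set M} (hs : MeasurableSet s)
    (hsub : s ⊆ (extChartAt (𝓡 d) x₀).source) {f : M → ENNReal}
    (hf : AEMeasurable f (μ.restrict s)) :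
    ∫⁻ x in s, f x ∂μ = ∫⁻ y in extChartAt (𝓡 d) x₀ '' s,
      ENNReal.ofReal (ρ y) * f ((extChartAt (𝓡 d) x₀).symm y) := by
  have hA := measurableSet_extChartAt_image hs hsub
  have hAt : extChartAt (𝓡 d) x₀ '' s ⊆ (extChartAt (𝓡 d) x₀).target := by
    rintro _ ⟨x, hx, rfl⟩
    exact (extChartAt (𝓡 d) x₀).map_source (hsub hx)
  have hm : AEMeasurable (extChartAt (𝓡 d) x₀).symm
      ((volume.restrict (extChartAt (𝓡 d) x₀ '' s)).withDensity fun y => ENNReal.ofReal (ρ y)) :=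
    (((continuousOn_extChartAt_symm x₀).mono hAt).aemeasurable hA).mono_ac
      (withDensity_absolutelyContinuous _ _)
  rw [h.restrict_eq hs hsub] at hf ⊢
  rw [lintegral_map' hf hm]
  exact lintegral_withDensity_eq_lintegral_mul₀' (h.aemeasurable hA hAt) (hf.comp_aemeasurable hm)

end IsChartDensity

end ChartDensity

/-! ### Realizing one elementary change of density -/

section ElementaryStep
set_option linter.unusedSectionVars false
open Filter Topology

variable {d : ℕ} {M : Type*} [TopologicalSpace M] [T2Space M]
    [ChartedSpace (EuclideanSpace ℝ (Fin d)) M] [IsManifold (𝓡 d) ∞ M] [MeasurableSpace M]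
    [BorelSpace M] {μ : Measure M} {x₀ : M} {ρ : EuclideanSpace ℝ (Fin d) → ℝ}
    {P : Type*} [TopologicalSpace P] [CompactSpace P]

lemma exists_cutoff {E : Type*} [NormedAddCommGroup E] [NormedSpace ℝ E] [FiniteDimensional ℝ E]
    {K U : Set E} (hK : IsCompact K) (hU : IsOpen U) (hKU : K ⊆ U) :
    ∃ (χ : E → ℝ) (L : Set E), ContDiff ℝ ∞ χ ∧ IsCompact L ∧ L ⊆ U ∧ K ⊆ L ∧ (∀ y ∈ K, χ y = 1) ∧
      (∀ y ∉ L, χ y = 0) ∧ ∀ y, χ y ∈ Set.Icc (0 : ℝ) 1 := by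
  obtain ⟨L, hL, hKL, hLU⟩ := exists_compact_between hK hU hKU
  obtain ⟨f, hf0, hf1, hf⟩ := exists_contMDiffMap_zero_one_of_isClosed (n := ⊤) 𝓘(ℝ, E)
    (s := (interior L)ᶜ) (t := K) isOpen_interior.isClosed_compl hK.isClosed
    (Set.disjoint_left.2 fun y hy hyK => hy (hKL hyK))
  exact ⟨f, L, f.contMDiff.contDiff, hL, hLU, hKL.trans interior_subset, hf1,
    fun y hy => hf0 fun h => hy (interior_subset h), hf⟩

lemma exists_pos_le_of_eq_one {E : Type*} [TopologicalSpace E] {L : Set E} (hL : IsCompact L)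
    {F : P → E → ℝ} (hF : Continuous fun q : P × E => F q.1 q.2) (hpos : ∀ p y, 0 < F p y)
    (h1 : ∀ p, ∀ y ∉ L, F p y = 1) : ∃ c : ℝ, 0 < c ∧ ∀ p y, c ≤ F p y := by
  obtain ⟨c, hc, h⟩ := (isCompact_univ (X := P)).prod hL |>.exists_forall_le' (a := 0)
    hF.continuousOn fun q _ => hpos q.1 q.2
  refine ⟨min c 1, lt_min hc one_pos, fun p y => ?_⟩
  by_cases hy : y ∈ L
  · exact (min_le_left _ _).trans (h (p, y) ⟨trivial, hy⟩)
  · rw [h1 p y hy]; exact min_le_right _ _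

variable [FirstCountableTopology P] [LocallyCompactSpace P]

/-- In the chart the two Lebesgue densities are `W * ρ` and `W * ρ + e`, with equal integrals along
the `j`-lines. Line transport carries one to the other and is the identity off the cube, so it can
be transplanted to `M`. -/
theorem exists_diffeo_elementary (hρ : IsChartDensity μ x₀ ρ) {c : EuclideanSpace ℝ (Fin d)} {a : ℝ}
    (hcube : cube c a ⊆ (extChartAt (𝓡 d) x₀).target) {j : Fin d}
    {e : P → EuclideanSpace ℝ (Fin d) → ℝ} (he : IsLineZero c a j e) {W W' : P → M → ℝ}
    (hW : IsC1FamM d W) (hW' : Continuous fun q : P × M => W' q.1 q.2)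
    (hWW' : ∀ p, ∀ x ∈ (extChartAt (𝓡 d) x₀).source, W' p x = W p x +
      e p (extChartAt (𝓡 d) x₀ x) / ρ (extChartAt (𝓡 d) x₀ x))
    (hWW'' : ∀ p, ∀ x ∉ (extChartAt (𝓡 d) x₀).source, W' p x = W p x)
    (hWpos : ∀ p x, 0 < W p x) (hWpos' : ∀ p x, 0 < W' p x) (r : ℕ∞) :
    ∃ G : P → Diffeomorph (𝓡 d) (𝓡 d) M M r, IsC1Family G ∧ (IsC1Family fun p => (G p).symm) ∧
      ∀ p, MeasurePreserving (G p) (μ.withDensity fun x => ENNReal.ofReal (W p x))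
        (μ.withDensity fun x => ENNReal.ofReal (W' p x)) := by
  set φ := extChartAt (𝓡 d) x₀ with hφ
  have hot : IsOpen φ.target := isOpen_extChartAt_target x₀
  obtain ⟨χ, L, hχ, hL, hLt, hKL, hχ1, hχ0, hχI⟩ := exists_cutoff (isCompact_cube c a) hot hcube
  set f : P → EuclideanSpace ℝ (Fin d) → ℝ := fun p y => W p (φ.symm y) * ρ y with hf
  have hfOn : IsC1FamOn f φ.target := (hW x₀).mul (.of_contDiffOn hot hρ.smooth) hot
  have hfpos (p : P) (y) (hy : y ∈ φ.target) : 0 < f p y := mul_pos (hWpos _ _) (hρ.pos y hy)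
  have hhOn : IsC1FamOn (fun p y => χ y * (f p y - 1)) φ.target :=
    ((IsC1Fam.of_contDiff hχ).on _).mul (hfOn.sub ((IsC1Fam.of_contDiff contDiff_const).on _) hot) hot
  have hhFam := hhOn.indicator hot hL.isClosed hLt fun p y _ hy => by rw [hχ0 y hy, zero_mul]
  -- The density `f` makes sense only on the chart target. Interpolation with 1 by the cutoff gives
  -- a positive function on the whole space, unchanged on the cube and equal to 1 off a compact set.
  set m : P → EuclideanSpace ℝ (Fin d) → ℝ :=
    fun p y => 1 + φ.target.indicator (fun y => χ y * (f p y - 1)) y with hm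
  have hmfam : IsC1Fam m := (IsC1Fam.of_contDiff contDiff_const).add hhFam
  have hm1 (p : P) (y) (hy : y ∉ L) : m p y = 1 := by
    simp only [hm]
    by_cases hyt : y ∈ φ.target
    · rw [Set.indicator_of_mem hyt, hχ0 y hy]; ring
    · rw [Set.indicator_of_notMem hyt, add_zero]
  have hmpos (p : P) (y) : 0 < m p y := by
    simp only [hm]
    by_cases hyt : y ∈ φ.target
    · rw [Set.indicator_of_mem hyt]
      have h1 := hfpos p y hyt
      obtain ⟨h2, h3⟩ := hχI y
      rcases h2.eq_or_lt with h2 | h2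
      · rw [← h2]; norm_num
      · nlinarith [mul_pos h2 h1]
    · rw [Set.indicator_of_notMem hyt]; norm_num
  have hmf (p : P) (y) (hy : y ∈ cube c a) : m p y = f p y := by
    simp only [hm]
    rw [Set.indicator_of_mem (hcube hy), hχ1 y hy]; ring
  set m' : P → EuclideanSpace ℝ (Fin d) → ℝ := fun p y => m p y + e p y with hm'
  have hmfam' : IsC1Fam m' := hmfam.add he.fam
  have hmf' (p : P) (y) (hy : y ∈ cube c a) : m' p y = W' p (φ.symm y) * ρ y := by
    simp only [hm', hmf p y hy, hf]
    rw [hWW' p _ (φ.map_target (hcube hy)), φ.right_inv (hcube hy)]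
    have := (hρ.pos y (hcube hy)).ne'
    field_simp
  have hm'1 (p : P) (y) (hy : y ∉ L) : m' p y = 1 := by
    simp only [hm', hm1 p y hy, he.supp p y fun h => hy (hKL h), add_zero]
  have hmpos' (p : P) (y) : 0 < m' p y := by
    by_cases hy : y ∈ cube c a
    · rw [hmf' p y hy]
      exact mul_pos (hWpos' _ _) (hρ.pos y (hcube hy))
    · simp only [hm', he.supp p y hy, add_zero]
      exact hmpos p y
  obtain ⟨c₁, hc₁, hcm⟩ := exists_pos_le_of_eq_one hL hmfam.cont hmpos hm1
  obtain ⟨c₂, hc₂, hcm'⟩ := exists_pos_le_of_eq_one hL hmfam'.cont hmpos' hm'1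
  obtain ⟨T, T', hT, hT', hTl, hTr, hTid, hTvol⟩ := exists_isC1Fam_line_transport
    (μ := (volume : Measure (EuclideanSpace ℝ (Fin d)))) (ℓ := EuclideanSpace.proj j)
    (proj_single_self j) hmfam hmfam' (lt_min hc₁ hc₂)
    (fun p y => (min_le_left _ _).trans (hcm p y)) (fun p y => (min_le_right _ _).trans (hcm' p y))
    (l := c j - a) (r := c j + a)
    (fun p y hy => by
      simp only [hm', add_eq_left]
      refine he.supp p y fun h => hy ?_
      obtain ⟨h1, h2⟩ := abs_le.1 (h j)
      exact ⟨by change _ ≤ y j; linarith, by change y j ≤ _; linarith⟩)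
    (fun p y => by simp only [hm', add_sub_cancel_left]; exact he.integral p y)
  have hid (p : P) (y) (hy : y ∉ cube c a) : T p y = y := by
    apply hTid
    have : ∃ i, a < |y i - c i| := by simpa [cube] using hy
    obtain ⟨i, hi⟩ := this
    rcases eq_or_ne i j with rfl | hij
    · left
      rintro ⟨h1, h2⟩
      have h1 : c i - a ≤ y i := h1
      have h2 : y i ≤ c i + a := h2
      exact not_le.2 hi (abs_le.2 ⟨by linarith, by linarith⟩)
    · right
      intro s
      simp only [hm', add_eq_left]
      refine he.supp p _ fun h => not_le.2 hi ?_
      have := h i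
      rwa [← updCoord, updCoord_of_ne hij] at this
  have hinj (p : P) : Function.Injective (T p) := Function.LeftInverse.injective (hTl p)
  obtain ⟨G, hG, hG', hGT⟩ :=
    exists_isC1Family_transplant (isCompact_cube c a) hcube hT hT' hTl hTr hid r
  refine ⟨G, hG, hG', fun p => ?_⟩
  have hGm : Measurable (G p) := (G p).continuous.measurable
  have hWm : Measurable fun x => ENNReal.ofReal (W p x) :=
    (hW.continuous.comp (continuous_const.prodMk continuous_id)).measurable.ennreal_ofReal
  have hWm' : Measurable fun x => ENNReal.ofReal (W' p x) :=
    (hW'.comp (continuous_const.prodMk continuous_id)).measurable.ennreal_ofReal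
  refine ⟨hGm, ?_⟩
  have hKc : MeasurableSet (φ.symm '' cube c a) :=
    (isClosed_chart_image (isCompact_cube c a) hcube).measurableSet
  have hKsub : φ.symm '' cube c a ⊆ φ.source := by
    rintro _ ⟨y, hy, rfl⟩
    exact φ.map_target (hcube hy)
  have hφK {x : M} (hx : x ∈ φ.symm '' cube c a) : φ x ∈ cube c a := by
    obtain ⟨y, hy, rfl⟩ := hx
    rwa [φ.right_inv (hcube hy)]
  have hGid (x : M) (hx : x ∉ φ.symm '' cube c a) : G p x = x := by
    rw [hGT]; exact transplant_of_notMem (hid p) hx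
  have hGφ {x : M} (hx : x ∈ φ.symm '' cube c a) : G p x = φ.symm (T p (φ x)) := by
    rw [hGT]; exact transplant_of_mem (hKsub hx)
  have hTK : Set.MapsTo (T p) (cube c a) (cube c a) := mapsTo_of_eq_id (hinj p) (hid p) le_rfl
  have hGK {x : M} (hx : x ∈ φ.symm '' cube c a) : G p x ∈ φ.symm '' cube c a := by
    rw [hGφ hx]
    exact ⟨_, hTK (hφK hx), rfl⟩
  have hWeq (x : M) (hx : x ∉ φ.symm '' cube c a) : W' p x = W p x := by
    by_cases hxs : x ∈ φ.source
    · rw [hWW' p x hxs, he.supp, zero_div, add_zero]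
      exact fun h => hx ⟨_, h, φ.left_inv hxs⟩
    · exact hWW'' p x hxs
  -- the part of the set inside the cube
  have hin (s : Set M) (hs : MeasurableSet s) (hsK : s ⊆ φ.symm '' cube c a) :
      ∫⁻ x in G p '' s, ENNReal.ofReal (W' p x) ∂μ = ∫⁻ x in s, ENNReal.ofReal (W p x) ∂μ := by
    have hGs : MeasurableSet (G p '' s) := by
      rw [show G p '' s = (G p).symm ⁻¹' s from (G p).toEquiv.image_eq_preimage_symm s]
      exact (G p).symm.continuous.measurable hs
    have hGsK : G p '' s ⊆ φ.symm '' cube c a := by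
      rintro _ ⟨x, hx, rfl⟩
      exact hGK (hsK hx)
    have hsA : φ '' s ⊆ cube c a := by
      rintro _ ⟨x, hx, rfl⟩
      exact hφK (hsK hx)
    have himg : φ '' (G p '' s) = T p '' (φ '' s) := by
      rw [Set.image_image, Set.image_image]
      refine Set.image_congr fun x hx => ?_
      rw [hGφ (hsK hx), φ.right_inv (hcube (hTK (hφK (hsK hx))))]
    have hAm := measurableSet_extChartAt_image hs (hsK.trans hKsub)
    have hTAm : MeasurableSet (T p '' (φ '' s)) := himg ▸
      measurableSet_extChartAt_image hGs (hGsK.trans hKsub)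
    rw [hρ.setLIntegral_eq hs (hsK.trans hKsub) hWm.aemeasurable, hρ.setLIntegral_eq hGs (hGsK.trans hKsub) hWm'.aemeasurable]
    rw [← hφ, himg]
    have e1 : ∫⁻ y in T p '' (φ '' s), ENNReal.ofReal (ρ y) * ENNReal.ofReal (W' p (φ.symm y)) =
        ∫⁻ y in T p '' (φ '' s), ENNReal.ofReal (m' p y) := by
      refine setLIntegral_congr_fun hTAm fun y hy => ?_
      have hyc : y ∈ cube c a := by
        obtain ⟨z, hz, rfl⟩ := hy
        exact hTK (hsA hz)
      rw [hmf' p y hyc, ENNReal.ofReal_mul (hWpos' _ _).le, mul_comm]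
    have e2 : ∫⁻ y in φ '' s, ENNReal.ofReal (ρ y) * ENNReal.ofReal (W p (φ.symm y)) =
        ∫⁻ y in φ '' s, ENNReal.ofReal (m p y) := by
      refine setLIntegral_congr_fun hAm fun y hy => ?_
      rw [hmf p y (hsA hy), ENNReal.ofReal_mul (hWpos _ _).le, mul_comm]
    rw [e1, e2, hTvol p _ hAm]
  ext s hs
  rw [Measure.map_apply hGm hs, withDensity_apply _ (hGm hs), withDensity_apply _ hs,
    ← lintegral_inter_add_sdiff _ _ hKc, ← lintegral_inter_add_sdiff _ s hKc,
    ← hin _ ((hGm hs).inter hKc) Set.inter_subset_right]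
  have hGKimg : G p '' (G p ⁻¹' s ∩ φ.symm '' cube c a) = s ∩ φ.symm '' cube c a := by
    apply Set.Subset.antisymm
    · rintro _ ⟨x, ⟨hx, hxK⟩, rfl⟩
      exact ⟨hx, hGK hxK⟩
    · rintro x ⟨hx, hxK⟩
      obtain ⟨z, rfl⟩ : ∃ z, G p z = x := (G p).surjective x
      refine ⟨z, ⟨hx, ?_⟩, rfl⟩
      by_contra hz
      rw [hGid z hz] at hxK
      exact hz hxK
  -- Off the cube `G p` is the identity and the two weights agree, so that part of the set
  -- contributes equally.
  have hGKd : G p ⁻¹' s \ φ.symm '' cube c a = s \ φ.symm '' cube c a := by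
    ext x
    constructor <;> rintro ⟨hx, hxK⟩
    · rw [Set.mem_preimage, hGid x hxK] at hx
      exact ⟨hx, hxK⟩
    · refine ⟨?_, hxK⟩
      rwa [Set.mem_preimage, hGid x hxK]
  rw [hGKimg, hGKd]
  congr 1
  refine setLIntegral_congr_fun (hs.diff hKc) fun x hx => ?_
  simp only [hWeq x hx.2]

end ElementaryStep

/-! ### Cubes in charts -/

section ChartCubes
set_option linter.unusedSectionVars false
open Filter Topology

variable {d : ℕ} {M : Type*} [TopologicalSpace M] [ChartedSpace (EuclideanSpace ℝ (Fin d)) M]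

lemma isPreconnected_cube (c : EuclideanSpace ℝ (Fin d)) (a : ℝ) : IsPreconnected (cube c a) := by
  have : Convex ℝ (cube c a) := by
    intro y hy z hz s t hs ht hst i
    have h1 := hy i
    have h2 := hz i
    have : (s • y + t • z) i - c i = s * (y i - c i) + t * (z i - c i) := by
      simp only [PiLp.add_apply, PiLp.smul_apply, smul_eq_mul]
      linear_combination (c i) * hst
    rw [this]
    calc _ ≤ |s * (y i - c i)| + |t * (z i - c i)| := abs_add_le _ _
      _ = s * |y i - c i| + t * |z i - c i| := by rw [abs_mul, abs_mul, abs_of_nonneg hs, abs_of_nonneg ht]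
      _ ≤ s * a + t * a := by gcongr
      _ = a := by rw [← add_mul, hst, one_mul]
  exact this.isPreconnected

lemma cube_mem_nhds (c : EuclideanSpace ℝ (Fin d)) {a : ℝ} (ha : 0 < a) : cube c a ∈ 𝓝 c := by
  have : IsOpen {y : EuclideanSpace ℝ (Fin d) | ∀ i, |y i - c i| < a} := by
    simp only [Set.ofPred_forall]
    exact isOpen_iInter_of_finite fun i => isOpen_lt (by fun_prop) continuous_const
  exact mem_of_superset (this.mem_nhds (by simpa using fun _ => ha)) fun y hy i => (hy i).le

lemma exists_cube_subset {c : EuclideanSpace ℝ (Fin d)} {U : Set (EuclideanSpace ℝ (Fin d))}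
    (hU : U ∈ 𝓝 c) : ∃ a : ℝ, 0 < a ∧ cube c a ⊆ U := by
  have h1 : Tendsto (EuclideanSpace.equiv (Fin d) ℝ).symm (𝓝 (EuclideanSpace.equiv (Fin d) ℝ c)) (𝓝 c) := by
    have := (EuclideanSpace.equiv (Fin d) ℝ).symm.continuous.tendsto (EuclideanSpace.equiv (Fin d) ℝ c)
    rwa [ContinuousLinearEquiv.symm_apply_apply] at this
  obtain ⟨a, ha, h⟩ := Metric.nhds_basis_closedBall.mem_iff.1 (h1 hU)
  refine ⟨a, ha, fun y hy => ?_⟩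
  have : EuclideanSpace.equiv (Fin d) ℝ y ∈ Metric.closedBall (EuclideanSpace.equiv (Fin d) ℝ c) a :=
    (dist_pi_le_iff ha.le).2 hy
  simpa using h this

/-- The preimage in the manifold of a cube around the center of a chart. -/
def chartCube (d : ℕ) {M : Type*} [TopologicalSpace M] [ChartedSpace (EuclideanSpace ℝ (Fin d)) M]
    (x : M) (a : ℝ) : Set M :=
  (extChartAt (𝓡 d) x).symm '' cube (extChartAt (𝓡 d) x x) a

variable {x : M} {a : ℝ}

lemma chartCube_subset_source (h : cube (extChartAt (𝓡 d) x x) a ⊆ (extChartAt (𝓡 d) x).target) :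
    chartCube d x a ⊆ (extChartAt (𝓡 d) x).source := by
  rintro _ ⟨y, hy, rfl⟩
  exact (extChartAt (𝓡 d) x).map_target (h hy)

lemma extChartAt_image_chartCube
    (h : cube (extChartAt (𝓡 d) x x) a ⊆ (extChartAt (𝓡 d) x).target) :
    extChartAt (𝓡 d) x '' chartCube d x a = cube (extChartAt (𝓡 d) x x) a := by
  rw [chartCube, Set.image_image]
  exact (Set.image_congr fun y hy => (extChartAt (𝓡 d) x).right_inv (h hy)).trans (Set.image_id' _)

lemma isPreconnected_chartCube
    (h : cube (extChartAt (𝓡 d) x x) a ⊆ (extChartAt (𝓡 d) x).target) :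
    IsPreconnected (chartCube d x a) :=
  (isPreconnected_cube _ _).image _ ((continuousOn_extChartAt_symm x).mono h)

lemma chartCube_mem_nhds (ha : 0 < a) : chartCube d x a ∈ 𝓝 x := by
  have h1 := (continuousAt_extChartAt (I := 𝓡 d) x).preimage_mem_nhds (cube_mem_nhds _ ha)
  filter_upwards [h1, extChartAt_source_mem_nhds (I := 𝓡 d) x] with y hy hys
  exact ⟨_, hy, (extChartAt (𝓡 d) x).left_inv hys⟩

/-- A function supported in a chart cube thus contributes to the integral over a single component.
-/
lemma chartCube_subset_connectedComponent (ha : 0 < a)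
    (h : cube (extChartAt (𝓡 d) x x) a ⊆ (extChartAt (𝓡 d) x).target) :
    chartCube d x a ⊆ connectedComponent x :=
  (isPreconnected_chartCube h).subset_connectedComponent (mem_of_mem_nhds (chartCube_mem_nhds ha))

variable [T2Space M] [IsManifold (𝓡 d) ∞ M] [MeasurableSpace M] [BorelSpace M] {μ : Measure M}

lemma isClosed_chartCube {x : M} {a : ℝ}
    (h : cube (extChartAt (𝓡 d) x x) a ⊆ (extChartAt (𝓡 d) x).target) :
    IsClosed (chartCube d x a) := isClosed_chart_image (isCompact_cube _ _) h

lemma IsChartDensity.setIntegral_eq {x : M} {ρ : EuclideanSpace ℝ (Fin d) → ℝ}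
    (h : IsChartDensity μ x ρ) {s : Set M} (hs : MeasurableSet s)
    (hsub : s ⊆ (extChartAt (𝓡 d) x).source) {f : M → ℝ} (hf : Continuous f) :
    ∫ z in s, f z ∂μ = ∫ y in extChartAt (𝓡 d) x '' s, ρ y * f ((extChartAt (𝓡 d) x).symm y) := by
  have hA := measurableSet_extChartAt_image hs hsub
  have hAt : extChartAt (𝓡 d) x '' s ⊆ (extChartAt (𝓡 d) x).target := by
    rintro _ ⟨x, hx, rfl⟩
    exact (extChartAt (𝓡 d) _).map_source (hsub hx)
  have hm : AEMeasurable (extChartAt (𝓡 d) x).symm (volume.restrict (extChartAt (𝓡 d) x '' s)) :=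
    ((continuousOn_extChartAt_symm x).mono hAt).aemeasurable hA
  rw [h.restrict_eq hs hsub, integral_map (hm.mono_ac (withDensity_absolutelyContinuous _ _))
    hf.aestronglyMeasurable, integral_withDensity_eq_integral_toReal_smul₀ (h.aemeasurable hA hAt)
    (by simp)]
  refine setIntegral_congr_fun hA fun y hy => ?_
  simp only [ENNReal.toReal_ofReal (h.pos y (hAt hy)).le, smul_eq_mul]

lemma isLocallyFiniteMeasure_of_isChartDensity {ρ : M → EuclideanSpace ℝ (Fin d) → ℝ}
    (h : ∀ x, IsChartDensity μ x (ρ x)) : IsLocallyFiniteMeasure μ := by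
  refine ⟨fun x => ?_⟩
  obtain ⟨a, ha, hat⟩ := exists_cube_subset
    ((isOpen_extChartAt_target (I := 𝓡 d) x).mem_nhds (mem_extChartAt_target x))
  refine ⟨chartCube d x a, chartCube_mem_nhds ha, ?_⟩
  rw [(h x).measure_eq _ (isClosed_chartCube hat).measurableSet
    (chartCube_subset_source hat), extChartAt_image_chartCube hat]
  have := ((h x).smooth.continuousOn.mono hat).integrableOn_compact (μ := volume)
    (isCompact_cube _ _)
  exact this.lintegral_lt_top

lemma isOpenPosMeasure_of_isChartDensity {ρ : M → EuclideanSpace ℝ (Fin d) → ℝ}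
    (h : ∀ x, IsChartDensity μ x (ρ x)) : μ.IsOpenPosMeasure := by
  refine ⟨fun U hU ⟨x, hx⟩ hμ => ?_⟩
  set φ := extChartAt (𝓡 d) x with hφ
  have hV : IsOpen (U ∩ φ.source) := hU.inter (isOpen_extChartAt_source x)
  have h1 : μ (U ∩ φ.source) = 0 := measure_mono_null Set.inter_subset_left hμ
  have himg : φ '' (U ∩ φ.source) = φ.target ∩ φ.symm ⁻¹' U := by
    ext y
    constructor
    · rintro ⟨z, ⟨hzU, hz⟩, rfl⟩
      exact ⟨φ.map_source hz, by rwa [Set.mem_preimage, φ.left_inv hz]⟩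
    · rintro ⟨hy, hyU⟩
      exact ⟨_, ⟨hyU, φ.map_target hy⟩, φ.right_inv hy⟩
  have hW : IsOpen (φ.target ∩ φ.symm ⁻¹' U) :=
    (continuousOn_extChartAt_symm x).isOpen_inter_preimage (isOpen_extChartAt_target x) hU
  rw [(h x).measure_eq _ hV.measurableSet Set.inter_subset_right, ← hφ, himg,
    lintegral_eq_zero_iff' ((h x).aemeasurable hW.measurableSet Set.inter_subset_left)] at h1
  have h2 : ∀ᵐ y ∂volume.restrict (φ.target ∩ φ.symm ⁻¹' U), False := by
    filter_upwards [h1, ae_restrict_mem hW.measurableSet] with y hy hyW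
    have := (h x).pos y hyW.1
    simp only [Pi.zero_apply, ENNReal.ofReal_eq_zero] at hy
    linarith
  rw [ae_iff] at h2
  simp only [not_false_eq_true] at h2
  have h3 : volume (φ.target ∩ φ.symm ⁻¹' U) = 0 := by
    simpa using h2
  exact (hW.measure_pos volume ⟨φ x, mem_extChartAt_target x,
    by rwa [Set.mem_preimage, hφ, extChartAt_to_inv]⟩).ne' h3

end ChartCubes

/-! ### Elementary families and their sums -/

section Decomposition
set_option linter.unusedSectionVars false
open Filter Topology

variable {d : ℕ} {M : Type*} [TopologicalSpace M] [T2Space M]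
    [ChartedSpace (EuclideanSpace ℝ (Fin d)) M] [IsManifold (𝓡 d) ∞ M] [MeasurableSpace M]
    [BorelSpace M] {P Q : Type*} [TopologicalSpace P] [TopologicalSpace Q]

/-- A family of functions on a manifold that in a chart, after multiplication with the density, is
supported in a cube and has zero integrals along the lines in a coordinate direction. -/
structure IsElementary (ρ : M → EuclideanSpace ℝ (Fin d) → ℝ) (x : M)
    (c : EuclideanSpace ℝ (Fin d)) (a : ℝ) (j : Fin d) (ε : P → M → ℝ) : Prop where
  subset : cube c a ⊆ (extChartAt (𝓡 d) x).target
  lift : ∃ e : P → EuclideanSpace ℝ (Fin d) → ℝ, IsLineZero c a j e ∧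
    ∀ p, ε p = (extChartAt (𝓡 d) x).source.indicator
      fun z => e p (extChartAt (𝓡 d) x z) / ρ x (extChartAt (𝓡 d) x z)

namespace IsElementary

variable {ρ : M → EuclideanSpace ℝ (Fin d) → ℝ} {x : M} {c : EuclideanSpace ℝ (Fin d)} {a : ℝ}
  {j : Fin d} {ε ε' : P → M → ℝ}

lemma reparam (h : IsElementary ρ x c a j ε) {f : Q → P} (hf : Continuous f) :
    IsElementary ρ x c a j fun q => ε (f q) := by
  obtain ⟨e, he, hε⟩ := h.lift
  exact ⟨h.subset, fun q => e (f q), he.reparam hf, fun q => hε (f q)⟩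

lemma isC1FamM (h : IsElementary ρ x c a j ε)
    (hρ : ContDiffOn ℝ ∞ (ρ x) (extChartAt (𝓡 d) x).target)
    (hpos : ∀ y ∈ (extChartAt (𝓡 d) x).target, 0 < ρ x y) : IsC1FamM d ε := by
  obtain ⟨e, he, hε⟩ := h.lift
  have hε' : ε = fun p => (extChartAt (𝓡 d) x).source.indicator
      fun z => e p (extChartAt (𝓡 d) x z) / ρ x (extChartAt (𝓡 d) x z) := funext hε
  rw [hε']
  have hot : IsOpen (extChartAt (𝓡 d) x).target := isOpen_extChartAt_target x
  refine IsC1FamM.indicator_chart x (g := fun p y => e p y / ρ x y) ?_ (isCompact_cube c a) h.subset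
    fun p y _ hy => by rw [he.supp p y hy, zero_div]
  simp only [div_eq_mul_inv]
  exact (he.fam.on _).mul (.of_contDiffOn hot (hρ.inv fun y hy => (hpos y hy).ne')) hot

variable [FirstCountableTopology P] [LocallyCompactSpace P]

lemma sub (h : IsElementary ρ x c a j ε) (h' : IsElementary ρ x c a j ε') :
    IsElementary ρ x c a j fun p z => ε p z - ε' p z := by
  obtain ⟨e, he, hε⟩ := h.lift
  obtain ⟨e', he', hε'⟩ := h'.lift
  refine ⟨h.subset, _, he.sub he', fun p => ?_⟩
  rw [hε, hε']
  classical
  ext z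
  simp only [Set.indicator_apply]
  split_ifs <;> ring

lemma smul {b : P → ℝ} (hb : Continuous b) (h : IsElementary ρ x c a j ε) :
    IsElementary ρ x c a j fun p z => b p * ε p z := by
  obtain ⟨e, he, hε⟩ := h.lift
  refine ⟨h.subset, _, he.smul hb, fun p => ?_⟩
  rw [hε]
  classical
  ext z
  simp only [Set.indicator_apply]
  split_ifs <;> ring

end IsElementary

/-- The finite sums of elementary families. -/
def elementarySums (P : Type*) [TopologicalSpace P] (ρ : M → EuclideanSpace ℝ (Fin d) → ℝ) :
    AddSubmonoid (P → M → ℝ) :=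
  AddSubmonoid.closure {ε | ∃ x c a j, IsElementary ρ x c a j ε}

variable [FirstCountableTopology P] [LocallyCompactSpace P] {ρ : M → EuclideanSpace ℝ (Fin d) → ℝ}
  {μ : Measure M}

lemma smul_mem_elementarySums {b : P → ℝ} (hb : Continuous b) {u : P → M → ℝ}
    (hu : u ∈ elementarySums P ρ) : (fun p z => b p * u p z) ∈ elementarySums P ρ := by
  induction hu using AddSubmonoid.closure_induction with
  | mem u hu =>
    obtain ⟨x, c, a, j, h⟩ := hu
    exact AddSubmonoid.subset_closure ⟨x, c, a, j, h.smul hb⟩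
  | zero =>
    convert zero_mem (elementarySums P ρ) using 1
    ext p z
    simp
  | add u v _ _ hu hv =>
    convert add_mem hu hv using 1
    ext p z
    simp [mul_add]

lemma sub_mem_elementarySums {u v : P → M → ℝ} (hu : u ∈ elementarySums P ρ)
    (hv : v ∈ elementarySums P ρ) : (fun p z => u p z - v p z) ∈ elementarySums P ρ := by
  convert add_mem hu (smul_mem_elementarySums (b := fun _ => -1) continuous_const hv) using 1
  ext p z
  simp [sub_eq_add_neg]

/-- Multiplied by the chart density, `u` becomes a function on the cube with zero Lebesgue integral.
It splits by `exists_sum_isLineZero`, and dividing the summands by the density gives elementary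
families. -/
lemma mem_elementarySums_of_integral_eq_zero (hρ : ∀ x, IsChartDensity μ x (ρ x)) {x : M} {a : ℝ}
    (ha : 0 < a) (hat : cube (extChartAt (𝓡 d) x x) a ⊆ (extChartAt (𝓡 d) x).target)
    {u : P → M → ℝ} (hu : IsC1FamM d u) (hsupp : ∀ p, ∀ z ∉ chartCube d x a, u p z = 0)
    (hint : ∀ p, ∫ z, u p z ∂μ = 0) : u ∈ elementarySums P ρ := by
  set φ := extChartAt (𝓡 d) x with hφ
  have hot : IsOpen φ.target := isOpen_extChartAt_target x
  set g : P → EuclideanSpace ℝ (Fin d) → ℝ :=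
    fun p => φ.target.indicator fun y => ρ x y * u p (φ.symm y) with hg
  have hgs (p : P) (y : EuclideanSpace ℝ (Fin d)) (hyt : y ∈ φ.target) (hy : y ∉ cube (φ x) a) :
      ρ x y * u p (φ.symm y) = 0 := by
    rw [hsupp, mul_zero]
    rintro ⟨z, hz, hzy⟩
    have := congrArg φ hzy
    rw [φ.right_inv (hat hz), φ.right_inv hyt] at this
    exact hy (this ▸ hz)
  have hgfam : IsC1Fam g :=
    ((IsC1FamOn.of_contDiffOn hot (hρ x).smooth).mul (hu x) hot).indicator hot
      (isClosed_cube (φ x) a) hat hgs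
  have hgsupp (p : P) (y) (hy : y ∉ cube (φ x) a) : g p y = 0 := by
    by_cases hyt : y ∈ φ.target
    · exact (Set.indicator_of_mem hyt _).trans (hgs p y hyt hy)
    · exact Set.indicator_of_notMem hyt _
  have hKm : MeasurableSet (chartCube d x a) := (isClosed_chartCube hat).measurableSet
  obtain ⟨e, he, hge⟩ := exists_sum_isLineZero ha hgfam hgsupp fun p => by
    have h1 := hint p
    rw [← setIntegral_eq_integral_of_forall_compl_eq_zero (hsupp p),
      (hρ x).setIntegral_eq hKm (chartCube_subset_source hat)
      (f := u p) (hu.continuous.comp (continuous_const.prodMk continuous_id)),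
      extChartAt_image_chartCube hat] at h1
    rw [← setIntegral_eq_integral_of_forall_compl_eq_zero (hgsupp p), ← h1]
    refine setIntegral_congr_fun (isClosed_cube _ _).measurableSet fun y hy => ?_
    exact Set.indicator_of_mem (hat hy) _
  have hsum : u = ∑ j, fun p => φ.source.indicator fun z => e j p (φ z) / ρ x (φ z) := by
    ext p z
    simp only [Finset.sum_apply]
    by_cases hz : z ∈ φ.source
    · simp only [Set.indicator_of_mem hz, ← Finset.sum_div, ← hge]
      rw [hg]
      simp only [Set.indicator_of_mem (φ.map_source hz), φ.left_inv hz]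
      have := ((hρ x).pos _ (φ.map_source hz)).ne'
      field_simp
    · simp only [Set.indicator_of_notMem hz, Finset.sum_const_zero]
      exact hsupp p z fun h => hz (chartCube_subset_source hat h)
  rw [hsum]
  exact sum_mem fun j _ => AddSubmonoid.subset_closure ⟨x, φ x, a, j, hat, e j, he j, fun p => rfl⟩

end Decomposition

/-! ### Functions of zero integral over every component are elementary sums -/

section GlobalDecomposition
set_option linter.unusedSectionVars false
open Filter Topology

variable {d : ℕ} {M : Type*} [TopologicalSpace M] [T2Space M] [CompactSpace M]
    [ChartedSpace (EuclideanSpace ℝ (Fin d)) M] [IsManifold (𝓡 d) ∞ M] [MeasurableSpace M]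
    [BorelSpace M] {P : Type*} [TopologicalSpace P] [FirstCountableTopology P] [LocallyCompactSpace P]
    {ρ : M → EuclideanSpace ℝ (Fin d) → ℝ} {μ : Measure M}

lemma exists_bump_integral_eq_one [IsLocallyFiniteMeasure μ] [μ.IsOpenPosMeasure] {U : Set M}
    (hU : IsOpen U) {x : M} (hx : x ∈ U) : ∃ η : M → ℝ, ContMDiff (𝓡 d) 𝓘(ℝ, ℝ) ∞ η ∧
      (∀ z ∉ U, η z = 0) ∧ ∫ z, η z ∂μ = 1 := by
  obtain ⟨f, hf0, hf1, hf⟩ := exists_contMDiffMap_zero_one_of_isClosed (n := ⊤) (𝓡 d)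
    (s := Uᶜ) (t := {x}) hU.isClosed_compl isClosed_singleton (by simpa using hx)
  have hpos : 0 < ∫ z, f z ∂μ :=
    f.contMDiff.continuous.integral_pos_of_hasCompactSupport_nonneg_nonzero (x := x)
      (HasCompactSupport.of_compactSpace _) (fun z => (hf z).1) (by rw [hf1 rfl]; simp)
  refine ⟨fun z => (∫ z, f z ∂μ)⁻¹ * f z, contMDiff_const.mul f.contMDiff, fun z hz => ?_, ?_⟩
  · simp only [hf0 hz, Pi.zero_apply, mul_zero]
  · rw [integral_const_mul, inv_mul_cancel₀ hpos.ne']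

lemma IsC1FamM.integrable [IsLocallyFiniteMeasure μ] {u : P → M → ℝ} (hu : IsC1FamM d u) (p : P) :
    Integrable (u p) μ :=
  Continuous.integrable_of_hasCompactSupport
    (hu.continuous.comp (continuous_const.prodMk continuous_id) : Continuous fun x => u p x)
    (HasCompactSupport.of_compactSpace _)

lemma IsC1FamM.continuous_setIntegral [IsLocallyFiniteMeasure μ] {u : P → M → ℝ}
    (hu : IsC1FamM d u) {s : Set M} (hs : IsClosed s) : Continuous fun p => ∫ z in s, u p z ∂μ :=
  continuous_parametric_integral_of_continuous hu.continuous hs.isCompact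

/-- Modulo elementary sums, the mass of `u` may be concentrated on a fixed bump of integral one in
the same cube. -/
lemma sub_integral_mul_mem_elementarySums (hρ : ∀ x, IsChartDensity μ x (ρ x)) {x : M} {a : ℝ}
    (ha : 0 < a) (hat : cube (extChartAt (𝓡 d) x x) a ⊆ (extChartAt (𝓡 d) x).target)
    {u : P → M → ℝ} (hu : IsC1FamM d u) (hsupp : ∀ p, ∀ z ∉ chartCube d x a, u p z = 0)
    {η : M → ℝ} (hη : ContMDiff (𝓡 d) 𝓘(ℝ, ℝ) ∞ η) (hηs : ∀ z ∉ chartCube d x a, η z = 0)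
    (hη1 : ∫ z, η z ∂μ = 1) : (fun p z => u p z - (∫ z, u p z ∂μ) * η z) ∈ elementarySums P ρ := by
  have := isLocallyFiniteMeasure_of_isChartDensity hρ
  have hc : Continuous fun p => ∫ z, u p z ∂μ := by
    simpa using hu.continuous_setIntegral (μ := μ) isClosed_univ
  have h2 : IsC1FamM d fun p z => (∫ z, u p z ∂μ) * η z :=
    (IsC1FamM.of_continuous hc).mul (.of_contMDiff hη)
  refine mem_elementarySums_of_integral_eq_zero hρ ha hat (hu.sub h2)
    (fun p z hz => by rw [hsupp p z hz, hηs z hz, mul_zero, sub_zero]) fun p => ?_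
  rw [integral_sub (hu.integrable p) (h2.integrable p), integral_const_mul, hη1, mul_one, sub_self]

/-- A partition of unity cuts `u` into pieces in chart cubes, and each piece is congruent to its
integral times the bump of its cube. Bumps within one component are interchangeable modulo
elementary sums. All pieces of a component can thus be gathered on one bump, whose coefficient is
the integral of `u` over that component, namely zero. -/
theorem mem_elementarySums (hρ : ∀ x, IsChartDensity μ x (ρ x)) {u : P → M → ℝ}
    (hu : IsC1FamM d u) (hint : ∀ p x, ∫ z in connectedComponent x, u p z ∂μ = 0) :
    u ∈ elementarySums P ρ := by
  have := isLocallyFiniteMeasure_of_isChartDensity hρ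
  have := isOpenPosMeasure_of_isChartDensity hρ
  have hcube (x : M) : ∃ a : ℝ, 0 < a ∧
      cube (extChartAt (𝓡 d) x x) a ⊆ (extChartAt (𝓡 d) x).target := exists_cube_subset
    ((isOpen_extChartAt_target (I := 𝓡 d) x).mem_nhds (mem_extChartAt_target x))
  choose a ha hat using hcube
  have hxK (x : M) : x ∈ interior (chartCube d x (a x)) :=
    mem_interior_iff_mem_nhds.2 (chartCube_mem_nhds (ha x))
  choose η hη hηs' hη1 using fun x => exists_bump_integral_eq_one (d := d) (μ := μ) isOpen_interior (hxK x)
  have hηs (x : M) (z : M) (hz : z ∉ chartCube d x (a x)) : η x z = 0 :=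
    hηs' x z fun h => hz (interior_subset h)
  -- bump functions in the same component are interchangeable
  set R : M → M → Prop := fun x y => ∀ b : P → ℝ, Continuous b →
    (fun p z => b p * (η x z - η y z)) ∈ elementarySums P ρ with hR
  have hRsymm {x y : M} (h : R x y) : R y x := fun b hb => by
    convert h (fun p => -b p) hb.neg using 1
    ext p z
    ring
  have hRtrans {x y z : M} (h : R x y) (h' : R y z) : R x z := fun b hb => by
    convert add_mem (h b hb) (h' b hb) using 1
    ext p w
    simp only [Pi.add_apply]
    ring
  have hRloc (x y : M) (hy : y ∈ interior (chartCube d x (a x))) : R x y := by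
    -- A bump supported in both cubes mediates between the two given ones.
    obtain ⟨η', hη', hηs'', hη1'⟩ := exists_bump_integral_eq_one (d := d) (μ := μ)
      ((isOpen_interior (s := chartCube d x (a x))).inter
        (isOpen_interior (s := chartCube d y (a y)))) ⟨hy, hxK y⟩
    have key (w : M) (hw : ∀ z ∉ chartCube d w (a w), η' z = 0) (b : P → ℝ) (hb : Continuous b) :
        (fun p z => b p * η' z - b p * η w z) ∈ elementarySums P ρ := by
      convert sub_integral_mul_mem_elementarySums hρ (ha w) (hat w) (u := fun p z => b p * η' z)
        ((IsC1FamM.of_continuous hb).mul (.of_contMDiff hη'))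
        (fun p z hz => by rw [hw z hz, mul_zero]) (hη w) (hηs w) (hη1 w) using 3
      rw [integral_const_mul, hη1', mul_one]
    intro b hb
    convert sub_mem_elementarySums
      (key y (fun z hz => hηs'' z fun h => hz (interior_subset h.2)) b hb)
      (key x (fun z hz => hηs'' z fun h => hz (interior_subset h.1)) b hb) using 3
    ring
  have hRrefl (x : M) : R x x := hRloc x x (hxK x)
  have hRcomp {x y : M} (hy : y ∈ connectedComponent x) : R x y := by
    have hopen (w : M) : IsOpen {y | R w y} := isOpen_iff_mem_nhds.2 fun y hy =>
      mem_of_superset (isOpen_interior.mem_nhds (hxK y)) fun z hz => hRtrans hy (hRloc y z hz)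
    -- `R` is an equivalence relation with open classes, so each class is also closed.
    have hclopen : IsClopen {y | R x y} := by
      refine ⟨isOpen_compl_iff.1 (isOpen_iff_mem_nhds.2 fun y hy => ?_), hopen x⟩
      exact mem_of_superset ((hopen y).mem_nhds (hRrefl y)) fun z hz hxz =>
        hy (hRtrans hxz (hRsymm hz))
    exact hclopen.connectedComponent_subset (hRrefl x) hy
  -- a partition of unity
  obtain ⟨t, ht⟩ := isCompact_univ.elim_nhds_subcover (fun x : M => interior (chartCube d x (a x)))
    fun x _ => isOpen_interior.mem_nhds (hxK x)
  obtain ⟨f, hf⟩ := SmoothPartitionOfUnity.exists_isSubordinate (𝓡 d) isClosed_univ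
    (fun i : t => interior (chartCube d (i : M) (a i))) (fun i => isOpen_interior)
    (by simpa [Set.iUnion_subtype] using ht.2)
  have hfs (i : t) (z : M) (hz : z ∉ chartCube d (i : M) (a i)) : f i z = 0 := by
    by_contra h
    exact hz (interior_subset (hf i (subset_tsupport _ h)))
  have hfsum (z : M) : ∑ i, f i z = 1 := by
    rw [← finsum_eq_sum_of_fintype]
    exact f.sum_eq_one (Set.mem_univ z)
  have hfu (i : t) : IsC1FamM d fun p z => f i z * u p z := (IsC1FamM.of_contMDiff (f i).contMDiff).mul hu
  set b : t → P → ℝ := fun i p => ∫ z, f i z * u p z ∂μ with hb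
  have hbc (i : t) : Continuous (b i) := by
    simpa using (hfu i).continuous_setIntegral (μ := μ) isClosed_univ
  have h1 (i : t) : (fun p z => f i z * u p z - b i p * η i z) ∈ elementarySums P ρ :=
    sub_integral_mul_mem_elementarySums hρ (ha i) (hat i) (hfu i)
      (fun p z hz => by rw [hfs i z hz, zero_mul]) (hη i) (hηs i) (hη1 i)
  -- One reference point in each component, whose bump collects the masses of all pieces there.
  set rep : M → M := fun x => Quotient.out (s := connectedComponentSetoid M) ⟦x⟧ with hrep
  have hrepmk (x : M) : connectedComponent (rep x) = connectedComponent x :=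
    Quotient.exact (s := connectedComponentSetoid M) (Quotient.out_eq _)
  have hrepeq {x y : M} (h : connectedComponent x = connectedComponent y) : rep x = rep y :=
    congrArg Quotient.out (Quotient.sound (s := connectedComponentSetoid M) h)
  have h2 (i : t) : (fun p z => b i p * (η i z - η (rep i) z)) ∈ elementarySums P ρ :=
    hRcomp (by rw [← hrepmk]; exact mem_connectedComponent) (b i) (hbc i)
  classical
  -- The functions `f i` with index in the component of `w` sum to 1 on it and vanish off it, so the
  -- sum is the integral of `u` over that component.
  have h3 (p : P) (w : M) : ∑ i with rep (i : t) = rep w, b i p = 0 := by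
    rw [hb, ← integral_finsetSum _ fun i _ => (hfu i).integrable p, ← hint p w,
      ← integral_indicator isClosed_connectedComponent.measurableSet]
    congr 1
    ext z
    have hne (i : t) (hi : f i z ≠ 0) : connectedComponent (i : M) = connectedComponent z :=
      connectedComponent_eq (chartCube_subset_connectedComponent (ha i) (hat i)
        (by_contra fun h => hi (hfs i z h)))
    rw [← Finset.sum_mul]
    by_cases hz : z ∈ connectedComponent w
    · rw [Set.indicator_of_mem hz, Finset.sum_filter_of_ne, hfsum, one_mul]
      intro i _ hi
      exact hrepeq ((hne i hi).trans (connectedComponent_eq hz).symm)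
    · rw [Set.indicator_of_notMem hz, Finset.sum_eq_zero, zero_mul]
      intro i hi
      by_contra h
      have h5 : connectedComponent (i : M) = connectedComponent w := by
        rw [← hrepmk i, (Finset.mem_filter.1 hi).2, hrepmk]
      exact hz (h5 ▸ (hne i h) ▸ mem_connectedComponent)
  have h4 : (fun (p : P) z => ∑ i : t, b i p * η (rep i) z) = 0 := by
    ext p z
    rw [← Finset.sum_fiberwise_of_maps_to (g := fun i : t => rep i) (t := Finset.univ.image fun i : t => rep i)
      fun i hi => Finset.mem_image_of_mem _ hi]
    refine Finset.sum_eq_zero fun w hw => ?_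
    obtain ⟨i, -, rfl⟩ := Finset.mem_image.1 hw
    rw [Finset.sum_congr rfl (g := fun k : t => b k p * η (rep i) z) fun k hk => by
      rw [(Finset.mem_filter.1 hk).2], ← Finset.sum_mul, h3, zero_mul]
  have h5 : u = ∑ i : t, ((fun p z => f i z * u p z - b i p * η i z) +
      fun p z => b i p * (η i z - η (rep i) z)) := by
    ext p z
    have h6 := congrFun (congrFun h4 p) z
    simp only [Pi.zero_apply] at h6
    simp only [Finset.sum_apply, Pi.add_apply]
    calc u p z = ∑ i, f i z * u p z - ∑ i : t, b i p * η (rep i) z := by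
          rw [h6, sub_zero, ← Finset.sum_mul, hfsum, one_mul]
      _ = _ := by
        rw [← Finset.sum_sub_distrib]
        exact Finset.sum_congr rfl fun i _ => by ring
  rw [h5]
  exact sum_mem fun i _ => add_mem (h1 i) (h2 i)

end GlobalDecomposition

/-! ### Paths of diffeomorphisms realizing a path of densities -/

section MoserPath
set_option linter.unusedSectionVars false
open Filter Topology

variable {d : ℕ} {M : Type*} [TopologicalSpace M] [T2Space M] [CompactSpace M]
    [ChartedSpace (EuclideanSpace ℝ (Fin d)) M] [IsManifold (𝓡 d) ∞ M] [MeasurableSpace M]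
    [BorelSpace M] {ρ : M → EuclideanSpace ℝ (Fin d) → ℝ} {μ : Measure M} {r : ℕ∞}

lemma Diffeomorph.measurePreserving_symm {ν : Measure M} (f : Diffeomorph (𝓡 d) (𝓡 d) M M r)
    (h : MeasurePreserving f μ ν) : MeasurePreserving f.symm ν μ := by
  have hm : Measurable f.symm := f.symm.continuous.measurable
  refine ⟨hm, ?_⟩
  rw [← h.map_eq, Measure.map_map hm h.measurable]
  convert Measure.map_id
  ext x
  exact f.symm_apply_apply x

/-- The terms are added one after another, each by an elementary diffeomorphism; this requires every
partial sum to be a positive density. -/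
lemma exists_diffeo_list_elementary {P : Type*} [TopologicalSpace P] [CompactSpace P]
    [FirstCountableTopology P] [LocallyCompactSpace P] (hr : 1 ≤ r)
    (hρ : ∀ x, IsChartDensity μ x (ρ x)) (l : List (P → M → ℝ))
    (hl : ∀ ε ∈ l, ∃ x c a j, IsElementary ρ x c a j ε) (W : P → M → ℝ) (hW : IsC1FamM d W)
    (hpos : ∀ k p x, 0 < W p x + (l.take k).sum p x) :
    ∃ G : P → Diffeomorph (𝓡 d) (𝓡 d) M M r, IsC1Family G ∧ (IsC1Family fun p => (G p).symm) ∧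
      ∀ p, MeasurePreserving (G p) (μ.withDensity fun x => ENNReal.ofReal (W p x))
        (μ.withDensity fun x => ENNReal.ofReal (W p x + l.sum p x)) := by
  induction l generalizing W with
  | nil =>
    refine ⟨fun _ => .refl _ _ _, isC1Family_const hr _, isC1Family_const hr _, fun p => ?_⟩
    simpa using MeasurePreserving.id _
  | cons ε l ih =>
    obtain ⟨x₀, c, a, j, hε⟩ := hl ε (by simp)
    have hεf : IsC1FamM d ε := hε.isC1FamM (hρ x₀).smooth (hρ x₀).pos
    obtain ⟨e, he, hεe⟩ := hε.lift
    obtain ⟨G₁, hG₁, hG₁', hG₁m⟩ := exists_diffeo_elementary (hρ x₀) hε.subset he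
      (W' := fun p x => W p x + ε p x) hW
      (hW.add hεf).continuous (fun p x hx => by rw [hεe, Set.indicator_of_mem hx])
      (fun p x hx => by rw [hεe, Set.indicator_of_notMem hx, add_zero])
      (fun p x => by simpa using hpos 0 p x) (fun p x => by simpa using hpos 1 p x) r
    obtain ⟨G₂, hG₂, hG₂', hG₂m⟩ := ih (fun ε' h => hl ε' (by simp [h])) (fun p x => W p x + ε p x)
      (hW.add hεf) fun k p x => by simpa [add_assoc] using hpos (k + 1) p x
    refine ⟨fun p => (G₁ p).trans (G₂ p), hG₁.trans hr hG₂, hG₂'.trans hr hG₁', fun p => ?_⟩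
    have := (hG₂m p).comp (hG₁m p)
    simpa [add_assoc] using this

lemma sum_map_reparam {P Q : Type*} (l : List (P → M → ℝ)) (a b : Q → P) (q : Q) (x : M) :
    (l.map fun ε q x => ε (b q) x - ε (a q) x).sum q x = l.sum (b q) x - l.sum (a q) x := by
  induction l with
  | nil => simp
  | cons ε l ih =>
    simp only [List.map_cons, List.sum_cons, Pi.add_apply, ih]
    ring

/-- The difference `w t - w 0` is a finite sum of elementary families, but its partial sums may
destroy positivity of the density. Over short time steps the increments of the partial sums are
small and positivity persists, so the path is built step by step. -/
theorem exists_moser_path (hr : 1 ≤ r) (hρ : ∀ x, IsChartDensity μ x (ρ x))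
    {w : unitInterval → M → ℝ} (hw : IsC1FamM d w) (hpos : ∀ t x, 0 < w t x)
    (hint : ∀ t x, ∫ z in connectedComponent x, w t z ∂μ = ∫ z in connectedComponent x, w 0 z ∂μ) :
    ∃ G : unitInterval → Diffeomorph (𝓡 d) (𝓡 d) M M r, IsC1Family G ∧
      (IsC1Family fun t => (G t).symm) ∧ ⇑(G 0) = id ∧
      ∀ t, MeasurePreserving (G t) (μ.withDensity fun x => ENNReal.ofReal (w 0 x))
        (μ.withDensity fun x => ENNReal.ofReal (w t x)) := by
  have := isLocallyFiniteMeasure_of_isChartDensity hρ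
  have hw0 : IsC1FamM d fun _ : unitInterval => w 0 := hw.reparam (a := fun _ => 0) continuous_const
  have hu : (fun t x => w t x - w 0 x) ∈ elementarySums unitInterval ρ := by
    refine mem_elementarySums hρ (hw.sub hw0) fun t x => ?_
    rw [integral_sub (hw.integrable t).integrableOn (hw0.integrable t).integrableOn, hint, sub_self]
  obtain ⟨l, hl, hlsum⟩ := AddSubmonoid.exists_list_of_mem_closure hu
  have hlfam (ε) (hε : ε ∈ l) : IsC1FamM d ε := by
    obtain ⟨x, c, a, j, h⟩ := hl ε hε
    exact h.isC1FamM (hρ x).smooth (hρ x).pos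
  have hsumc (l' : List (unitInterval → M → ℝ)) (h : ∀ ε ∈ l', IsC1FamM d ε) :
      Continuous fun q : unitInterval × M => l'.sum q.1 q.2 := by
    induction l' with
    | nil => simpa using continuous_const
    | cons ε l' ih =>
      simp only [List.sum_cons, Pi.add_apply]
      exact (h ε (by simp)).continuous.add (ih fun ε' h' => h ε' (by simp [h']))
  have hlsum' (t : unitInterval) (x : M) : l.sum t x = w t x - w 0 x := by rw [hlsum]
  -- uniform positivity of the intermediate densities
  have hδ : ∃ δ : ℝ, 0 < δ ∧ ∀ s t : unitInterval, dist s t < δ → ∀ k x,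
      0 < w s x + ((l.take k).sum t x - (l.take k).sum s x) := by
    have hmem : {q : unitInterval × unitInterval | ∀ k ∈ Finset.range (l.length + 1), ∀ x,
        0 < w q.1 x + ((l.take k).sum q.2 x - (l.take k).sum q.1 x)} ∈ uniformity unitInterval := by
      rw [← nhdsSet_diagonal_eq_uniformity, mem_nhdsSet_iff_forall]
      rintro ⟨s, t⟩ hst
      obtain rfl : s = t := hst
      refine (Finset.eventually_all _).2 fun k _ => ?_
      have hc := hsumc (l.take k) fun ε hε => hlfam ε (List.mem_of_mem_take hε)
      have hF : Continuous fun z : (unitInterval × unitInterval) × M =>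
          w z.1.1 z.2 + ((l.take k).sum z.1.2 z.2 - (l.take k).sum z.1.1 z.2) :=
        (hw.continuous.comp ((continuous_fst.comp continuous_fst).prodMk continuous_snd)).add
          ((hc.comp ((continuous_snd.comp continuous_fst).prodMk continuous_snd)).sub
          (hc.comp ((continuous_fst.comp continuous_fst).prodMk continuous_snd)))
      have := isCompact_univ.eventually_forall_of_forall_eventually (x₀ := (s, s))
        (P := fun q x => 0 < w q.1 x + ((l.take k).sum q.2 x - (l.take k).sum q.1 x))
        fun x (_ : x ∈ (Set.univ : Set M)) =>
          (hF.tendsto ((s, s), x)).eventually_const_lt (by simpa using hpos s x)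
      simpa using this
    obtain ⟨δ, hδ, h⟩ := Metric.mem_uniformity_dist.1 hmem
    refine ⟨δ, hδ, fun s t hst k x => ?_⟩
    -- The uniform estimate covers the finitely many truncations up to the whole list; larger `k`
    -- give the whole list again.
    by_cases hk : k < l.length + 1
    · exact h hst k (Finset.mem_range.2 hk) x
    · have := h hst l.length (by simp) x
      rwa [List.take_of_length_le le_rfl, ← List.take_of_length_le (l := l) (i := k) (by omega)] at this
  obtain ⟨δ, hδ0, hδ⟩ := hδ
  obtain ⟨N, hN⟩ := exists_nat_one_div_lt hδ0
  have hN0 : (0 : ℝ) < N + 1 := by positivity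
  set τ : ℕ → unitInterval := fun n => ⟨min (n / (N + 1)) 1, le_min (by positivity) zero_le_one,
    min_le_right _ _⟩ with hτ
  -- Stopping the parameter at `τ n` keeps every stage a continuous family over the whole interval,
  -- so no gluing in `t` is needed.
  have key (n : ℕ) : ∃ G : unitInterval → Diffeomorph (𝓡 d) (𝓡 d) M M r, IsC1Family G ∧
      (IsC1Family fun t => (G t).symm) ∧
      ∀ t, MeasurePreserving (G t) (μ.withDensity fun x => ENNReal.ofReal (w 0 x))
        (μ.withDensity fun x => ENNReal.ofReal (w (t ⊓ τ n) x)) := by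
    induction n with
    | zero =>
      refine ⟨fun _ => .refl _ _ _, isC1Family_const hr _, isC1Family_const hr _, fun t => ?_⟩
      have : t ⊓ τ 0 = 0 := by
        rw [show τ 0 = 0 from Subtype.ext (by simp [hτ])]
        exact inf_eq_right.2 t.2.1
      rw [this]
      exact MeasurePreserving.id _
    | succ n ih =>
      obtain ⟨G₁, hG₁, hG₁', hG₁m⟩ := ih
      have ha : Continuous fun t : unitInterval => t ⊓ τ n := continuous_id.inf continuous_const
      have hb : Continuous fun t : unitInterval => t ⊓ τ (n + 1) := continuous_id.inf continuous_const
      have hdist (t : unitInterval) : dist (t ⊓ τ n) (t ⊓ τ (n + 1)) < δ := by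
        refine lt_of_le_of_lt ?_ hN
        have h1 : ((n + 1 : ℕ) : ℝ) / (N + 1) = n / (N + 1) + 1 / (N + 1) := by
          push_cast; ring
        have h2 : (0 : ℝ) < 1 / (N + 1) := by positivity
        rw [Subtype.dist_eq, Real.dist_eq]
        change |min (t : ℝ) (min (n / (N + 1)) 1) - min (t : ℝ) (min (((n + 1 : ℕ) : ℝ) / (N + 1)) 1)| ≤ _
        rw [h1]
        generalize (n : ℝ) / (N + 1) = z at *
        generalize (1 : ℝ) / (N + 1) = y at *
        rw [abs_le]
        grind
      obtain ⟨G₂, hG₂, hG₂', hG₂m⟩ := exists_diffeo_list_elementary hr hρ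
        (l.map fun ε (t : unitInterval) x => ε (t ⊓ τ (n + 1)) x - ε (t ⊓ τ n) x)
        (fun ε hε => by
          obtain ⟨ε', hε', rfl⟩ := List.mem_map.1 hε
          obtain ⟨x, c, a, j, h⟩ := hl ε' hε'
          exact ⟨x, c, a, j, (h.reparam hb).sub (h.reparam ha)⟩)
        (fun t => w (t ⊓ τ n)) (hw.reparam ha) (fun k t x => by
          rw [← List.map_take, sum_map_reparam]
          exact hδ _ _ (hdist t) k x)
      refine ⟨fun t => (G₁ t).trans (G₂ t), hG₁.trans hr hG₂, hG₂'.trans hr hG₁', fun t => ?_⟩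
      have := (hG₂m t).comp (hG₁m t)
      simp only [sum_map_reparam, hlsum', sub_sub_sub_cancel_right, add_sub_cancel] at this
      exact this
  obtain ⟨G, hG, hG', hGm⟩ := key (N + 1)
  have hτ1 (t : unitInterval) : t ⊓ τ (N + 1) = t := by
    rw [show τ (N + 1) = 1 from Subtype.ext (by simp [hτ, div_self hN0.ne'])]
    exact inf_eq_left.2 t.2.2
  simp only [hτ1] at hGm
  -- `G 0` preserves the initial measure, so precomposing with its inverse makes the path start at
  -- the identity without affecting the transport.
  refine ⟨fun t => (G 0).symm.trans (G t), (isC1Family_const hr _).trans hr hG,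
    hG'.trans hr (isC1Family_const hr (G 0)), ?_, fun t => (hGm t).comp ?_⟩
  · ext x
    exact (G 0).apply_symm_apply x
  · exact (G 0).measurePreserving_symm (hGm 0)

end MoserPath

/-! ### Densities of a smooth family of volumes -/

section VolumeFamilies
set_option linter.unusedSectionVars false
open Filter Topology

lemma IsC1FamOn.of_locally {P E F : Type*} [TopologicalSpace P] [NormedAddCommGroup E]
    [NormedSpace ℝ E] [NormedAddCommGroup F] [NormedSpace ℝ F] {u : P → E → F} {s : Set E}
    (h : ∀ y ∈ s, ∃ t, IsOpen t ∧ y ∈ t ∧ IsC1FamOn u t) : IsC1FamOn u s := by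
  refine ⟨fun p y hy => ?_, fun q hq => ?_, fun q hq => ?_⟩
  · obtain ⟨t, ht, hyt, hu⟩ := h y hy
    exact ((hu.smooth p).contDiffAt (ht.mem_nhds hyt)).contDiffWithinAt
  · obtain ⟨t, ht, hyt, hu⟩ := h q.2 hq.2
    exact (hu.cont.continuousAt ((isOpen_univ.prod ht).mem_nhds ⟨trivial, hyt⟩)).continuousWithinAt
  · obtain ⟨t, ht, hyt, hu⟩ := h q.2 hq.2
    exact (hu.cont_fderiv.continuousAt
      ((isOpen_univ.prod ht).mem_nhds ⟨trivial, hyt⟩)).continuousWithinAt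

/-- Smoothness of `ρ` is given only within `[0,1] × U`. The space derivative is therefore read off
from the derivative within this set, which is continuous up to the ends of the interval. -/
lemma IsC1FamOn.of_contDiffOn_prod {E : Type*} [NormedAddCommGroup E] [NormedSpace ℝ E]
    {ρ : ℝ × E → ℝ} {U : Set E} (hU : IsOpen U) (hρ : ContDiffOn ℝ ∞ ρ (Set.Icc 0 1 ×ˢ U)) :
    IsC1FamOn (fun (t : unitInterval) y => ρ ((t : ℝ), y)) U := by
  have hmaps (t : unitInterval) : Set.MapsTo (fun y : E => ((t : ℝ), y)) U (Set.Icc 0 1 ×ˢ U) :=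
    fun y hy => ⟨t.2, hy⟩
  have hc : Continuous fun q : unitInterval × E => ((q.1 : ℝ), q.2) :=
    (continuous_subtype_val.comp continuous_fst).prodMk continuous_snd
  have hm : Set.MapsTo (fun q : unitInterval × E => ((q.1 : ℝ), q.2)) (Set.univ ×ˢ U)
    (Set.Icc 0 1 ×ˢ U) := fun q hq => ⟨q.1.2, hq.2⟩
  refine ⟨fun t => hρ.comp (contDiff_prodMk_right _).contDiffOn (hmaps t),
    hρ.continuousOn.comp hc.continuousOn hm, ?_⟩
  have hd : ContinuousOn (fderivWithin ℝ ρ (Set.Icc 0 1 ×ˢ U)) (Set.Icc 0 1 ×ˢ U) :=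
    hρ.continuousOn_fderivWithin ((uniqueDiffOn_Icc zero_lt_one).prod hU.uniqueDiffOn) (by simp)
  refine ((hd.comp hc.continuousOn hm).clm_comp
    (continuousOn_const (c := ContinuousLinearMap.inr ℝ ℝ E))).congr fun q hq => ?_
  have h1 : HasFDerivWithinAt ρ (fderivWithin ℝ ρ (Set.Icc 0 1 ×ˢ U) ((q.1 : ℝ), q.2))
      (Set.Icc 0 1 ×ˢ U) ((q.1 : ℝ), q.2) :=
    (hρ.differentiableOn (by simp) _ ⟨q.1.2, hq.2⟩).hasFDerivWithinAt
  have h2 := h1.comp q.2 (hasFDerivAt_prodMk_right (𝕜 := ℝ) (q.1 : ℝ) q.2).hasFDerivWithinAt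
    (hmaps q.1)
  exact (h2.hasFDerivAt (hU.mem_nhds hq.2)).fderiv

variable {d : ℕ} {M : Type*} [TopologicalSpace M]
    [ChartedSpace (EuclideanSpace ℝ (Fin d)) M]

lemma IsC1FamM.of_locally {P : Type*} [TopologicalSpace P] {u : P → M → ℝ}
    (h : ∀ x : M, ∃ U : Set M, IsOpen U ∧ x ∈ U ∧ ∃ v : P → M → ℝ, IsC1FamM d v ∧
      ∀ p, ∀ z ∈ U, u p z = v p z) : IsC1FamM d u := by
  intro x₀
  refine .of_locally fun y hy => ?_
  obtain ⟨U, hU, hyU, v, hv, huv⟩ := h ((extChartAt (𝓡 d) x₀).symm y)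
  have ho : IsOpen ((extChartAt (𝓡 d) x₀).target ∩ (extChartAt (𝓡 d) x₀).symm ⁻¹' U) :=
    (continuousOn_extChartAt_symm x₀).isOpen_inter_preimage (isOpen_extChartAt_target x₀) hU
  exact ⟨_, ho, ⟨hy, hyU⟩, ((hv x₀).mono Set.inter_subset_left).congr ho fun p z hz => huv p _ hz.2⟩

variable [T2Space M] [CompactSpace M] [IsManifold (𝓡 d) ∞ M] [MeasurableSpace M] [BorelSpace M]

lemma IsChartDensity.setLIntegral_div {μ ν : Measure M} {x₀ : M} {ρ σ : EuclideanSpace ℝ (Fin d) → ℝ}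
    (h : IsChartDensity μ x₀ ρ) (h' : IsChartDensity ν x₀ σ) {f : M → ℝ} {s : Set M}
    (hs : MeasurableSet s) (hsub : s ⊆ (extChartAt (𝓡 d) x₀).source)
    (hfm : AEMeasurable f (μ.restrict s))
    (hf : ∀ x ∈ s, f x = σ (extChartAt (𝓡 d) x₀ x) / ρ (extChartAt (𝓡 d) x₀ x)) :
    ∫⁻ x in s, ENNReal.ofReal (f x) ∂μ = ν s := by
  rw [h.setLIntegral_eq hs hsub hfm.ennreal_ofReal, h'.measure_eq s hs hsub]
  refine setLIntegral_congr_fun (measurableSet_extChartAt_image hs hsub) ?_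
  rintro _ ⟨x, hx, rfl⟩
  have := h.pos _ ((extChartAt (𝓡 d) x₀).map_source (hsub hx))
  simp only [(extChartAt (𝓡 d) x₀).left_inv (hsub hx), hf x hx]
  rw [← ENNReal.ofReal_mul this.le, mul_div_cancel₀ _ this.ne']

lemma IsChartDensity.continuousOn_div {μ ν : Measure M} {x₀ : M} {ρ σ : EuclideanSpace ℝ (Fin d) → ℝ}
    (h : IsChartDensity μ x₀ ρ) (h' : IsChartDensity ν x₀ σ) :
    ContinuousOn (fun x => σ (extChartAt (𝓡 d) x₀ x) / ρ (extChartAt (𝓡 d) x₀ x))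
      (extChartAt (𝓡 d) x₀).source := by
  have hm : Set.MapsTo (extChartAt (𝓡 d) x₀) (extChartAt (𝓡 d) x₀).source
    (extChartAt (𝓡 d) x₀).target := fun x hx => (extChartAt (𝓡 d) x₀).map_source hx
  exact (h'.smooth.continuousOn.comp (continuousOn_extChartAt x₀) hm).div
    (h.smooth.continuousOn.comp (continuousOn_extChartAt x₀) hm)
    fun x hx => (h.pos _ (hm hx)).ne'

/-- The quotient of the densities of two measures does not depend on the chart. -/
lemma IsChartDensity.div_eq_div {μ ν : Measure M} [IsFiniteMeasure ν] [μ.IsOpenPosMeasure]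
    {x₀ x₁ : M} {ρ₀ σ₀ ρ₁ σ₁ : EuclideanSpace ℝ (Fin d) → ℝ}
    (h₀ : IsChartDensity μ x₀ ρ₀) (h₀' : IsChartDensity ν x₀ σ₀) (h₁ : IsChartDensity μ x₁ ρ₁)
    (h₁' : IsChartDensity ν x₁ σ₁) {x : M} (hx₀ : x ∈ (extChartAt (𝓡 d) x₀).source)
    (hx₁ : x ∈ (extChartAt (𝓡 d) x₁).source) :
    σ₀ (extChartAt (𝓡 d) x₀ x) / ρ₀ (extChartAt (𝓡 d) x₀ x) =
      σ₁ (extChartAt (𝓡 d) x₁ x) / ρ₁ (extChartAt (𝓡 d) x₁ x) := by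
  set U := (extChartAt (𝓡 d) x₀).source ∩ (extChartAt (𝓡 d) x₁).source with hU
  have hUo : IsOpen U := (isOpen_extChartAt_source x₀).inter (isOpen_extChartAt_source x₁)
  have hc₀ := (h₀.continuousOn_div h₀').mono (Set.inter_subset_left : U ⊆ _)
  have hc₁ := (h₁.continuousOn_div h₁').mono (Set.inter_subset_right : U ⊆ _)
  have hm₀ := hc₀.aemeasurable (μ := μ) hUo.measurableSet
  have hm₁ := hc₁.aemeasurable (μ := μ) hUo.measurableSet
  -- Both quotients are densities of `ν` with respect to `μ` on the overlap, hence agree almost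
  -- everywhere. Continuity then gives equality everywhere because `μ` charges open sets.
  have hae : (fun x => ENNReal.ofReal (σ₀ (extChartAt (𝓡 d) x₀ x) / ρ₀ (extChartAt (𝓡 d) x₀ x)))
      =ᵐ[μ.restrict U]
      fun x => ENNReal.ofReal (σ₁ (extChartAt (𝓡 d) x₁ x) / ρ₁ (extChartAt (𝓡 d) x₁ x)) := by
    rw [← withDensity_eq_iff hm₀.ennreal_ofReal hm₁.ennreal_ofReal]
    · ext s hs
      rw [withDensity_apply _ hs, withDensity_apply _ hs, Measure.restrict_restrict hs,
        h₀.setLIntegral_div h₀' (hs.inter hUo.measurableSet)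
          (Set.inter_subset_right.trans Set.inter_subset_left)
          (hm₀.mono_measure (Measure.restrict_mono Set.inter_subset_right le_rfl)) fun _ _ => rfl,
        h₁.setLIntegral_div h₁' (hs.inter hUo.measurableSet)
          (Set.inter_subset_right.trans Set.inter_subset_right)
          (hm₁.mono_measure (Measure.restrict_mono Set.inter_subset_right le_rfl)) fun _ _ => rfl]
    · rw [h₀.setLIntegral_div h₀' hUo.measurableSet Set.inter_subset_left hm₀ fun _ _ => rfl]
      exact measure_ne_top _ _
  refine Measure.eqOn_open_of_ae_eq (μ := μ) ?_ hUo hc₀ hc₁ ⟨hx₀, hx₁⟩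
  filter_upwards [hae, ae_restrict_mem hUo.measurableSet] with z hz hzU
  have p₀ := div_nonneg (h₀'.pos _ ((extChartAt (𝓡 d) x₀).map_source hzU.1)).le
    (h₀.pos _ ((extChartAt (𝓡 d) x₀).map_source hzU.1)).le
  have p₁ := div_nonneg (h₁'.pos _ ((extChartAt (𝓡 d) x₁).map_source hzU.2)).le
    (h₁.pos _ ((extChartAt (𝓡 d) x₁).map_source hzU.2)).le
  rwa [ENNReal.ofReal_eq_ofReal_iff p₀ p₁] at hz

/-- A smooth family of volumes is given by a family of positive densities with respect to the first
volume. -/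
lemma IsSmoothVolumeFamily.exists_density {vol : unitInterval → Measure M}
    (hvol : IsSmoothVolumeFamily d vol) :
    (∃ ρ : M → EuclideanSpace ℝ (Fin d) → ℝ, ∀ x, IsChartDensity (vol 0) x (ρ x)) ∧
    ∃ w : unitInterval → M → ℝ, IsC1FamM d w ∧ (∀ t x, 0 < w t x) ∧
      ∀ t, vol t = (vol 0).withDensity fun x => ENNReal.ofReal (w t x) := by
  choose ρ hρs hρpos hρeq using hvol
  have hden (t : unitInterval) (x : M) : IsChartDensity (vol t) x fun y => ρ x ((t : ℝ), y) :=
    ⟨(IsC1FamOn.of_contDiffOn_prod (isOpen_extChartAt_target x) (hρs x)).smooth t,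
      fun y hy => hρpos x _ ⟨t.2, hy⟩, hρeq x t⟩
  have hlf (t : unitInterval) : IsLocallyFiniteMeasure (vol t) :=
    isLocallyFiniteMeasure_of_isChartDensity (hden t)
  have hop := isOpenPosMeasure_of_isChartDensity (hden 0)
  -- The quotient is taken in the chart at `x` itself; its independence of the chart gives
  -- regularity in every fixed chart.
  set w : unitInterval → M → ℝ := fun t x =>
    ρ x ((t : ℝ), extChartAt (𝓡 d) x x) / ρ x (((0 : unitInterval) : ℝ), extChartAt (𝓡 d) x x) with hw
  have hwx (t : unitInterval) (x₀ x : M) (hx : x ∈ (extChartAt (𝓡 d) x₀).source) :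
      w t x = ρ x₀ ((t : ℝ), extChartAt (𝓡 d) x₀ x) /
        ρ x₀ (((0 : unitInterval) : ℝ), extChartAt (𝓡 d) x₀ x) :=
    (hden 0 x).div_eq_div (hden t x) (hden 0 x₀) (hden t x₀) (mem_extChartAt_source x) hx
  have hwpos (t : unitInterval) (x : M) : 0 < w t x :=
    div_pos ((hden t x).pos _ (mem_extChartAt_target x)) ((hden 0 x).pos _ (mem_extChartAt_target x))
  have hwfam : IsC1FamM d w := fun x₀ => by
    have hot : IsOpen (extChartAt (𝓡 d) x₀).target := isOpen_extChartAt_target x₀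
    refine ((IsC1FamOn.of_contDiffOn_prod hot (hρs x₀)).mul (.of_contDiffOn hot
      ((hden 0 x₀).smooth.inv fun y hy => ((hden 0 x₀).pos y hy).ne')) hot).congr hot
      fun t y hy => ?_
    rw [hwx t x₀ _ ((extChartAt (𝓡 d) x₀).map_target hy), (extChartAt (𝓡 d) x₀).right_inv hy,
      div_eq_mul_inv, Pi.inv_apply]
  refine ⟨⟨_, hden 0⟩, w, hwfam, hwpos, fun t => ?_⟩
  have hwm : Measurable (w t) :=
    (hwfam.continuous.comp (continuous_const.prodMk continuous_id) :
      Continuous fun x => w t x).measurable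
  obtain ⟨T, hT⟩ := isCompact_univ.elim_nhds_subcover
    (fun x : M => (extChartAt (𝓡 d) x).source) fun x _ => extChartAt_source_mem_nhds x
  have hT' : ⋃ x ∈ T, (extChartAt (𝓡 d) x).source = Set.univ := Set.univ_subset_iff.1 hT.2
  rw [← Measure.restrict_univ (μ := vol t),
    ← Measure.restrict_univ (μ := (vol 0).withDensity _), ← hT',
    Measure.restrict_biUnion_finset_congr]
  intro x _
  ext s hs
  have hsm := hs.inter (isOpen_extChartAt_source (I := 𝓡 d) x).measurableSet
  rw [Measure.restrict_apply hs, Measure.restrict_apply hs, withDensity_apply _ hsm,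
    (hden 0 x).setLIntegral_div (hden t x) hsm Set.inter_subset_right hwm.aemeasurable
    fun z hz => hwx t x z hz.2]

end VolumeFamilies

/-! ### Normalizing the volumes and conjugating to a fixed one -/

section VolumePreserving
set_option linter.unusedSectionVars false
attribute [local instance 5000] isManifold_one_of_infty instTopologicalSpaceTangentBundle
open Filter Topology

variable {d : ℕ} {M : Type*} [TopologicalSpace M] [T2Space M] [CompactSpace M]
    [ChartedSpace (EuclideanSpace ℝ (Fin d)) M] [IsManifold (𝓡 d) ∞ M] [MeasurableSpace M]
    [BorelSpace M] {r : ℕ∞}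

lemma Homeomorph.preimage_connectedComponent {X : Type*} [TopologicalSpace X] (f : X ≃ₜ X) (x : X) :
    f ⁻¹' connectedComponent (f x) = connectedComponent x := by
  apply Set.Subset.antisymm
  · intro y hy
    have h := f.symm.continuous.image_connectedComponent_subset (f x) ⟨f y, hy, rfl⟩
    simpa using h
  · exact fun y hy => f.continuous.image_connectedComponent_subset x ⟨y, hy, rfl⟩

lemma connectedComponent_apply_path {X : Type*} [TopologicalSpace X] {c : unitInterval → X}
    (hc : Continuous c) (s t : unitInterval) : connectedComponent (c s) = connectedComponent (c t) :=
  connectedComponent_eq ((isPreconnected_range hc).subset_connectedComponent ⟨s, rfl⟩ ⟨t, rfl⟩)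

/-- A family of volumes preserved by a path of diffeomorphisms can be normalized to be joined by a
path of diffeomorphisms. -/
theorem exists_path_measurePreserving (hr : 1 ≤ r) {f : unitInterval → Diffeomorph (𝓡 d) (𝓡 d) M M r}
    (hf : IsC1Path f) {vol : unitInterval → Measure M} (hvol : IsSmoothVolumeFamily d vol)
    (hpres : ∀ t, MeasurePreserving (f t) (vol t) (vol t))
    (hcomp : ∀ x : M, vol 1 (connectedComponent x) = vol 0 (connectedComponent x)) :
    ∃ G : unitInterval → Diffeomorph (𝓡 d) (𝓡 d) M M r, IsC1Path G ∧
      (IsC1Path fun t => (G t).symm) ∧ ⇑(G 0) = id ∧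
      (∀ t, MeasurePreserving (conjDiffeo (G t) (f t)) (vol 0) (vol 0)) ∧
      MeasurePreserving (G 1) (vol 0) (vol 1) := by
  obtain ⟨⟨ρ, hρ⟩, w, hw, hwpos, hvolw⟩ := hvol.exists_density
  have := isLocallyFiniteMeasure_of_isChartDensity hρ
  have := isOpenPosMeasure_of_isChartDensity hρ
  have : LocallyConnectedSpace M := ChartedSpace.locallyConnectedSpace (EuclideanSpace ℝ (Fin d)) M
  have hCo (x : M) : IsOpen (connectedComponent x) := isOpen_connectedComponent
  have hCm (x : M) : MeasurableSet (connectedComponent x) := (hCo x).measurableSet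
  have hvolC (t : unitInterval) (x : M) :
      (vol t).real (connectedComponent x) = ∫ z in connectedComponent x, w t z ∂(vol 0) := by
    rw [Measure.real, hvolw t, withDensity_apply _ (hCm x),
      integral_eq_lintegral_of_nonneg_ae (.of_forall fun z => (hwpos t z).le)
        (hw.integrable t).aestronglyMeasurable.restrict]
  have hVpos (t : unitInterval) (x : M) : 0 < (vol t).real (connectedComponent x) := by
    rw [hvolC, setIntegral_pos_iff_support_of_nonneg_ae (.of_forall fun z => (hwpos t z).le)
      (hw.integrable t).integrableOn]
    have : Function.support (w t) = Set.univ := Set.eq_univ_of_forall fun z => (hwpos t z).ne'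
    rw [this, Set.univ_inter]
    exact (hCo x).measure_pos _ ⟨x, mem_connectedComponent⟩
  -- The masses of the components may vary along the path. This factor, constant on components,
  -- restores their initial values; it is 1 at `t = 0`, and by assumption also at `t = 1`.
  set κ : unitInterval → M → ℝ :=
    fun t x => (vol 0).real (connectedComponent x) / (vol t).real (connectedComponent x) with hκ
  have hκpos (t x) : 0 < κ t x := div_pos (hVpos 0 x) (hVpos t x)
  have hκC (t : unitInterval) {x y : M} (h : connectedComponent x = connectedComponent y) :
      κ t x = κ t y := by simp only [hκ, h]
  have hκfam : IsC1FamM d κ := .of_locally fun x => by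
    refine ⟨connectedComponent x, hCo x, mem_connectedComponent, fun t _ => κ t x,
      .of_continuous ?_, fun t z hz => hκC t (connectedComponent_eq hz).symm⟩
    refine continuous_const.div ?_ fun t => (hVpos t x).ne'
    simp only [hvolC]
    exact hw.continuous_setIntegral isClosed_connectedComponent
  set ν : unitInterval → Measure M :=
    fun t => (vol 0).withDensity fun x => ENNReal.ofReal (κ t x * w t x) with hν
  have hκm (t) : Measurable fun x => ENNReal.ofReal (κ t x) :=
    (hκfam.continuous.comp (continuous_const.prodMk continuous_id) :
      Continuous fun x => κ t x).measurable.ennreal_ofReal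
  have hwm (t) : Measurable fun x => ENNReal.ofReal (w t x) :=
    (hw.continuous.comp (continuous_const.prodMk continuous_id) :
      Continuous fun x => w t x).measurable.ennreal_ofReal
  have hνvol (t) : ν t = (vol t).withDensity fun x => ENNReal.ofReal (κ t x) := by
    have e : (fun x => ENNReal.ofReal (κ t x * w t x)) =
        (fun x => ENNReal.ofReal (w t x)) * fun x => ENNReal.ofReal (κ t x) := by
      ext x
      rw [Pi.mul_apply, ← ENNReal.ofReal_mul (hwpos t x).le, mul_comm]
    rw [hvolw t, ← withDensity_mul _ (hwm t) (hκm t), ← e]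
  have hκ1 (t) (h : ∀ x : M, vol t (connectedComponent x) = vol 0 (connectedComponent x)) :
      ν t = vol t := by
    have : (fun x => ENNReal.ofReal (κ t x)) = 1 := by
      ext x
      have hx : κ t x = 1 := by
        simp only [hκ, Measure.real, h x]
        exact div_self (hVpos 0 x).ne'
      rw [hx, ENNReal.ofReal_one, Pi.one_apply]
    rw [hνvol, this, withDensity_one]
  obtain ⟨G, hG, hG', hG0, hGm⟩ := exists_moser_path hr hρ (hκfam.mul hw)
    (fun t x => mul_pos (hκpos t x) (hwpos t x)) fun t x => by
      have h (t) : ∫ z in connectedComponent x, κ t z * w t z ∂(vol 0) =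
          (vol 0).real (connectedComponent x) := by
        rw [setIntegral_congr_fun (g := fun z => κ t x * w t z) (hCm x) fun z hz => by
          simp only [hκC t (connectedComponent_eq hz).symm], integral_const_mul, ← hvolC,
          div_mul_cancel₀ _ (hVpos t x).ne']
      rw [h, h]
  have hGm' (t) : MeasurePreserving (G t) (vol 0) (ν t) := by
    have := hGm t
    rwa [show (vol 0).withDensity (fun x => ENNReal.ofReal (κ 0 x * w 0 x)) = vol 0 from
      hκ1 0 fun _ => rfl] at this
  have hfν (t) : MeasurePreserving (f t) (ν t) (ν t) := by
    refine ⟨(hpres t).measurable, ?_⟩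
    -- `f t` carries the component of `x` to that of `f t x` and preserves its mass under `vol t`.
    -- The latter component also contains `f 0 x`, so its mass under `vol 0` is that of the
    -- component of `x` as well.
    have hinv (x : M) : κ t (f t x) = κ t x := by
      have h1 (s u : unitInterval) (x : M) :
          vol s (connectedComponent (f s x)) = vol s (connectedComponent x) := by
        rw [← (hpres s).measure_preimage (hCm _).nullMeasurableSet]
        exact congrArg _ ((f s).toHomeomorph.preimage_connectedComponent x)
      have h2 : connectedComponent (f t x) = connectedComponent (f 0 x) :=
        connectedComponent_apply_path (c := fun s => f s x)
          (IsC1Family.continuous_apply hf x) t 0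
      simp only [hκ, Measure.real]
      rw [h1 t t x, h2, h1 0 0 x]
    ext s hs
    rw [Measure.map_apply (hpres t).measurable hs, hνvol, withDensity_apply _ hs,
      withDensity_apply _ ((hpres t).measurable hs),
      ← (hpres t).setLIntegral_comp_preimage hs (hκm t)]
    simp only [hinv]
  refine ⟨G, hG, hG', hG0, fun t => ?_, ?_⟩
  · exact ((G t).measurePreserving_symm (hGm' t)).comp ((hfν t).comp (hGm' t))
  · rw [← hκ1 1 hcomp]
    exact hGm' 1

lemma IsWord.measurePreserving {F : unitInterval → Diffeomorph (𝓡 d) (𝓡 d) M M r} {μ : Measure M}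
    (hF : ∀ t, MeasurePreserving (F t) μ μ) {n : ℕ} {k : Diffeomorph (𝓡 d) (𝓡 d) M M r}
    (hk : IsWord F n k) : MeasurePreserving k μ μ := by
  induction hk with
  | refl => exact MeasurePreserving.id μ
  | trans h t ih => exact (hF t).comp ih

end VolumePreserving

theorem propositionp {d : ℕ} {M : Type*} [TopologicalSpace M] [T2Space M] [CompactSpace M]
    [ChartedSpace (EuclideanSpace ℝ (Fin d)) M] [IsManifold (𝓡 d) ∞ M]
    [MeasurableSpace M] [BorelSpace M]
    (γ : Bundle.ContMDiffRiemannianMetric (𝓡 d) ∞ (EuclideanSpace ℝ (Fin d))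
      (fun x : M => TangentSpace (𝓡 d) x))
    (r : ℕ∞) (hr : 1 ≤ r)
    (f : unitInterval → Diffeomorph (𝓡 d) (𝓡 d) M M r) (hf : IsC1Path f)
    (S : (t : unitInterval) → PartiallyHyperbolicSplitting γ (f t))
    (hss : ∀ t x, Module.finrank ℝ ((S t).Ess x) = Module.finrank ℝ ((S 0).Ess x))
    (huu : ∀ t x, Module.finrank ℝ ((S t).Euu x) = Module.finrank ℝ ((S 0).Euu x)) :
    (∃ N₀ : ℕ, ∀ N ≥ N₀, ∃ h : Diffeomorph (𝓡 d) (𝓡 d) M M r,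
      HTransverse (S 0) (S 1) h ∧ DiffIsotopic d r h (f 0)^[N] ∧
      (DiffIsotopic d r (f 0) id → DiffIsotopic d r (f 1) id ∧ DiffIsotopic d r h id)) ∧
    (∀ vol : unitInterval → Measure M, IsSmoothVolumeFamily d vol →
      (∀ t, MeasurePreserving (f t) (vol t) (vol t)) →
      (∀ x : M, vol 1 (connectedComponent x) = vol 0 (connectedComponent x)) →
      ∃ N₀ : ℕ, ∀ N ≥ N₀, ∃ h : Diffeomorph (𝓡 d) (𝓡 d) M M r,
        HTransverse (S 0) (S 1) h ∧ DiffIsotopic d r h (f 0)^[N] ∧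
        (DiffIsotopic d r (f 0) id → DiffIsotopic d r (f 1) id ∧ DiffIsotopic d r h id) ∧
        MeasurePreserving h (vol 0) (vol 1)) := by
  refine ⟨?_, fun vol hvol hpres hcomp => ?_⟩
  -- Without volumes the conjugating path is constantly the identity.
  · have hc : IsC1Path fun _ : unitInterval => Diffeomorph.refl (𝓡 d) M r := isC1Family_const hr _
    obtain ⟨N₀, h⟩ := exists_hTransverse_of_conj hr hf S hss huu hc hc rfl
    refine ⟨N₀, fun N hN => ?_⟩
    obtain ⟨k, -, hk, hiso⟩ := h N hN
    exact ⟨_, hk, hiso, DiffIsotopic.of_isotopic_id hr hf hiso⟩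
  · obtain ⟨G, hG, hG', hG0, hGf, hG1⟩ := exists_path_measurePreserving hr hf hvol hpres hcomp
    obtain ⟨N₀, h⟩ := exists_hTransverse_of_conj hr hf S hss huu hG hG' hG0
    refine ⟨N₀, fun N hN => ?_⟩
    obtain ⟨k, hkw, hk, hiso⟩ := h N hN
    -- The word `k` consists of maps preserving `vol 0`, and `G 1` carries `vol 0` to `vol 1`.
    exact ⟨_, hk, hiso, DiffIsotopic.of_isotopic_id hr hf hiso,
      hG1.comp (hkw.measurePreserving hGf)⟩
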